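/- **Setting.** Let $dA=\frac1\pi\,dx\,dy$ and $\Delta=\partial\bar\partial=\frac14(\partial_{xx}+\partial_{yy})$ on $\mathbb C$. Let $Q(z)=q(|z|)$, $q:[0,\infty)\to\mathbb R$, be lower semicontinuous with $Q(z)-2\log|z|\to\infty$ as $|z|\to\infty$. Let $\sigma$ be its equilibrium measure, i.e. the minimizer of $I_Q[\mu]=\iint\log\frac1{|z-w|}\,d\mu(z)\,d\mu(w)+\int Q\,d\mu$ over all compactly supported Borel probability measures $\mu$ on $\mathbb C$. Let $S=\operatorname{supp}\sigma$ be the droplet, $U^\sigma(z)=\int\log\frac1{|z-w|}\,d\sigma(w)$, $\gamma$ the constant value of $Q+2U^\sigma$ on $S$, and $\check Q=\gamma-2U^\sigma$ the obstacle function. Assume that * $S=\bigcup_{j=0}^N\{a_j\le|z|\le b_j\}$ with $N\ge1$ and $0\le a_0<b_0<a_1<b_1<\dots<a_N<b_N$; * $Q$ is $C^2$-smooth in a neighbourhood of $S$, $\Delta Q>0$ on $\partial S$, and $Q>\check Q$ on $\mathbb C\setminus S$; * $G=\{r_1<|z|<r_2\}$ is a gap, $r_1=b_k$, $r_2=a_{k+1}$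 for some $0\le k\le N-1$, and $Q$ is $C^6$-smooth in a neighbourhood of $\partial G$. Let $B$ be the constant such that $\check Q(z)=A+B\log|z|$ for $r_1\le|z|\le r_2$, and put $m=\lfloor Bn/2\rfloor$, $x=x(n)=\{Bn/2\}=Bn/2-m$, $\rho=r_1/r_2$, $a=\sqrt{\Delta Q(r_2)/\Delta Q(r_1)}$. Let $$K_n(z,w)=\sum_{j=0}^{n-1}\frac{p_j(z)\overline{p_j(w)}}{\|p_j\|^2},\qquad p_j(z)=z^je^{-\frac n2Q(z)},\qquad \|p_j\|^2=\int_{\mathbb C}|p_j|^2\,dA$$ (a term with $\|p_j\|=\infty$ being read as $0$). The $n$-weighted Szegő kernel of $G$ is, for $z,w\in G$, $$\mathcal S^G(z,w;n)=\frac1{2\pi}\sum_{\ell=-\infty}^{\infty}\frac{(z\bar w)^\ell}{\frac{r_1^{2\ell+1-2x}}{\sqrt{\Delta Q(r_1)}}+\frac{r_2^{2\ell+1-2x}}{\sqrt{\Delta Q(r_2)}}},$$ and for two distinct points of the circle $|z|=r_1$ it is defined by Abel summation of this series, i.e. $$\mathcal S^G(r_1e^{i\theta_1},r_1e^{i\theta_2};n)=\frac1{2\pi}\frac{\sqrt{\Delta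 Q(r_1)}}{r_1}r_1^{2x}\left(\frac1{e^{i(\theta_1-\theta_2)}-1}+\sum_{\ell=0}^\infty\frac{e^{i(\theta_1-\theta_2)\ell}}{1+a^{-1}\rho^{-(2\ell-2x+1)}}-\sum_{\ell=-\infty}^{-1}\frac{e^{i(\theta_1-\theta_2)\ell}}{1+a\rho^{2\ell-2x+1}}\right).$$ **Theorem.** Fix $0\le\theta_1,\theta_2<2\pi$ with $\theta_1\ne\theta_2$. For $s,t\in\mathbb R$ put $$z=\Big(r_1+\frac t{\sqrt{2n\Delta Q(r_1)}}\Big)e^{i\theta_1},\qquad w=\Big(r_1+\frac s{\sqrt{2n\Delta Q(r_1)}}\Big)e^{i\theta_2}.$$ Then, as $n\to\infty$, uniformly for $s,t$ in any given compact subset of $\mathbb R$, $$K_n(z,w)=\sqrt{2\pi n}\,e^{-\frac12(t^2+s^2)}\,e^{im(\theta_1-\theta_2)}\,r_1^{-2x}\,\mathcal S^G(r_1e^{i\theta_1},r_1e^{i\theta_2};n)+\mathcal O(\log^5n).$$ Moreover, when $s,t>0$ (so that $z,w\in G$ for large $n$), the same formula holds, with the same uniformity, with $\mathcal S^G(z,w;n)$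 in place of $\mathcal S^G(r_1e^{i\theta_1},r_1e^{i\theta_2};n)$. -/

import Mathlib

open MeasureTheory Filter Topology
open scoped ENNReal

noncomputable section

namespace CoulombGap

/-- The normalized area measure `dA = (1/π) dx dy` on the complex plane. -/
def area : Measure ℂ := ENNReal.ofReal (1 / Real.pi) • volume

/-- `ΔQ = ∂∂̄Q = (1/4)(∂_xx + ∂_yy) Q`, a quarter of the usual Laplacian. -/
def quarterLaplacian (Q : ℂ → ℝ) (z : ℂ) : ℝ := (1 / 4) * Laplacian.laplacian Q z

/-- The radially symmetric external potential `Q(z) = q(|z|)`. -/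
def radialPotential (q : ℝ → ℝ) (z : ℂ) : ℝ := q ‖z‖

/-! ### Weighted potential theory -/

/-- Positive part of `log (1 / |z - w|)`, equal to `+∞` on the diagonal. -/
def logKernelPos (z w : ℂ) : ℝ≥0∞ :=
  if z = w then ⊤ else ENNReal.ofReal (Real.log (1 / ‖z - w‖))

/-- Negative part of `log (1 / |z - w|)`. -/
def logKernelNeg (z w : ℂ) : ℝ≥0∞ := ENNReal.ofReal (Real.log ‖z - w‖)

/-- The weighted logarithmic energy
`I_Q[μ] = ∬ log (1 / |z - w|) dμ(z) dμ(w) + ∫ Q dμ`, as an extended real number. It is used for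
compactly supported probability measures and `Q` lower semicontinuous; then both negative parts
are finite. -/
def weightedEnergy (Q : ℂ → ℝ) (μ : Measure ℂ) : EReal :=
  (((∫⁻ z, ∫⁻ w, logKernelPos z w ∂μ ∂μ : ℝ≥0∞) : EReal)
      - ((∫⁻ z, ∫⁻ w, logKernelNeg z w ∂μ ∂μ : ℝ≥0∞) : EReal))
    + (((∫⁻ z, ENNReal.ofReal (Q z) ∂μ : ℝ≥0∞) : EReal)
      - ((∫⁻ z, ENNReal.ofReal (-Q z) ∂μ : ℝ≥0∞) : EReal))

/-- `σ` is the equilibrium measure in external potential `Q`: it minimizes the weighted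
logarithmic energy among all compactly supported Borel probability measures on `ℂ`. The droplet
is its support `σ.support`. -/
structure IsEquilibriumMeasure (Q : ℂ → ℝ) (σ : Measure ℂ) : Prop where
  isProbabilityMeasure : IsProbabilityMeasure σ
  isCompact_support : IsCompact σ.support
  energy_le : ∀ μ : Measure ℂ, IsProbabilityMeasure μ → IsCompact μ.support →
    weightedEnergy Q σ ≤ weightedEnergy Q μ

/-- The logarithmic potential `U^μ(z) = ∫ log (1 / |z - w|) dμ(w)`. -/
def logPotential (μ : Measure ℂ) (z : ℂ) : ℝ := ∫ w, Real.log (1 / ‖z - w‖) ∂μ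

/-- Robin's constant `γ`, i.e. the constant value of `Q + 2 U^σ` on the droplet, obtained by
averaging that function against the equilibrium measure `σ`. -/
def robinConstant (Q : ℂ → ℝ) (σ : Measure ℂ) : ℝ := ∫ z, (Q z + 2 * logPotential σ z) ∂σ

/-- The obstacle function `Q̌ = γ - 2 U^σ`. -/
def obstacle (Q : ℂ → ℝ) (σ : Measure ℂ) (z : ℂ) : ℝ :=
  robinConstant Q σ - 2 * logPotential σ z

/-- The gap `G = {r₁ < |z| < r₂}`. -/
def gap (r₁ r₂ : ℝ) : Set ℂ := {z | r₁ < ‖z‖ ∧ ‖z‖ < r₂}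

/-- The standing assumptions: `Q(z) = q(|z|)` is an admissible radial potential with equilibrium
measure `σ`, the droplet is the union of the annuli `a j ≤ |z| ≤ b j`, `0 ≤ j ≤ N`, and
`{b k < |z| < a (k+1)}` is one of its gaps. -/
structure IsGapPotential (q : ℝ → ℝ) (σ : Measure ℂ) (N : ℕ) (a b : ℕ → ℝ) (k : ℕ) : Prop where
  lowerSemicontinuous : LowerSemicontinuous (radialPotential q)
  growth : Tendsto (fun z : ℂ => radialPotential q z - 2 * Real.log ‖z‖) (cocompact ℂ) atTop
  equilibrium : IsEquilibriumMeasure (radialPotential q) σ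
  zero_le : 0 ≤ a 0
  radii_lt : ∀ j ≤ N, a j < b j
  radii_lt_succ : ∀ j < N, b j < a (j + 1)
  droplet_eq : σ.support = ⋃ j ∈ Finset.range (N + 1), {z : ℂ | a j ≤ ‖z‖ ∧ ‖z‖ ≤ b j}
  contDiff_two : ∃ W : Set ℂ, IsOpen W ∧ σ.support ⊆ W ∧ ContDiffOn ℝ 2 (radialPotential q) W
  laplacian_pos : ∀ z ∈ frontier σ.support, 0 < quarterLaplacian (radialPotential q) z
  obstacle_lt : ∀ z ∉ σ.support, obstacle (radialPotential q) σ z < radialPotential q z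
  gap_index : k < N
  contDiff_six : ∃ W : Set ℂ, IsOpen W ∧ frontier (gap (b k) (a (k + 1))) ⊆ W ∧
    ContDiffOn ℝ 6 (radialPotential q) W

/-- The constant `B` for which the obstacle function has the form `Q̌(z) = A + B log |z|` on the
closed gap `r₁ ≤ |z| ≤ r₂`. -/
def gapSlope (q : ℝ → ℝ) (σ : Measure ℂ) (r₁ r₂ : ℝ) : ℝ :=
  (obstacle (radialPotential q) σ (r₂ : ℂ) - obstacle (radialPotential q) σ (r₁ : ℂ)) /
    (Real.log r₂ - Real.log r₁)

/-! ### The correlation kernel -/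

/-- The weighted monomial `p_j(z) = z^j e^{-n Q(z) / 2}`. -/
def weightedMonomial (Q : ℂ → ℝ) (n j : ℕ) (z : ℂ) : ℂ :=
  z ^ j * (Real.exp (-((n : ℝ) / 2) * Q z) : ℂ)

/-- The squared norm `‖p_j‖²` in `L²(ℂ, dA)`. -/
def monomialNormSq (Q : ℂ → ℝ) (n j : ℕ) : ℝ := ∫ z, ‖weightedMonomial Q n j z‖ ^ 2 ∂area

/-- The canonical correlation kernel `K_n(z,w) = ∑_{j<n} p_j(z) conj(p_j(w)) / ‖p_j‖²` of the
radially symmetric potential `Q`. If some `p_j` is not square integrable, then its squared norm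
is `0` by convention and the corresponding term vanishes, so that the sum is in every case the
reproducing kernel of the space of square integrable weighted polynomials of degree `< n`. -/
def correlationKernel (Q : ℂ → ℝ) (n : ℕ) (z w : ℂ) : ℂ :=
  ∑ j ∈ Finset.range n,
    weightedMonomial Q n j z * (starRingEnd ℂ) (weightedMonomial Q n j w) /
      (monomialNormSq Q n j : ℂ)

/-! ### The weighted Szegő kernel -/

/-- The weighted Szegő kernel of the gap `r₁ < |z| < r₂`, for `z, w` in the gap:
`(1/2π) ∑_{ℓ ∈ ℤ} (z conj w)^ℓ / (r₁^(2ℓ+1-2x) / √ΔQ(r₁) + r₂^(2ℓ+1-2x) / √ΔQ(r₂))`. -/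
def szegoGap (Q : ℂ → ℝ) (r₁ r₂ x : ℝ) (z w : ℂ) : ℂ :=
  (1 / (2 * Real.pi) : ℝ) * ∑' l : ℤ, (z * (starRingEnd ℂ) w) ^ l /
    ((r₁ ^ (2 * (l : ℝ) + 1 - 2 * x) / Real.sqrt (quarterLaplacian Q (r₁ : ℂ))
      + r₂ ^ (2 * (l : ℝ) + 1 - 2 * x) / Real.sqrt (quarterLaplacian Q (r₂ : ℂ)) : ℝ) : ℂ)

/-- The weighted Szegő kernel at the boundary points `r₁ e^{iθ₁}, r₁ e^{iθ₂}`, given by the Abel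
sum of the above series, with `ρ = r₁ / r₂`, `α = √(ΔQ(r₂) / ΔQ(r₁))` and `φ = θ₁ - θ₂`:
`(1/2π) (√ΔQ(r₁) / r₁) r₁^(2x) (1 / (e^{iφ} - 1) + ∑_{ℓ ≥ 0} e^{iφℓ} / (1 + α⁻¹ ρ^(-(2ℓ-2x+1)))
- ∑_{ℓ ≤ -1} e^{iφℓ} / (1 + α ρ^(2ℓ-2x+1)))`.
The last sum is written over `l : ℕ` with `ℓ = -(l + 1)`. -/
def szegoInner (Q : ℂ → ℝ) (r₁ r₂ x θ₁ θ₂ : ℝ) : ℂ :=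
  let ρ : ℝ := r₁ / r₂
  let α : ℝ :=
    Real.sqrt (quarterLaplacian Q (r₂ : ℂ) / quarterLaplacian Q (r₁ : ℂ))
  let e : ℤ → ℂ := fun l => Complex.exp (Complex.I * ((θ₁ - θ₂ : ℝ) : ℂ) * (l : ℂ))
  (1 / (2 * Real.pi) * (Real.sqrt (quarterLaplacian Q (r₁ : ℂ)) / r₁) * r₁ ^ (2 * x) : ℝ) *
    (1 / (Complex.exp (Complex.I * ((θ₁ - θ₂ : ℝ) : ℂ)) - 1)
      + ∑' l : ℕ, e (l : ℤ) /
          ((1 + α⁻¹ * ρ ^ (-(2 * (l : ℝ) - 2 * x + 1)) : ℝ) : ℂ)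
      - ∑' l : ℕ, e (-((l : ℤ) + 1)) /
          ((1 + α * ρ ^ (2 * (-((l : ℝ) + 1)) - 2 * x + 1) : ℝ) : ℂ))

/-- The point `(r + t / √(2 n ΔQ(r))) e^{iθ}` at microscopic distance from the circle
`|z| = r`. -/
def edgePoint (Q : ℂ → ℝ) (n : ℕ) (r t θ : ℝ) : ℂ :=
  ((r + t / Real.sqrt (2 * n * quarterLaplacian Q (r : ℂ)) : ℝ) : ℂ) *
    Complex.exp (Complex.I * (θ : ℂ))

/-- The factor `√(2πn) e^{-(t²+s²)/2} e^{i(θ₁-θ₂)m} r₁^{-2x}`, with `m = ⌊y⌋` and `x = {y}`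
(used for `y = B n / 2`). -/
def edgePrefactor (n : ℕ) (r₁ y s t θ₁ θ₂ : ℝ) : ℂ :=
  (Real.sqrt (2 * Real.pi * n) * Real.exp (-(t ^ 2 + s ^ 2) / 2) : ℝ) *
    Complex.exp (Complex.I * ((θ₁ - θ₂ : ℝ) : ℂ) * ((⌊y⌋ : ℤ) : ℂ)) *
    (r₁ ^ (-(2 * Int.fract y)) : ℝ)

end CoulombGap

end

/-! Write `y = log r`, `y₁ = log r₁`, `y₂ = log r₂`, `d = y₂ - y₁`, `τ = j - B n / 2`, `ω = e^{i(θ₁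
- θ₂)}`. Subtracting from `q(e^y)` the linear function that the obstacle follows across the gap
leaves a profile `v ≥ 0` with nondegenerate zeros at `y₁` and `y₂`, positive elsewhere and growing
at least linearly: a double well (`exists_doubleWell`). Up to a factor independent of `j`, `‖p_j‖²`
is the moment `∫ exp((2τ + 2) y - n v(y)) dy`, so the kernel is a Gaussian prefactor times `∑ ω^j
f(j)` with `f(j) = coeff v n Y τ` and `Y` within `O(n^{-1/2})` of `2 y₁` (`correlationKernel_eq`).

The well comes from potential theory. The variational inequality is tested only against uniform
measures on circles, whose potentials are explicit. Small circles give `Q + 2 U^σ = γ` on all of the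
droplet. Circles about the origin compare `q` with the circular mean of the obstacle. That mean is
linear in `log r` over the gap with slope `B = 2 σ{|w| ≤ r₁}`, so `0 < B < 2` and the critical index
`B n / 2` lies well inside `[0, n)`.

For `|τ|` small against `√n`, Laplace's method sees both wells, and `f(j)` is `√n` times a constant
times `1 / (1 + κ e^{(2τ + 2) d})`, with error `O(1 + |τ|)` (`exists_coeff_asymp`). This is the
summand of the Szegő kernel. To the right `f` decays exponentially and is summed in absolute value.
To the left the coefficients may stay of order `√n` over about `√n` indices, and only the
oscillation of `ω^j`, `ω ≠ 1`, makes their sum small.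

That oscillation is exploited without expanding the norms one by one. By Cauchy–Schwarz the moments
are log-convex, so `f` is log-concave (`coeff_mul_le`) and its successive ratios decrease. Two
summations by parts reduce the sum to a boundary term plus the second variation of `f`, which is
controlled by the two extreme ratios (`sum_abs_second_diff_le`). Both are `1 + O(log n / √n)`: the
right one by Laplace asymptotics at two adjacent indices, the left one because a larger ratio would
force too much growth over the preceding `2 √n log n` indices (`norm_sum_window_le`). The surviving
boundary term `ω^q f(q) / (ω - 1)` is what turns the truncated central sum into the Abel sum
(`norm_sum_sub_szegoSeries_le`). The total error is `O(log³ n)`.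

For points inside the gap, the bilateral Szegő series is the same function evaluated at `ω y` with
`0 < y - 1 = O(n^{-1/2})`. It is Lipschitz there, so after multiplication by `√n` the change is
bounded. -/

namespace CoulombGap

/-! ### The uniform measure on a circle -/

/-- The uniform probability measure on the circle of centre `c` and radius `r`. -/
noncomputable def circleMeasure (c : ℂ) (r : ℝ) : Measure ℂ :=
  (ENNReal.ofReal (2 * Real.pi)⁻¹ • volume.restrict (Set.Ioc 0 (2 * Real.pi))).map (circleMap c r)

lemma measurable_circleMap (c : ℂ) (r : ℝ) : Measurable (circleMap c r) :=
  (continuous_circleMap c r).measurable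

instance isProbabilityMeasure_circleMeasure (c : ℂ) (r : ℝ) :
    IsProbabilityMeasure (circleMeasure c r) := by
  have : IsProbabilityMeasure
      (ENNReal.ofReal (2 * Real.pi)⁻¹ • volume.restrict (Set.Ioc 0 (2 * Real.pi))) := by
    constructor
    have hp : 0 < 2 * Real.pi := by positivity
    simp only [Measure.smul_apply, Measure.restrict_apply_univ, Real.volume_Ioc, sub_zero,
      smul_eq_mul]
    rw [← ENNReal.ofReal_mul (by positivity), inv_mul_cancel₀ hp.ne', ENNReal.ofReal_one]
  exact Measure.isProbabilityMeasure_map (measurable_circleMap c r).aemeasurable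

lemma ae_circleMeasure (c : ℂ) {r : ℝ} (hr : 0 ≤ r) : ∀ᵐ z ∂circleMeasure c r, ‖z - c‖ = r := by
  rw [circleMeasure, ae_map_iff (measurable_circleMap c r).aemeasurable
    (measurableSet_eq_fun (by fun_prop) (by fun_prop))]
  refine Eventually.of_forall fun θ => ?_
  simp [circleMap, abs_of_nonneg hr]

lemma integral_circleMeasure {f : ℂ → ℝ} (hf : Measurable f) (c : ℂ) (r : ℝ) :
    ∫ z, f z ∂circleMeasure c r = Real.circleAverage f c r := by
  have hp : 0 < 2 * Real.pi := by positivity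
  rw [circleMeasure, integral_map (measurable_circleMap c r).aemeasurable
    hf.aestronglyMeasurable, integral_smul_measure, Real.circleAverage,
    intervalIntegral.integral_of_le hp.le, ENNReal.toReal_ofReal (by positivity)]

lemma integrable_circleMeasure {f : ℂ → ℝ} (hf : Measurable f) {c : ℂ} {r : ℝ}
    (h : CircleIntegrable f c r) : Integrable f (circleMeasure c r) := by
  have hp : 0 < 2 * Real.pi := by positivity
  rw [circleMeasure, integrable_map_measure hf.aestronglyMeasurable
    (measurable_circleMap c r).aemeasurable]
  refine Integrable.smul_measure ?_ ENNReal.ofReal_ne_top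
  exact (intervalIntegrable_iff_integrableOn_Ioc_of_le hp.le).1 h

lemma measurable_log_norm_sub (w : ℂ) : Measurable fun z : ℂ => Real.log ‖z - w‖ := by fun_prop

lemma integrable_log_circleMeasure (c w : ℂ) (r : ℝ) :
    Integrable (fun z => Real.log ‖z - w‖) (circleMeasure c r) :=
  integrable_circleMeasure (measurable_log_norm_sub w) (circleIntegrable_log_norm_sub_const r)

/-- The potential of a circle is constant inside and logarithmic outside. In particular it is
bounded below and continuous, which is what makes circles convenient test measures. -/
lemma integral_log_circleMeasure (c w : ℂ) {r : ℝ} (hr : 0 < r) :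
    ∫ z, Real.log ‖z - w‖ ∂circleMeasure c r = Real.log (max r ‖w - c‖) := by
  rw [integral_circleMeasure (measurable_log_norm_sub w),
    circleAverage_log_norm_sub_const_eq_log_radius_add_posLog hr.ne',
    Real.posLog_eq_log_max_one (by positivity), ← Real.log_mul hr.ne' (by positivity),
    mul_max_of_nonneg _ _ hr.le, mul_one, mul_inv_cancel_left₀ hr.ne', norm_sub_rev]

lemma circleMeasure_singleton (c w : ℂ) {r : ℝ} (hr : 0 < r) : circleMeasure c r {w} = 0 := by
  rw [circleMeasure, Measure.map_apply (measurable_circleMap c r) (measurableSet_singleton w),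
    Measure.smul_apply, Measure.restrict_apply
      (measurable_circleMap c r (measurableSet_singleton w))]
  have : (circleMap c r ⁻¹' {w} ∩ Set.Ioc 0 (2 * Real.pi)).Subsingleton := by
    rintro x ⟨hx, hx'⟩ y ⟨hy, hy'⟩
    exact injOn_circleMap_of_abs_sub_le hr.ne' (a := 0) (b := 2 * Real.pi) (by
      rw [zero_sub, abs_neg, abs_of_pos (by positivity)])
      (by rwa [Set.uIoc_of_le (by positivity)]) (by rwa [Set.uIoc_of_le (by positivity)])
      (by rw [Set.mem_preimage, Set.mem_singleton_iff] at hx hy; rw [hx, hy])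
  rw [this.measure_zero]
  simp

lemma support_circleMeasure_subset (c : ℂ) {r : ℝ} (hr : 0 ≤ r) :
    (circleMeasure c r).support ⊆ Metric.sphere c r := by
  refine Measure.support_subset_of_isClosed Metric.isClosed_sphere ?_
  filter_upwards [ae_circleMeasure c hr] with z hz
  simpa [dist_eq_norm] using hz

/-- The bound is affine in `Real.log x`, so it can be integrated by the mean value formula on a
circle. It also covers `x = 0`, where `Real.log 0 = 0`. -/
lemma abs_log_le {x R : ℝ} (hx : 0 ≤ x) (hxR : x ≤ R) (hR : 1 ≤ R) :
    |Real.log x| ≤ 2 * Real.log R - Real.log x := by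
  have h0 : 0 ≤ Real.log R := Real.log_nonneg hR
  have h1 : Real.log x ≤ Real.log R := by
    rcases hx.eq_or_lt with rfl | hx
    · simpa using h0
    · exact Real.log_le_log hx hxR
  rw [abs_le]; constructor <;> linarith

lemma measurable_log_norm_prod : Measurable fun p : ℂ × ℂ => Real.log ‖p.1 - p.2‖ := by fun_prop

/-- The logarithmic kernel is integrable for the product of a measure of bounded support with the
uniform measure of a circle. -/
lemma integrable_log_prod_circleMeasure {μ : Measure ℂ} [IsProbabilityMeasure μ] {R : ℝ}
    (hμ : ∀ᵐ z ∂μ, ‖z‖ ≤ R) (c : ℂ) {r : ℝ} (hr : 0 < r) :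
    Integrable (fun p : ℂ × ℂ => Real.log ‖p.1 - p.2‖) (μ.prod (circleMeasure c r)) := by
  rw [integrable_prod_iff measurable_log_norm_prod.aestronglyMeasurable]
  have hint : ∀ z : ℂ, Integrable (fun w => Real.log ‖z - w‖) (circleMeasure c r) := fun z => by
    simpa only [norm_sub_rev] using integrable_log_circleMeasure c z r
  refine ⟨Eventually.of_forall hint, ?_⟩
  -- `R'` bounds `‖z - w‖` for `‖z‖ ≤ R` and `w` on the circle; the summand `1` makes `log R' ≥ 0`.
  set R' : ℝ := 1 + |R| + ‖c‖ + r with hR'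
  have hR'1 : 1 ≤ R' := by have := abs_nonneg R; have := norm_nonneg c; linarith
  refine Integrable.mono' (g := fun _ => 2 * Real.log R' - Real.log r) (integrable_const _) ?_ ?_
  · exact measurable_log_norm_prod.norm.stronglyMeasurable.integral_prod_right'.aestronglyMeasurable
  · filter_upwards [hμ] with z hz
    rw [Real.norm_of_nonneg (integral_nonneg fun _ => norm_nonneg _)]
    have h1 : ∀ᵐ w ∂circleMeasure c r, ‖Real.log ‖z - w‖‖ ≤ 2 * Real.log R' - Real.log ‖z - w‖ := by
      filter_upwards [ae_circleMeasure c hr.le] with w hw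
      refine abs_log_le (norm_nonneg _) ?_ hR'1
      have h2 : ‖z - w‖ ≤ ‖z‖ + ‖c‖ + ‖w - c‖ := by
        have : z - w = z - c - (w - c) := by ring
        rw [this]
        exact (norm_sub_le _ _).trans (by gcongr; exact norm_sub_le _ _)
      have := le_abs_self R
      linarith
    refine (integral_mono_ae (hint z).norm ((integrable_const _).sub (hint z)) h1).trans ?_
    have h3 : ∫ w, Real.log ‖z - w‖ ∂circleMeasure c r = Real.log (max r ‖z - c‖) := by
      rw [← integral_log_circleMeasure c z hr]
      exact integral_congr_ae (Eventually.of_forall fun w => by simp only [norm_sub_rev])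
    simp only [Pi.sub_apply]
    rw [integral_sub (integrable_const _) (hint z), h3, integral_const]
    have := Real.log_le_log hr (le_max_left r ‖z - c‖)
    simp only [probReal_univ, one_smul]
    linarith

lemma integral_log_prod_circleMeasure {μ : Measure ℂ} [IsProbabilityMeasure μ] {R : ℝ}
    (hμ : ∀ᵐ z ∂μ, ‖z‖ ≤ R) (c : ℂ) {r : ℝ} (hr : 0 < r) :
    ∫ p : ℂ × ℂ, Real.log ‖p.1 - p.2‖ ∂(μ.prod (circleMeasure c r)) =
      ∫ z, Real.log (max r ‖z - c‖) ∂μ := by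
  rw [integral_prod _ (integrable_log_prod_circleMeasure hμ c hr)]
  refine integral_congr_ae (Eventually.of_forall fun z => ?_)
  beta_reduce
  rw [← integral_log_circleMeasure c z hr]
  exact integral_congr_ae (Eventually.of_forall fun w => by simp only [norm_sub_rev])

lemma integrable_log_circleMeasure_prod {μ : Measure ℂ} [IsProbabilityMeasure μ] {R : ℝ}
    (hμ : ∀ᵐ z ∂μ, ‖z‖ ≤ R) (c : ℂ) {r : ℝ} (hr : 0 < r) :
    Integrable (fun p : ℂ × ℂ => Real.log ‖p.1 - p.2‖) ((circleMeasure c r).prod μ) := by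
  have := (integrable_log_prod_circleMeasure hμ c hr).swap
  refine this.congr (Eventually.of_forall fun p => ?_)
  simp [norm_sub_rev]

lemma integral_log_circleMeasure_prod {μ : Measure ℂ} [IsProbabilityMeasure μ] {R : ℝ}
    (hμ : ∀ᵐ z ∂μ, ‖z‖ ≤ R) (c : ℂ) {r : ℝ} (hr : 0 < r) :
    ∫ p : ℂ × ℂ, Real.log ‖p.1 - p.2‖ ∂((circleMeasure c r).prod μ) =
      ∫ z, Real.log (max r ‖z - c‖) ∂μ := by
  rw [← integral_log_prod_circleMeasure hμ c hr, ← integral_prod_swap]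
  exact integral_congr_ae (Eventually.of_forall fun w => by simp [norm_sub_rev])

/-! ### Weighted energies as real numbers -/

lemma measurable_logKernelPos : Measurable fun p : ℂ × ℂ => logKernelPos p.1 p.2 := by
  unfold logKernelPos
  exact Measurable.ite (measurableSet_eq_fun measurable_fst measurable_snd) measurable_const
    (by fun_prop)

lemma measurable_logKernelNeg : Measurable fun p : ℂ × ℂ => logKernelNeg p.1 p.2 := by
  unfold logKernelNeg
  fun_prop

lemma logKernelPos_of_ne {z w : ℂ} (h : z ≠ w) :
    logKernelPos z w = ENNReal.ofReal (-Real.log ‖z - w‖) := by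
  rw [logKernelPos, if_neg h, one_div, Real.log_inv]

lemma lintegral_logKernelPos (μ : Measure ℂ) [SFinite μ] :
    ∫⁻ z, ∫⁻ w, logKernelPos z w ∂μ ∂μ = ∫⁻ p, logKernelPos p.1 p.2 ∂(μ.prod μ) :=
  (lintegral_prod _ measurable_logKernelPos.aemeasurable).symm

lemma lintegral_logKernelNeg (μ : Measure ℂ) [SFinite μ] :
    ∫⁻ z, ∫⁻ w, logKernelNeg z w ∂μ ∂μ = ∫⁻ p, logKernelNeg p.1 p.2 ∂(μ.prod μ) :=
  (lintegral_prod _ measurable_logKernelNeg.aemeasurable).symm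

lemma coe_lintegral_sub_coe_lintegral {α : Type*} [MeasurableSpace α] {μ : Measure α} {f : α → ℝ}
    (hf : Integrable f μ) :
    ((∫⁻ x, ENNReal.ofReal (f x) ∂μ : ℝ≥0∞) : EReal)
      - ((∫⁻ x, ENNReal.ofReal (-f x) ∂μ : ℝ≥0∞) : EReal) = ((∫ x, f x ∂μ : ℝ) : EReal) := by
  have h1 : ∫⁻ x, ENNReal.ofReal (f x) ∂μ ≠ ⊤ := hf.lintegral_lt_top.ne
  have h2 : ∫⁻ x, ENNReal.ofReal (-f x) ∂μ ≠ ⊤ := hf.neg.lintegral_lt_top.ne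
  rw [integral_eq_lintegral_pos_part_sub_lintegral_neg_part hf, EReal.coe_sub,
    EReal.coe_ennreal_toReal h1, EReal.coe_ennreal_toReal h2]

lemma ae_ne_of_measure_diagonal {μ : Measure (ℂ × ℂ)} (hd : μ {p : ℂ × ℂ | p.1 = p.2} = 0) :
    ∀ᵐ p ∂μ, p.1 ≠ p.2 := by
  rw [ae_iff]
  simpa using hd

/-- The kernels `logKernelPos` and `logKernelNeg` are the two parts of `-Real.log ‖z - w‖` except on
the diagonal, where the first is `⊤`. Once the diagonal is null the extended energy is an ordinary
integral. -/
lemma weightedEnergy_eq {Q : ℂ → ℝ} {μ : Measure ℂ} [IsProbabilityMeasure μ]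
    (hl : Integrable (fun p : ℂ × ℂ => Real.log ‖p.1 - p.2‖) (μ.prod μ))
    (hd : (μ.prod μ) {p : ℂ × ℂ | p.1 = p.2} = 0) (hQ : Integrable Q μ) :
    weightedEnergy Q μ =
      ((-∫ p : ℂ × ℂ, Real.log ‖p.1 - p.2‖ ∂(μ.prod μ) + ∫ z, Q z ∂μ : ℝ) : EReal) := by
  have h1 : ∫⁻ p, logKernelPos p.1 p.2 ∂(μ.prod μ) =
      ∫⁻ p : ℂ × ℂ, ENNReal.ofReal (-Real.log ‖p.1 - p.2‖) ∂(μ.prod μ) := by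
    refine lintegral_congr_ae ?_
    filter_upwards [ae_ne_of_measure_diagonal hd] with p hp using logKernelPos_of_ne hp
  have h2 : ∫⁻ p, logKernelNeg p.1 p.2 ∂(μ.prod μ) =
      ∫⁻ p : ℂ × ℂ, ENNReal.ofReal (-(-Real.log ‖p.1 - p.2‖)) ∂(μ.prod μ) := by
    simp only [neg_neg, logKernelNeg]
  have h3 := coe_lintegral_sub_coe_lintegral hl.neg
  simp only [Pi.neg_apply] at h3
  rw [weightedEnergy, lintegral_logKernelPos, lintegral_logKernelNeg, h1, h2, h3,
    coe_lintegral_sub_coe_lintegral hQ, ← EReal.coe_add, integral_neg]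

lemma lintegral_ofReal_ne_top {α : Type*} [MeasurableSpace α] {μ : Measure α} [IsFiniteMeasure μ]
    {f : α → ℝ} {C : ℝ} (h : ∀ᵐ x ∂μ, f x ≤ C) : ∫⁻ x, ENNReal.ofReal (f x) ∂μ ≠ ⊤ := by
  refine ((lintegral_mono_ae (g := fun _ => ENNReal.ofReal C) ?_).trans_lt ?_).ne
  · filter_upwards [h] with x hx using ENNReal.ofReal_le_ofReal hx
  · rw [lintegral_const]
    exact ENNReal.mul_lt_top ENNReal.ofReal_lt_top (measure_lt_top _ _)

lemma integrable_of_lintegral_ofReal_ne_top {α : Type*} [MeasurableSpace α] {μ : Measure α}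
    {f : α → ℝ} (hf : AEStronglyMeasurable f μ) (h1 : ∫⁻ x, ENNReal.ofReal (f x) ∂μ ≠ ⊤)
    (h2 : ∫⁻ x, ENNReal.ofReal (-f x) ∂μ ≠ ⊤) : Integrable f μ := by
  have hp : Integrable (fun x => max (f x) 0) μ := by
    refine (lintegral_ofReal_ne_top_iff_integrable (hf.sup aestronglyMeasurable_const)
      (Eventually.of_forall fun x => le_max_right (f x) 0)).1 ?_
    simpa [ENNReal.ofReal_max] using h1
  have hn : Integrable (fun x => max (-f x) 0) μ := by
    refine (lintegral_ofReal_ne_top_iff_integrable (hf.neg.sup aestronglyMeasurable_const)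
      (Eventually.of_forall fun x => le_max_right (-f x) 0)).1 ?_
    simpa [ENNReal.ofReal_max] using h2
  refine (hp.sub hn).congr (Eventually.of_forall fun x => ?_)
  simp only [Pi.sub_apply]
  rcases le_total (f x) 0 with h | h
  · rw [max_eq_right h, max_eq_left (by linarith)]; ring
  · rw [max_eq_left h, max_eq_right (by linarith)]; ring

/-- A measure of bounded support and finite energy has integrable logarithmic kernel and
potential, and the diagonal is a null set for its square. -/
lemma integrable_of_weightedEnergy_lt_top {Q : ℂ → ℝ} (hQm : Measurable Q) {μ : Measure ℂ}
    [IsProbabilityMeasure μ] {R M : ℝ} (hR : ∀ᵐ z ∂μ, ‖z‖ ≤ R) (hM : ∀ᵐ z ∂μ, -M ≤ Q z)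
    (h : weightedEnergy Q μ < ⊤) :
    Integrable (fun p : ℂ × ℂ => Real.log ‖p.1 - p.2‖) (μ.prod μ) ∧
      (μ.prod μ) {p : ℂ × ℂ | p.1 = p.2} = 0 ∧ Integrable Q μ := by
  have hRR : ∀ᵐ p ∂(μ.prod μ), Real.log ‖p.1 - p.2‖ ≤ |Real.log (2 * R)| := by
    have h1 : ∀ᵐ p ∂(μ.prod μ), ‖p.1‖ ≤ R := Measure.quasiMeasurePreserving_fst.ae hR
    have h2 : ∀ᵐ p ∂(μ.prod μ), ‖p.2‖ ≤ R := Measure.quasiMeasurePreserving_snd.ae hR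
    filter_upwards [h1, h2] with p hp1 hp2
    rcases (norm_nonneg (p.1 - p.2)).eq_or_lt with h0 | h0
    · rw [← h0, Real.log_zero]; positivity
    · exact (Real.log_le_log h0 ((norm_sub_le _ _).trans (by linarith))).trans (le_abs_self _)
  have hN : ∫⁻ p, logKernelNeg p.1 p.2 ∂(μ.prod μ) ≠ ⊤ := lintegral_ofReal_ne_top hRR
  have hQN : ∫⁻ z, ENNReal.ofReal (-Q z) ∂μ ≠ ⊤ :=
    lintegral_ofReal_ne_top (C := M) (by filter_upwards [hM] with z hz; linarith)
  rw [weightedEnergy, lintegral_logKernelPos, lintegral_logKernelNeg] at h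
  -- Both negative parts are finite, so neither difference in the energy is `⊥`, and an infinite
  -- positive part cannot be hidden by a sum `⊤ + ⊥`.
  have hsub : ∀ x y : ℝ≥0∞, y ≠ ⊤ → (x : EReal) - (y : EReal) ≠ ⊥ ∧
      (x = ⊤ → (x : EReal) - (y : EReal) = ⊤) := by
    intro x y hy
    rw [← EReal.coe_ennreal_toReal hy]
    refine ⟨?_, ?_⟩
    · induction x with
      | top => simp
      | coe x =>
        rw [← EReal.coe_ennreal_toReal ENNReal.coe_ne_top, ← EReal.coe_sub]
        exact EReal.coe_ne_bot _
    · rintro rfl; simp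
  have hP : ∫⁻ p, logKernelPos p.1 p.2 ∂(μ.prod μ) ≠ ⊤ := by
    intro hP
    rw [(hsub _ _ hN).2 hP, EReal.top_add_of_ne_bot (hsub _ _ hQN).1] at h
    exact lt_irrefl _ h
  have hQP : ∫⁻ z, ENNReal.ofReal (Q z) ∂μ ≠ ⊤ := by
    intro hQP
    rw [(hsub _ _ hQN).2 hQP, EReal.add_top_of_ne_bot (hsub _ _ hN).1] at h
    exact lt_irrefl _ h
  have hd : (μ.prod μ) {p : ℂ × ℂ | p.1 = p.2} = 0 := by
    have h1 : ∀ᵐ p ∂(μ.prod μ), logKernelPos p.1 p.2 < ⊤ :=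
      ae_lt_top measurable_logKernelPos hP
    refine measure_mono_null ?_ (ae_iff.1 h1)
    intro p hp
    simp only [Set.mem_ofPred_eq] at hp ⊢
    simp [logKernelPos, hp]
  refine ⟨?_, hd, integrable_of_lintegral_ofReal_ne_top hQm.aestronglyMeasurable hQP hQN⟩
  refine integrable_of_lintegral_ofReal_ne_top measurable_log_norm_prod.aestronglyMeasurable hN ?_
  rw [← lintegral_congr_ae (f := fun p : ℂ × ℂ => logKernelPos p.1 p.2)]
  · exact hP
  · filter_upwards [ae_ne_of_measure_diagonal hd] with p hp using logKernelPos_of_ne hp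

/-! ### Perturbing the minimizer towards a circle -/

lemma prod_circleMeasure_diagonal (μ : Measure ℂ) [SFinite μ] (c : ℂ) {r : ℝ} (hr : 0 < r) :
    (μ.prod (circleMeasure c r)) {p : ℂ × ℂ | p.1 = p.2} = 0 := by
  rw [Measure.prod_apply (measurableSet_eq_fun measurable_fst measurable_snd)]
  refine (lintegral_congr fun z => ?_).trans lintegral_zero
  rw [show Prod.mk z ⁻¹' {p : ℂ × ℂ | p.1 = p.2} = {z} by ext w; simp [eq_comm]]
  exact circleMeasure_singleton c z hr

lemma circleMeasure_prod_diagonal (μ : Measure ℂ) [SFinite μ] (c : ℂ) {r : ℝ} (hr : 0 < r) :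
    ((circleMeasure c r).prod μ) {p : ℂ × ℂ | p.1 = p.2} = 0 := by
  rw [Measure.prod_apply_symm (measurableSet_eq_fun measurable_fst measurable_snd)]
  refine (lintegral_congr fun z => ?_).trans lintegral_zero
  rw [show (fun x => (x, z)) ⁻¹' {p : ℂ × ℂ | p.1 = p.2} = {z} by ext w; simp]
  exact circleMeasure_singleton c z hr

/-- The convex combination `(1 - ε) μ + ε ν`. -/
noncomputable def mixture (μ ν : Measure ℂ) (ε : ℝ) : Measure ℂ :=
  ENNReal.ofReal (1 - ε) • μ + ENNReal.ofReal ε • ν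

lemma isProbabilityMeasure_mixture (μ ν : Measure ℂ) [IsProbabilityMeasure μ]
    [IsProbabilityMeasure ν] {ε : ℝ} (h0 : 0 < ε) (h1 : ε < 1) :
    IsProbabilityMeasure (mixture μ ν ε) := by
  constructor
  simp only [mixture, Measure.add_apply, Measure.smul_apply, measure_univ, smul_eq_mul, mul_one]
  rw [← ENNReal.ofReal_add (by linarith) h0.le]
  simp

lemma mixture_prod (μ ν : Measure ℂ) [IsProbabilityMeasure μ] [IsProbabilityMeasure ν] (ε : ℝ) :
    (mixture μ ν ε).prod (mixture μ ν ε) =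
      ENNReal.ofReal (1 - ε) • ENNReal.ofReal (1 - ε) • μ.prod μ
      + ENNReal.ofReal (1 - ε) • ENNReal.ofReal ε • ν.prod μ
      + (ENNReal.ofReal ε • ENNReal.ofReal (1 - ε) • μ.prod ν
      + ENNReal.ofReal ε • ENNReal.ofReal ε • ν.prod ν) := by
  have : ∀ c : ℝ, IsFiniteMeasure (ENNReal.ofReal c • ν) := fun c =>
    Measure.smul_finite ν ENNReal.ofReal_ne_top
  have : ∀ c : ℝ, IsFiniteMeasure (ENNReal.ofReal c • μ) := fun c =>
    Measure.smul_finite μ ENNReal.ofReal_ne_top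
  simp only [mixture, Measure.prod_add, Measure.add_prod, Measure.prod_smul_left,
    Measure.prod_smul_right, smul_add]

/-- The variational inequality of the equilibrium measure, tested against circles. -/
lemma robin_le_of_energy_le {Q : ℂ → ℝ} {σ : Measure ℂ} [IsProbabilityMeasure σ]
    (hmin : ∀ μ : Measure ℂ, IsProbabilityMeasure μ → IsCompact μ.support →
      weightedEnergy Q σ ≤ weightedEnergy Q μ) (hS : IsCompact σ.support)
    (hl : Integrable (fun p : ℂ × ℂ => Real.log ‖p.1 - p.2‖) (σ.prod σ))
    (hd : (σ.prod σ) {p : ℂ × ℂ | p.1 = p.2} = 0) (hQ : Integrable Q σ)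
    {R : ℝ} (hR : ∀ᵐ z ∂σ, ‖z‖ ≤ R) (c : ℂ) {r : ℝ} (hr : 0 < r)
    (hQc : Integrable Q (circleMeasure c r)) :
    ∫ z, Q z ∂σ - 2 * ∫ p : ℂ × ℂ, Real.log ‖p.1 - p.2‖ ∂(σ.prod σ) ≤
      ∫ z, Q z ∂(circleMeasure c r) - 2 * ∫ z, Real.log (max r ‖z - c‖) ∂σ := by
  set ν := circleMeasure c r with hν
  have hRν : ∀ᵐ z ∂ν, ‖z‖ ≤ ‖c‖ + r := by
    filter_upwards [ae_circleMeasure c hr.le] with z hz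
    calc ‖z‖ = ‖c + (z - c)‖ := by congr 1; ring
      _ ≤ _ := (norm_add_le _ _).trans (by rw [hz])
  have i12 := integrable_log_prod_circleMeasure hR c hr
  have i21 := integrable_log_circleMeasure_prod hR c hr
  have i22 := integrable_log_prod_circleMeasure hRν c hr
  have e12 := integral_log_prod_circleMeasure hR c hr
  have e21 := integral_log_circleMeasure_prod hR c hr
  rw [← hν] at i12 i21 i22 e12 e21
  set f : ℂ × ℂ → ℝ := fun p => Real.log ‖p.1 - p.2‖ with hf
  set m := ∫ z, Real.log (max r ‖z - c‖) ∂σ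
  set a := ∫ p, f p ∂(σ.prod σ)
  set b := ∫ p, f p ∂(ν.prod ν)
  set x := ∫ z, Q z ∂σ
  set y := ∫ z, Q z ∂ν
  -- The energy of `(1 - ε) σ + ε ν` is quadratic in `ε`. Comparing it with the minimum and dividing
  -- by `ε` leaves an affine inequality, whose limit as `ε → 0⁺` is the claim.
  have key : ∀ ε : ℝ, 0 < ε → ε < 1 →
      0 ≤ ((y - 2 * m) - (x - 2 * a)) + ε * (-a + 2 * m - b) := by
    intro ε h0 h1
    have hp := isProbabilityMeasure_mixture σ ν h0 h1
    have hc : IsCompact (mixture σ ν ε).support := by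
      refine IsCompact.of_isClosed_subset (hS.union (isCompact_sphere c r))
        Measure.isClosed_support ?_
      rw [mixture, Measure.support_add]
      refine Set.union_subset_union ?_ ?_
      · exact (Measure.AbsolutelyContinuous.support_mono Measure.smul_absolutelyContinuous)
      · exact (Measure.AbsolutelyContinuous.support_mono Measure.smul_absolutelyContinuous).trans
          (support_circleMeasure_subset c hr.le)
    have hle := hmin _ hp hc
    have n1 : ENNReal.ofReal (1 - ε) ≠ ⊤ := ENNReal.ofReal_ne_top
    have n2 : ENNReal.ofReal ε ≠ ⊤ := ENNReal.ofReal_ne_top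
    have j11 := (hl.smul_measure n1).smul_measure n1
    have j12 := (i12.smul_measure n1).smul_measure n2
    have j21 := (i21.smul_measure n2).smul_measure n1
    have j22 := (i22.smul_measure n2).smul_measure n2
    have jl : Integrable f ((mixture σ ν ε).prod (mixture σ ν ε)) := by
      rw [mixture_prod]
      exact (j11.add_measure j21).add_measure (j12.add_measure j22)
    have jd : ((mixture σ ν ε).prod (mixture σ ν ε)) {p : ℂ × ℂ | p.1 = p.2} = 0 := by
      rw [mixture_prod]
      simp [hd, hν, prod_circleMeasure_diagonal _ c hr, circleMeasure_prod_diagonal _ c hr]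
    have jQ : Integrable Q (mixture σ ν ε) :=
      (hQ.smul_measure n1).add_measure (hQc.smul_measure n2)
    rw [weightedEnergy_eq hl hd hQ, weightedEnergy_eq jl jd jQ, EReal.coe_le_coe_iff, mixture_prod,
      integral_add_measure (j11.add_measure j21) (j12.add_measure j22),
      integral_add_measure j11 j21, integral_add_measure j12 j22, mixture,
      integral_add_measure (hQ.smul_measure n1) (hQc.smul_measure n2)] at hle
    simp only [integral_smul_measure, ENNReal.toReal_ofReal h0.le,
      ENNReal.toReal_ofReal (by linarith : 0 ≤ 1 - ε), smul_eq_mul] at hle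
    change -a + x ≤ -((1 - ε) * ((1 - ε) * a) + (1 - ε) * (ε * ∫ p, f p ∂(ν.prod σ))
      + (ε * ((1 - ε) * ∫ p, f p ∂(σ.prod ν)) + ε * (ε * b))) + ((1 - ε) * x + ε * y) at hle
    rw [e12, e21] at hle
    have : 0 ≤ ε * (((y - 2 * m) - (x - 2 * a)) + ε * (-a + 2 * m - b)) := by linarith
    exact nonneg_of_mul_nonneg_right this h0
  have hlim : Tendsto (fun ε : ℝ => ((y - 2 * m) - (x - 2 * a)) + ε * (-a + 2 * m - b)) (𝓝[>] 0)
      (𝓝 (((y - 2 * m) - (x - 2 * a)) + 0 * (-a + 2 * m - b))) := by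
    refine Tendsto.mono_left ?_ nhdsWithin_le_nhds
    exact (Continuous.tendsto (by fun_prop) 0)
  have hge := ge_of_tendsto hlim (by
    filter_upwards [Ioo_mem_nhdsGT (zero_lt_one (α := ℝ))] with ε hε using key ε hε.1 hε.2)
  linarith

/-! ### The equality conditions of the equilibrium problem -/

lemma measure_singleton_of_diagonal {σ : Measure ℂ} [SFinite σ]
    (hd : (σ.prod σ) {p : ℂ × ℂ | p.1 = p.2} = 0) (c : ℂ) : σ {c} = 0 := by
  have h : (σ.prod σ) ({c} ×ˢ {c}) = 0 := measure_mono_null (by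
    rintro ⟨x, y⟩ ⟨hx, hy⟩
    simp only [Set.mem_singleton_iff] at hx hy
    simp [hx, hy]) hd
  rw [Measure.prod_prod] at h
  simpa using h

lemma abs_log_max_le {r x M : ℝ} (hr : 0 < r) (hx : x ≤ M) :
    |Real.log (max r x)| ≤ |Real.log r| + |Real.log (max r M)| := by
  have h1 : Real.log r ≤ Real.log (max r x) := Real.log_le_log hr (le_max_left _ _)
  have h2 : Real.log (max r x) ≤ Real.log (max r M) :=
    Real.log_le_log (lt_max_of_lt_left hr) (max_le_max_left r hx)
  have h3 := neg_abs_le (Real.log r)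
  have h4 := le_abs_self (Real.log (max r M))
  have h5 := abs_nonneg (Real.log r)
  have h6 := abs_nonneg (Real.log (max r M))
  rw [abs_le]; constructor <;> linarith

lemma norm_sub_le_of_le {w c : ℂ} {R : ℝ} (h : ‖w‖ ≤ R) : ‖w - c‖ ≤ R + ‖c‖ :=
  (norm_sub_le _ _).trans (by linarith)

lemma measurable_log_max (c : ℂ) (r : ℝ) : Measurable fun w => Real.log (max r ‖w - c‖) := by
  fun_prop

lemma integrable_log_max {σ : Measure ℂ} [IsProbabilityMeasure σ] {R : ℝ}
    (hR : ∀ᵐ z ∂σ, ‖z‖ ≤ R) (c : ℂ) {r : ℝ} (hr : 0 < r) :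
    Integrable (fun w => Real.log (max r ‖w - c‖)) σ := by
  refine Integrable.mono' (g := fun _ => |Real.log r| + |Real.log (max r (R + ‖c‖))|)
    (integrable_const _) (measurable_log_max c r).aestronglyMeasurable ?_
  filter_upwards [hR] with w hw using abs_log_max_le hr (norm_sub_le_of_le hw)

/-- Truncation at radius `r` makes the logarithm bounded and continuous on the relevant range, so
dominated convergence applies; the untruncated potential is a priori only semicontinuous. -/
lemma continuous_integral_log_max {σ : Measure ℂ} [IsProbabilityMeasure σ] {R : ℝ}
    (hR : ∀ᵐ z ∂σ, ‖z‖ ≤ R) {r : ℝ} (hr : 0 < r) :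
    Continuous fun c : ℂ => ∫ w, Real.log (max r ‖w - c‖) ∂σ := by
  rw [continuous_iff_continuousAt]
  intro c
  refine continuousAt_of_dominated
    (bound := fun _ => |Real.log r| + |Real.log (max r (R + (‖c‖ + 1)))|) ?_ ?_
    (integrable_const _) ?_
  · exact Eventually.of_forall fun c => (measurable_log_max c r).aestronglyMeasurable
  · filter_upwards [Metric.ball_mem_nhds c one_pos] with c' hc'
    filter_upwards [hR] with w hw
    refine abs_log_max_le hr ((norm_sub_le_of_le hw).trans ?_)
    rw [Metric.mem_ball, dist_eq_norm] at hc'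
    have : ‖c'‖ ≤ ‖c‖ + ‖c' - c‖ := by
      calc ‖c'‖ = ‖c + (c' - c)‖ := by congr 1; ring
        _ ≤ _ := norm_add_le _ _
    linarith
  · refine Eventually.of_forall fun w => ?_
    have : ContinuousAt (fun c : ℂ => max r ‖w - c‖) c := by fun_prop
    exact this.log (lt_max_of_lt_left hr).ne'

lemma integrable_circleMeasure_of_bounded {Q : ℂ → ℝ} (hQ : Measurable Q) {c : ℂ} {r M : ℝ}
    (hr : 0 ≤ r) (h : ∀ z, ‖z - c‖ = r → |Q z| ≤ M) : Integrable Q (circleMeasure c r) := by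
  refine Integrable.mono' (g := fun _ => M) (integrable_const _) hQ.aestronglyMeasurable ?_
  filter_upwards [ae_circleMeasure c hr] with z hz using h z hz

/-- Data on an equilibrium measure of finite energy. -/
structure EquilibriumData (Q : ℂ → ℝ) (σ : Measure ℂ) (R : ℝ) : Prop where
  measurable : Measurable Q
  isProbabilityMeasure : IsProbabilityMeasure σ
  norm_le : ∀ᵐ z ∂σ, ‖z‖ ≤ R
  integrable_log : Integrable (fun p : ℂ × ℂ => Real.log ‖p.1 - p.2‖) (σ.prod σ)
  diagonal : (σ.prod σ) {p : ℂ × ℂ | p.1 = p.2} = 0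
  integrable : Integrable Q σ
  le_circle : ∀ (c : ℂ) (r : ℝ), 0 < r → Integrable Q (circleMeasure c r) →
    robinConstant Q σ ≤ ∫ z, Q z ∂(circleMeasure c r) - 2 * ∫ z, Real.log (max r ‖z - c‖) ∂σ

lemma logPotential_eq (σ : Measure ℂ) (z : ℂ) :
    logPotential σ z = -∫ w, Real.log ‖z - w‖ ∂σ := by
  simp only [logPotential, one_div, Real.log_inv, integral_neg]

/-- One circle on which `Q` is integrable has finite energy, hence so does the minimizer. All
integrability statements follow from that, and Robin's constant becomes `∫ Q - 2 ∬ log` by Fubini.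
-/
lemma IsEquilibriumMeasure.data {Q : ℂ → ℝ} (hQ : LowerSemicontinuous Q) {σ : Measure ℂ}
    (hσ : IsEquilibriumMeasure Q σ) {c : ℂ} {r : ℝ} (hr : 0 < r)
    (hQc : Integrable Q (circleMeasure c r)) : ∃ R, EquilibriumData Q σ R := by
  have := hσ.isProbabilityMeasure
  have hQm : Measurable Q := hQ.measurable
  obtain ⟨R, hR⟩ := hσ.isCompact_support.isBounded.exists_norm_le
  have hR' : ∀ᵐ z ∂σ, ‖z‖ ≤ R := by
    filter_upwards [Measure.support_mem_ae (μ := σ)] with z hz using hR z hz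
  obtain ⟨M, hM⟩ := (hQ.lowerSemicontinuousOn _).bddBelow_of_isCompact hσ.isCompact_support
  have hM' : ∀ᵐ z ∂σ, -(-M) ≤ Q z := by
    filter_upwards [Measure.support_mem_ae (μ := σ)] with z hz
    rw [neg_neg]
    exact hM ⟨z, hz, rfl⟩
  have hRν : ∀ᵐ z ∂circleMeasure c r, ‖z‖ ≤ ‖c‖ + r := by
    filter_upwards [ae_circleMeasure c hr.le] with z hz
    calc ‖z‖ = ‖c + (z - c)‖ := by congr 1; ring
      _ ≤ _ := (norm_add_le _ _).trans (by rw [hz])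
  have hfin : weightedEnergy Q σ < ⊤ := by
    refine (hσ.energy_le (circleMeasure c r) inferInstance ?_).trans_lt ?_
    · exact (isCompact_sphere c r).of_isClosed_subset Measure.isClosed_support
        (support_circleMeasure_subset c hr.le)
    · rw [weightedEnergy_eq (integrable_log_prod_circleMeasure hRν c hr)
        (prod_circleMeasure_diagonal _ c hr) hQc]
      exact EReal.coe_lt_top _
  obtain ⟨h1, h2, h3⟩ := integrable_of_weightedEnergy_lt_top hQm hR' hM' hfin
  have hrob : robinConstant Q σ =
      ∫ z, Q z ∂σ - 2 * ∫ p : ℂ × ℂ, Real.log ‖p.1 - p.2‖ ∂(σ.prod σ) := by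
    simp only [robinConstant, logPotential_eq]
    have h4 : Integrable (fun x => ∫ y, Real.log ‖x - y‖ ∂σ) σ := h1.integral_prod_left
    have h5 : Integrable (fun x => 2 * -∫ y, Real.log ‖x - y‖ ∂σ) σ := h4.neg.const_mul 2
    rw [integral_prod _ h1, integral_add h3 h5, integral_const_mul, integral_neg]
    ring
  refine ⟨R, hQm, this, hR', h1, h2, h3, fun c r hr hQc => ?_⟩
  rw [hrob]
  exact robin_le_of_energy_le hσ.energy_le hσ.isCompact_support h1 h2 h3 hR' c hr hQc

namespace EquilibriumData

variable {Q : ℂ → ℝ} {σ : Measure ℂ} {R : ℝ}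

lemma ae_ne (h : EquilibriumData Q σ R) (c : ℂ) : ∀ᵐ w ∂σ, w ≠ c := by
  have := h.isProbabilityMeasure
  rw [ae_iff]
  simpa using measure_singleton_of_diagonal h.diagonal c

lemma integral_log_le_integral_log_max (h : EquilibriumData Q σ R) {c : ℂ}
    (hc : Integrable (fun w => Real.log ‖w - c‖) σ) {r : ℝ} (hr : 0 < r) :
    ∫ w, Real.log ‖w - c‖ ∂σ ≤ ∫ w, Real.log (max r ‖w - c‖) ∂σ := by
  have := h.isProbabilityMeasure
  refine integral_mono_ae hc (integrable_log_max h.norm_le c hr) ?_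
  -- At `w = c` the convention `Real.log 0 = 0` would break monotonicity; finite energy excludes
  -- atoms, so this point can be discarded.
  filter_upwards [h.ae_ne c] with w hw
  exact Real.log_le_log (norm_pos_iff.2 (sub_ne_zero.2 hw)) (le_max_right _ _)

/-- The variational inequality is tested on small circles about `c`: continuity controls the mean of
`Q`, and truncating the logarithm only raises it. -/
lemma robin_le (h : EquilibriumData Q σ R) {c : ℂ} (hQ : ContinuousAt Q c)
    (hc : Integrable (fun w => Real.log ‖w - c‖) σ) :
    robinConstant Q σ ≤ Q c - 2 * ∫ w, Real.log ‖w - c‖ ∂σ := by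
  refine le_of_forall_pos_le_add fun ε hε => ?_
  obtain ⟨δ, hδ, hδ'⟩ := Metric.continuousAt_iff.1 hQ ε hε
  have hd : ∀ z, ‖z - c‖ = δ / 2 → |Q z - Q c| < ε := by
    intro z hz
    have := hδ' (x := z) (by rw [dist_eq_norm, hz]; linarith)
    rwa [Real.dist_eq] at this
  have hi : Integrable Q (circleMeasure c (δ / 2)) := by
    refine integrable_circleMeasure_of_bounded (M := |Q c| + ε) h.measurable (by positivity)
      fun z hz => ?_
    have h1 := hd z hz
    calc |Q z| = |Q c + (Q z - Q c)| := by congr 1; ring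
      _ ≤ _ := (abs_add_le _ _).trans (by linarith)
  have h1 := h.le_circle c (δ / 2) (by positivity) hi
  have h2 := h.integral_log_le_integral_log_max hc (r := δ / 2) (by positivity)
  have h3 : ∫ z, Q z ∂circleMeasure c (δ / 2) ≤ Q c + ε := by
    have : ∫ z, Q z ∂circleMeasure c (δ / 2) ≤ ∫ _, (Q c + ε) ∂circleMeasure c (δ / 2) := by
      refine integral_mono_ae hi (integrable_const _) ?_
      filter_upwards [ae_circleMeasure c (by positivity : 0 ≤ δ / 2)] with z hz
      have := (abs_lt.1 (hd z hz)).2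
      linarith
    simpa using this
  linarith

/-- The difference of the two sides is nonnegative almost everywhere by `robin_le` and has mean
zero, because `robinConstant` is defined as the mean. -/
lemma ae_robin_eq (h : EquilibriumData Q σ R) (hQ : ∀ z ∈ σ.support, ContinuousAt Q z) :
    ∀ᵐ c ∂σ, Integrable (fun w => Real.log ‖w - c‖) σ ∧
      Q c - 2 * ∫ w, Real.log ‖w - c‖ ∂σ = robinConstant Q σ := by
  have := h.isProbabilityMeasure
  have h1 : ∀ᵐ c ∂σ, Integrable (fun w => Real.log ‖w - c‖) σ := by
    filter_upwards [h.integrable_log.prod_right_ae] with c hc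
    simpa only [norm_sub_rev] using hc
  have hi : Integrable (fun c => Q c - 2 * ∫ w, Real.log ‖w - c‖ ∂σ) σ := by
    have := h.integrable.sub (h.integrable_log.integral_prod_left.const_mul 2)
    refine this.congr (Eventually.of_forall fun c => ?_)
    simp only [Pi.sub_apply, norm_sub_rev]
  have h0 : (fun _ => (0 : ℝ)) ≤ᵐ[σ]
      fun c => Q c - 2 * ∫ w, Real.log ‖w - c‖ ∂σ - robinConstant Q σ := by
    filter_upwards [h1, Measure.support_mem_ae (μ := σ)] with c hc hcS
    have := h.robin_le (hQ c hcS) hc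
    linarith
  have hz : ∫ c, (Q c - 2 * ∫ w, Real.log ‖w - c‖ ∂σ - robinConstant Q σ) ∂σ = 0 := by
    rw [integral_sub hi (integrable_const _), integral_const, probReal_univ, one_smul,
      sub_eq_zero, robinConstant]
    refine integral_congr_ae (Eventually.of_forall fun c => ?_)
    simp only [logPotential_eq, norm_sub_rev c]
    ring
  have h2 := (integral_eq_zero_iff_of_nonneg_ae h0 (hi.sub (integrable_const _))).1 hz
  filter_upwards [h1, h2] with c hc1 hc2
  refine ⟨hc1, ?_⟩
  have : Q c - 2 * ∫ w, Real.log ‖w - c‖ ∂σ - robinConstant Q σ = 0 := hc2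
  linarith

/-- The left side is continuous at `c`, so a strict violation would persist on a neighbourhood,
which has positive mass. There it contradicts the almost everywhere equality, since truncation
raises the logarithm. This upgrades the equality from almost every point to every point. -/
lemma log_max_le_robin (h : EquilibriumData Q σ R) (hQ : ∀ z ∈ σ.support, ContinuousAt Q z)
    {c : ℂ} (hc : c ∈ σ.support) {r : ℝ} (hr : 0 < r) :
    Q c - 2 * ∫ w, Real.log (max r ‖w - c‖) ∂σ ≤ robinConstant Q σ := by
  have := h.isProbabilityMeasure
  by_contra! hlt
  have hcont : ContinuousAt (fun c => Q c - 2 * ∫ w, Real.log (max r ‖w - c‖) ∂σ) c :=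
    (hQ c hc).sub (continuousAt_const.mul (continuous_integral_log_max h.norm_le hr).continuousAt)
  have hU := hcont.eventually (lt_mem_nhds hlt)
  have hpos := (Measure.mem_support_iff_forall c).1 hc _ hU
  refine hpos.ne' (measure_mono_null ?_ (ae_iff.1 (h.ae_robin_eq hQ)))
  rintro z hz ⟨hz1, hz2⟩
  have hz' : robinConstant Q σ < Q z - 2 * ∫ w, Real.log (max r ‖w - z‖) ∂σ := hz
  have := h.integral_log_le_integral_log_max hz1 hr
  linarith

/-- Fatou's lemma along the truncation radii `1 / (k + 1)`, with the uniform bound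
`log_max_le_robin`. Without integrability the Bochner integral in `logPotential` would silently be
`0`. -/
lemma integrable_log_of_mem_support (h : EquilibriumData Q σ R)
    (hQ : ∀ z ∈ σ.support, ContinuousAt Q z) {c : ℂ} (hc : c ∈ σ.support) :
    Integrable (fun w => Real.log ‖w - c‖) σ := by
  have := h.isProbabilityMeasure
  set R' : ℝ := 1 + |R| + ‖c‖ with hR'
  have hR1 : 1 ≤ R' := by have := abs_nonneg R; have := norm_nonneg c; linarith
  have hle : ∀ᵐ w ∂σ, ‖w - c‖ ≤ R' := by
    filter_upwards [h.norm_le] with w hw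
    have := norm_sub_le_of_le (c := c) hw
    have := le_abs_self R
    linarith
  have hk : ∀ k : ℕ, (0 : ℝ) < 1 / (k + 1) := fun k => by positivity
  have hk1 : ∀ k : ℕ, (1 : ℝ) / (k + 1) ≤ 1 := fun k => by
    rw [div_le_one (by positivity)]; simp
  set f : ℕ → ℂ → ℝ := fun k w => Real.log R' - Real.log (max (1 / (k + 1)) ‖w - c‖) with hf
  have hfi : ∀ k, Integrable (f k) σ := fun k =>
    (integrable_const _).sub (integrable_log_max h.norm_le c (hk k))
  have hf0 : ∀ k, 0 ≤ᵐ[σ] f k := by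
    intro k
    filter_upwards [hle] with w hw
    simp only [Pi.zero_apply, hf, sub_nonneg]
    exact Real.log_le_log (lt_max_of_lt_left (hk k)) (max_le ((hk1 k).trans hR1) hw)
  have hbound : ∀ k, ∫⁻ w, ENNReal.ofReal (f k w) ∂σ ≤
      ENNReal.ofReal (Real.log R' + (robinConstant Q σ - Q c) / 2) := by
    intro k
    rw [← ofReal_integral_eq_lintegral_ofReal (hfi k) (hf0 k)]
    refine ENNReal.ofReal_le_ofReal ?_
    have h1 := h.log_max_le_robin hQ hc (hk k)
    have h2 : ∫ w, f k w ∂σ = Real.log R' - ∫ w, Real.log (max (1 / (k + 1)) ‖w - c‖) ∂σ := by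
      simp only [hf]
      rw [integral_sub (integrable_const _) (integrable_log_max h.norm_le c (hk k))]
      simp
    rw [h2]
    linarith
  have hlim : ∀ᵐ w ∂σ, liminf (fun k => ENNReal.ofReal (f k w)) atTop =
      ENNReal.ofReal (Real.log R' - Real.log ‖w - c‖) := by
    filter_upwards [h.ae_ne c] with w hw
    have hw0 : 0 < ‖w - c‖ := norm_pos_iff.2 (sub_ne_zero.2 hw)
    refine Tendsto.liminf_eq (ENNReal.tendsto_ofReal (tendsto_const_nhds.sub ?_))
    refine Tendsto.log ?_ hw0.ne'
    have := (tendsto_one_div_add_atTop_nhds_zero_nat (𝕜 := ℝ)).max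
      (tendsto_const_nhds (x := ‖w - c‖))
    rwa [max_eq_right hw0.le] at this
  have hfat := lintegral_liminf_le (μ := σ) (u := atTop)
    (f := fun k w => ENNReal.ofReal (f k w)) (fun k => by simp only [hf]; fun_prop)
  rw [lintegral_congr_ae hlim] at hfat
  have hfin : ∫⁻ w, ENNReal.ofReal (Real.log R' - Real.log ‖w - c‖) ∂σ ≠ ⊤ := by
    refine ((hfat.trans (liminf_le_liminf (Eventually.of_forall hbound))).trans_lt ?_).ne
    rw [liminf_const]
    exact ENNReal.ofReal_lt_top
  have hint : Integrable (fun w => Real.log R' - Real.log ‖w - c‖) σ := by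
    refine (lintegral_ofReal_ne_top_iff_integrable
      (measurable_const.sub (measurable_log_norm_sub c)).aestronglyMeasurable ?_).1 hfin
    filter_upwards [hle, h.ae_ne c] with w hw hw'
    exact sub_nonneg.2 (Real.log_le_log (norm_pos_iff.2 (sub_ne_zero.2 hw')) hw)
  refine ((integrable_const (Real.log R')).sub hint).congr (Eventually.of_forall fun w => ?_)
  simp

/-- `Q + 2 U^σ` is equal to Robin's constant at every point of the droplet. -/
lemma robin_eq (h : EquilibriumData Q σ R) (hQ : ∀ z ∈ σ.support, ContinuousAt Q z) {c : ℂ}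
    (hc : c ∈ σ.support) : Q c - 2 * ∫ w, Real.log ‖w - c‖ ∂σ = robinConstant Q σ := by
  have := h.isProbabilityMeasure
  have hi := h.integrable_log_of_mem_support hQ hc
  refine le_antisymm ?_ (h.robin_le (hQ c hc) hi)
  have hk : ∀ k : ℕ, (0 : ℝ) < 1 / (k + 1) := fun k => by positivity
  have hlim : Tendsto (fun k : ℕ => ∫ w, Real.log (max (1 / (k + 1)) ‖w - c‖) ∂σ) atTop
      (𝓝 (∫ w, Real.log ‖w - c‖ ∂σ)) := by
    refine tendsto_integral_of_dominated_convergence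
      (fun w => |Real.log ‖w - c‖| + |Real.log (max 1 (R + ‖c‖))|) (fun k => (measurable_log_max c _).aestronglyMeasurable)
      (hi.abs.add (integrable_const _)) (fun k => ?_) ?_
    · filter_upwards [h.norm_le, h.ae_ne c] with w hw hw'
      have hw0 : 0 < ‖w - c‖ := norm_pos_iff.2 (sub_ne_zero.2 hw')
      have h1 : Real.log ‖w - c‖ ≤ Real.log (max (1 / (k + 1)) ‖w - c‖) :=
        Real.log_le_log hw0 (le_max_right _ _)
      have h2 : Real.log (max (1 / (k + 1)) ‖w - c‖) ≤ Real.log (max 1 (R + ‖c‖)) := by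
        refine Real.log_le_log (lt_max_of_lt_left (hk k)) (max_le_max ?_ (norm_sub_le_of_le hw))
        rw [div_le_one (by positivity)]; simp
      have h3 := neg_abs_le (Real.log ‖w - c‖)
      have h4 := le_abs_self (Real.log (max 1 (R + ‖c‖)))
      have h5 := abs_nonneg (Real.log ‖w - c‖)
      have h6 := abs_nonneg (Real.log (max 1 (R + ‖c‖)))
      rw [Real.norm_eq_abs, abs_le]
      constructor <;> linarith
    · filter_upwards [h.ae_ne c] with w hw
      have hw0 : 0 < ‖w - c‖ := norm_pos_iff.2 (sub_ne_zero.2 hw)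
      refine Tendsto.log ?_ hw0.ne'
      have := (tendsto_one_div_add_atTop_nhds_zero_nat (𝕜 := ℝ)).max
        (tendsto_const_nhds (x := ‖w - c‖))
      rwa [max_eq_right hw0.le] at this
  exact le_of_tendsto (tendsto_const_nhds.sub (hlim.const_mul 2))
    (Eventually.of_forall fun k => h.log_max_le_robin hQ hc (hk k))

end EquilibriumData

/-! ### Geometry of the gap -/

lemma closure_gap {r₁ r₂ r : ℝ} (h0 : 0 < r₁) (h : r₁ < r₂) (hr : r ∈ Set.Icc r₁ r₂) :
    (r : ℂ) ∈ closure (gap r₁ r₂) := by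
  rw [← closure_Ioo h.ne] at hr
  refine map_mem_closure Complex.continuous_ofReal hr fun x hx => ?_
  have hx0 : 0 ≤ x := h0.le.trans hx.1.le
  simpa [gap, abs_of_nonneg hx0] using hx

lemma isOpen_gap (r₁ r₂ : ℝ) : IsOpen (gap r₁ r₂) :=
  (isOpen_lt continuous_const continuous_norm).inter (isOpen_lt continuous_norm continuous_const)

lemma mem_frontier_gap {r₁ r₂ r : ℝ} (h0 : 0 < r₁) (h : r₁ < r₂) (hr : r = r₁ ∨ r = r₂) :
    (r : ℂ) ∈ frontier (gap r₁ r₂) := by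
  rw [(isOpen_gap r₁ r₂).frontier_eq]
  refine ⟨closure_gap h0 h ?_, ?_⟩
  · rcases hr with rfl | rfl
    exacts [⟨le_rfl, h.le⟩, ⟨h.le, le_rfl⟩]
  · rcases hr with rfl | rfl
    · simp [gap, abs_of_pos h0]
    · simp [gap, abs_of_pos (h0.trans h)]

namespace IsGapPotential

variable {q : ℝ → ℝ} {σ : Measure ℂ} {N : ℕ} {a b : ℕ → ℝ} {k : ℕ}

lemma left_nonneg (h : IsGapPotential q σ N a b k) : ∀ j ≤ N, 0 ≤ a j := by
  intro j
  induction j with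
  | zero => exact fun _ => h.zero_le
  | succ j ih =>
    intro hj
    have h1 := ih (by omega)
    have h2 := h.radii_lt j (by omega)
    have h3 := h.radii_lt_succ j (by omega)
    linarith

lemma right_le (h : IsGapPotential q σ N a b k) {i j : ℕ} (hij : i ≤ j) (hj : j ≤ N) :
    b i ≤ b j := by
  induction j, hij using Nat.le_induction with
  | base => exact le_rfl
  | succ j _ ih =>
    have h1 := ih (by omega)
    have h2 := h.radii_lt (j + 1) hj
    have h3 := h.radii_lt_succ j (by omega)
    linarith

lemma left_le (h : IsGapPotential q σ N a b k) {i j : ℕ} (hij : i ≤ j) (hj : j ≤ N) :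
    a i ≤ a j := by
  induction j, hij using Nat.le_induction with
  | base => exact le_rfl
  | succ j _ ih =>
    have h1 := ih (by omega)
    have h2 := h.radii_lt j (by omega)
    have h3 := h.radii_lt_succ j (by omega)
    linarith

lemma mem_droplet (h : IsGapPotential q σ N a b k) {z : ℂ} :
    z ∈ σ.support ↔ ∃ j ≤ N, a j ≤ ‖z‖ ∧ ‖z‖ ≤ b j := by
  rw [h.droplet_eq]
  simp only [Set.mem_iUnion, Finset.mem_range, Set.mem_ofPred_eq, exists_prop, Nat.lt_succ_iff]

lemma inner_pos (h : IsGapPotential q σ N a b k) : 0 < b k :=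
  (h.left_nonneg k h.gap_index.le).trans_lt (h.radii_lt k h.gap_index.le)

lemma gap_lt (h : IsGapPotential q σ N a b k) : b k < a (k + 1) := h.radii_lt_succ k h.gap_index

lemma mem_droplet_inner (h : IsGapPotential q σ N a b k) {z : ℂ} (h1 : a k ≤ ‖z‖)
    (h2 : ‖z‖ ≤ b k) : z ∈ σ.support := h.mem_droplet.2 ⟨k, h.gap_index.le, h1, h2⟩

lemma mem_droplet_outer (h : IsGapPotential q σ N a b k) {z : ℂ} (h1 : a (k + 1) ≤ ‖z‖)
    (h2 : ‖z‖ ≤ b (k + 1)) : z ∈ σ.support := h.mem_droplet.2 ⟨k + 1, h.gap_index, h1, h2⟩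

lemma norm_le_or_le (h : IsGapPotential q σ N a b k) {z : ℂ} (hz : z ∈ σ.support) :
    ‖z‖ ≤ b k ∨ a (k + 1) ≤ ‖z‖ := by
  obtain ⟨j, hj, h1, h2⟩ := h.mem_droplet.1 hz
  rcases le_or_gt j k with hjk | hjk
  · exact Or.inl (h2.trans (h.right_le hjk h.gap_index.le))
  · exact Or.inr ((h.left_le hjk hj).trans h1)

lemma notMem_droplet (h : IsGapPotential q σ N a b k) {z : ℂ} (hz : z ∈ gap (b k) (a (k + 1))) :
    z ∉ σ.support := fun hS => (h.norm_le_or_le hS).elim (not_le.2 hz.1) (not_le.2 hz.2)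

lemma mem_frontier_droplet (h : IsGapPotential q σ N a b k) {r : ℝ}
    (hr : r = b k ∨ r = a (k + 1)) : (r : ℂ) ∈ frontier σ.support := by
  have h0 := h.inner_pos
  have h1 := h.gap_lt
  rw [frontier_eq_closure_inter_closure]
  constructor
  · refine subset_closure ?_
    have hr0 : 0 < r := by rcases hr with rfl | rfl <;> linarith
    have hn : ‖(r : ℂ)‖ = r := by simp [abs_of_pos hr0]
    rcases hr with rfl | rfl
    · exact h.mem_droplet_inner (by rw [hn]; exact (h.radii_lt k h.gap_index.le).le) hn.le
    · exact h.mem_droplet_outer hn.ge (by rw [hn]; exact (h.radii_lt (k + 1) h.gap_index).le)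
  · refine closure_mono (fun z hz => h.notMem_droplet hz) (closure_gap h0 h1 ?_)
    rcases hr with rfl | rfl
    exacts [⟨le_rfl, h1.le⟩, ⟨h1.le, le_rfl⟩]

lemma quarterLaplacian_pos (h : IsGapPotential q σ N a b k) {r : ℝ}
    (hr : r = b k ∨ r = a (k + 1)) : 0 < quarterLaplacian (radialPotential q) (r : ℂ) :=
  h.laplacian_pos _ (h.mem_frontier_droplet hr)

lemma contDiffAt (h : IsGapPotential q σ N a b k) {r : ℝ}
    (hr : r = b k ∨ r = a (k + 1)) : ContDiffAt ℝ 6 (radialPotential q) (r : ℂ) := by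
  obtain ⟨W, hW, hWS, hc⟩ := h.contDiff_six
  exact hc.contDiffAt (hW.mem_nhds (hWS (mem_frontier_gap h.inner_pos h.gap_lt hr)))

lemma continuousAt (h : IsGapPotential q σ N a b k) : ∀ z ∈ σ.support,
    ContinuousAt (radialPotential q) z := by
  obtain ⟨W, hW, hWS, hc⟩ := h.contDiff_two
  exact fun z hz => (hc.contDiffAt (hW.mem_nhds (hWS hz))).continuousAt

lemma measurable (h : IsGapPotential q σ N a b k) : Measurable (radialPotential q) :=
  h.lowerSemicontinuous.measurable

lemma integrable_circle (h : IsGapPotential q σ N a b k) {r : ℝ} (hr : 0 < r) :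
    Integrable (radialPotential q) (circleMeasure 0 r) := by
  refine integrable_circleMeasure_of_bounded (M := |q r|) h.measurable hr.le fun z hz => ?_
  rw [sub_zero] at hz
  rw [radialPotential, hz]

lemma integral_circle (_h : IsGapPotential q σ N a b k) {r : ℝ} (hr : 0 < r) :
    ∫ z, radialPotential q z ∂circleMeasure 0 r = q r := by
  have : ∀ᵐ z ∂circleMeasure 0 r, radialPotential q z = q r := by
    filter_upwards [ae_circleMeasure 0 hr.le] with z hz
    rw [sub_zero] at hz
    rw [radialPotential, hz]
  rw [integral_congr_ae this]
  simp

lemma data (h : IsGapPotential q σ N a b k) : ∃ R, EquilibriumData (radialPotential q) σ R :=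
  h.equilibrium.data h.lowerSemicontinuous h.inner_pos (h.integrable_circle h.inner_pos)

end IsGapPotential

/-- The circular mean of the obstacle function over the circle of radius `r`. -/
noncomputable def meanObstacle (Q : ℂ → ℝ) (σ : Measure ℂ) (r : ℝ) : ℝ :=
  robinConstant Q σ + 2 * ∫ w, Real.log (max r ‖w‖) ∂σ

/-! ### Comparison of `q` with the circular mean of the obstacle -/

namespace IsGapPotential

variable {q : ℝ → ℝ} {σ : Measure ℂ} {N : ℕ} {a b : ℕ → ℝ} {k : ℕ}

/-- The variational inequality on circles about the origin. Since `Q` is radial its mean there is `q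
r`, and rotation invariance of `σ` is never needed. -/
lemma meanObstacle_le (h : IsGapPotential q σ N a b k) {r : ℝ} (hr : 0 < r) :
    meanObstacle (radialPotential q) σ r ≤ q r := by
  obtain ⟨R, hd⟩ := h.data
  have := hd.le_circle 0 r hr (h.integrable_circle hr)
  rw [h.integral_circle hr] at this
  simp only [sub_zero] at this
  rw [meanObstacle]
  linarith

lemma obstacle_eq (h : IsGapPotential q σ N a b k) {z : ℂ} (hz : z ∈ σ.support) :
    obstacle (radialPotential q) σ z = q ‖z‖ := by
  obtain ⟨R, hd⟩ := h.data
  have := hd.robin_eq h.continuousAt hz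
  simp only [norm_sub_rev _ z] at this
  rw [obstacle, logPotential_eq, ← this, radialPotential]
  ring

lemma integrable_logPotential_circle (h : IsGapPotential q σ N a b k) {r : ℝ} (hr : 0 < r) :
    Integrable (fun z => ∫ w, Real.log ‖z - w‖ ∂σ) (circleMeasure 0 r) := by
  obtain ⟨R, hd⟩ := h.data
  have := hd.isProbabilityMeasure
  exact (integrable_log_circleMeasure_prod hd.norm_le 0 hr).integral_prod_left

lemma integral_logPotential_circle (h : IsGapPotential q σ N a b k) {r : ℝ} (hr : 0 < r) :
    ∫ z, (∫ w, Real.log ‖z - w‖ ∂σ) ∂circleMeasure 0 r = ∫ w, Real.log (max r ‖w‖) ∂σ := by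
  obtain ⟨R, hd⟩ := h.data
  have := hd.isProbabilityMeasure
  have h1 := integral_log_circleMeasure_prod hd.norm_le 0 hr
  rw [integral_prod _ (integrable_log_circleMeasure_prod hd.norm_le 0 hr)] at h1
  simpa only [sub_zero] using h1

lemma meanObstacle_eq_integral (h : IsGapPotential q σ N a b k) {r : ℝ} (hr : 0 < r) :
    Integrable (obstacle (radialPotential q) σ) (circleMeasure 0 r) ∧
    ∫ z, obstacle (radialPotential q) σ z ∂circleMeasure 0 r =
      meanObstacle (radialPotential q) σ r := by
  have h1 : obstacle (radialPotential q) σ =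
      fun z => robinConstant (radialPotential q) σ + 2 * ∫ w, Real.log ‖z - w‖ ∂σ := by
    ext z
    rw [obstacle, logPotential_eq]
    ring
  have h2 := (h.integrable_logPotential_circle hr).const_mul 2
  rw [h1]
  refine ⟨(integrable_const _).add h2, ?_⟩
  rw [integral_add (integrable_const _) h2, integral_const_mul, h.integral_logPotential_circle hr]
  simp [meanObstacle]

lemma meanObstacle_eq (h : IsGapPotential q σ N a b k) {r : ℝ} (hr : r = b k ∨ r = a (k + 1)) :
    meanObstacle (radialPotential q) σ r = q r := by
  have h0 := h.inner_pos
  have hr0 : 0 < r := by rcases hr with rfl | rfl <;> linarith [h.gap_lt]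
  rw [← (h.meanObstacle_eq_integral hr0).2]
  have : ∀ᵐ z ∂circleMeasure 0 r, obstacle (radialPotential q) σ z = q r := by
    filter_upwards [ae_circleMeasure 0 hr0.le] with z hz
    rw [sub_zero] at hz
    rw [h.obstacle_eq, hz]
    rcases hr with rfl | rfl
    · exact h.mem_droplet_inner (by rw [hz]; exact (h.radii_lt k h.gap_index.le).le) hz.le
    · exact h.mem_droplet_outer hz.ge (by rw [hz]; exact (h.radii_lt (k + 1) h.gap_index).le)
  rw [integral_congr_ae this]
  simp

/-- The whole circle lies off the droplet, and a pointwise strict inequality survives averaging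
against a probability measure. -/
lemma meanObstacle_lt (h : IsGapPotential q σ N a b k) {r : ℝ} (h1 : b k < r)
    (h2 : r < a (k + 1)) : meanObstacle (radialPotential q) σ r < q r := by
  have hr0 : 0 < r := h.inner_pos.trans h1
  obtain ⟨hi, he⟩ := h.meanObstacle_eq_integral hr0
  rw [← he, ← h.integral_circle hr0]
  have hlt : ∀ᵐ z ∂circleMeasure 0 r,
      0 < radialPotential q z - obstacle (radialPotential q) σ z := by
    filter_upwards [ae_circleMeasure 0 hr0.le] with z hz
    rw [sub_zero] at hz
    have := h.obstacle_lt z (h.notMem_droplet ⟨by rwa [hz], by rwa [hz]⟩)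
    linarith
  have hsub : Integrable (fun z => radialPotential q z - obstacle (radialPotential q) σ z)
      (circleMeasure 0 r) := (h.integrable_circle hr0).sub hi
  have hpos : 0 < ∫ z, (radialPotential q z - obstacle (radialPotential q) σ z)
      ∂circleMeasure 0 r := by
    rw [integral_pos_iff_support_of_nonneg_ae (by filter_upwards [hlt] with z hz using hz.le) hsub]
    have : Function.support (fun z => radialPotential q z - obstacle (radialPotential q) σ z) ∈
        ae (circleMeasure 0 r) := by
      filter_upwards [hlt] with z hz using hz.ne'
    rw [(mem_ae_iff_prob_eq_one₀ ?_).1 this]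
    · exact one_pos
    · exact hsub.aestronglyMeasurable.aemeasurable.nullMeasurable
        (measurableSet_singleton (0 : ℝ)).compl
  rw [integral_sub (h.integrable_circle hr0) hi] at hpos
  linarith

/-- The mass of the part of the droplet enclosed by the gap. -/
lemma ae_norm (h : IsGapPotential q σ N a b k) : ∀ᵐ w ∂σ, ‖w‖ ≤ b k ∨ a (k + 1) ≤ ‖w‖ := by
  filter_upwards [Measure.support_mem_ae (μ := σ)] with w hw using h.norm_le_or_le hw

/-- A shell adjacent to the gap contains a neighbourhood of a point of the support. Its mass is what
forces the profile to grow linearly to the left of the gap; `measure_outer_pos` plays the same role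
on the right. -/
lemma measure_inner_pos (h : IsGapPotential q σ N a b k) {ρ : ℝ} (hρ : ρ < b k) :
    0 < σ {w | ρ ≤ ‖w‖ ∧ ‖w‖ ≤ b k} := by
  set x := (max ρ (a k) + b k) / 2 with hx
  have hak := h.radii_lt k h.gap_index.le
  have ha0 := h.left_nonneg k h.gap_index.le
  have hm : max ρ (a k) < b k := max_lt hρ hak
  have h1 : max ρ (a k) < x := by linarith
  have h2 : x < b k := by linarith
  have hx0 : 0 ≤ x := ha0.trans ((le_max_right _ _).trans h1.le)
  have hn : ‖(x : ℂ)‖ = x := by simp [abs_of_nonneg hx0]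
  refine (Measure.mem_support_iff_forall (x : ℂ)).1 (h.mem_droplet_inner
    (by rw [hn]; exact (le_max_right _ _).trans h1.le) (by rw [hn]; exact h2.le)) _ ?_
  refine Filter.mem_of_superset ((isOpen_gap (max ρ (a k)) (b k)).mem_nhds ⟨?_, ?_⟩) ?_
  · rwa [hn]
  · rwa [hn]
  · exact fun w hw => ⟨(le_max_left _ _).trans hw.1.le, hw.2.le⟩

lemma measure_outer_pos (h : IsGapPotential q σ N a b k) {ρ : ℝ} (hρ : a (k + 1) < ρ) :
    0 < σ {w | a (k + 1) ≤ ‖w‖ ∧ ‖w‖ ≤ ρ} := by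
  set x := (a (k + 1) + min ρ (b (k + 1))) / 2 with hx
  have hak := h.radii_lt (k + 1) h.gap_index
  have ha0 := h.left_nonneg (k + 1) h.gap_index
  have hm : a (k + 1) < min ρ (b (k + 1)) := lt_min hρ hak
  have h1 : a (k + 1) < x := by linarith
  have h2 : x < min ρ (b (k + 1)) := by linarith
  have hx0 : 0 ≤ x := ha0.trans h1.le
  have hn : ‖(x : ℂ)‖ = x := by simp [abs_of_nonneg hx0]
  refine (Measure.mem_support_iff_forall (x : ℂ)).1 (h.mem_droplet_outer
    (by rw [hn]; exact h1.le) (by rw [hn]; exact h2.le.trans (min_le_right _ _))) _ ?_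
  refine Filter.mem_of_superset
    ((isOpen_gap (a (k + 1)) (min ρ (b (k + 1)))).mem_nhds ⟨?_, ?_⟩) ?_
  · rwa [hn]
  · rwa [hn]
  · exact fun w hw => ⟨hw.1.le, hw.2.le.trans (min_le_left _ _)⟩

end IsGapPotential

/-! ### Linearity over the gap and the enclosed mass -/

namespace IsGapPotential

variable {q : ℝ → ℝ} {σ : Measure ℂ} {N : ℕ} {a b : ℕ → ℝ} {k : ℕ}

/-- The deviation of `log (max r |w|)` from its linear part in `log r` over the gap. -/
noncomputable def excess (r₁ r : ℝ) (w : ℂ) : ℝ :=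
  Real.log (max r ‖w‖) - Real.log (max r₁ ‖w‖)
    - {w : ℂ | ‖w‖ ≤ r₁}.indicator (fun _ => Real.log r - Real.log r₁) w

lemma measurableSet_norm_le (r : ℝ) : MeasurableSet {w : ℂ | ‖w‖ ≤ r} :=
  measurableSet_le measurable_norm measurable_const

lemma integrable_excess (h : IsGapPotential q σ N a b k) {r : ℝ} (hr : 0 < r) :
    Integrable (excess (b k) r) σ := by
  obtain ⟨R, hd⟩ := h.data
  have := hd.isProbabilityMeasure
  have h1 := integrable_log_max hd.norm_le 0 hr
  have h2 := integrable_log_max hd.norm_le 0 h.inner_pos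
  simp only [sub_zero] at h1 h2
  exact (h1.sub h2).sub ((integrable_const _).indicator (measurableSet_norm_le _))

/-- The integrated excess measures how far the mean obstacle rises above its linear continuation
from the gap, so a pointwise lower bound for `excess` becomes a growth bound for `q`. -/
lemma integral_excess (h : IsGapPotential q σ N a b k) {r : ℝ} (hr : 0 < r) :
    2 * ∫ w, excess (b k) r w ∂σ =
      meanObstacle (radialPotential q) σ r - q (b k)
        - 2 * σ.real {w | ‖w‖ ≤ b k} * (Real.log r - Real.log (b k)) := by
  obtain ⟨R, hd⟩ := h.data
  have := hd.isProbabilityMeasure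
  have h1 := integrable_log_max hd.norm_le 0 hr
  have h2 := integrable_log_max hd.norm_le 0 h.inner_pos
  simp only [sub_zero] at h1 h2
  have h12 : Integrable (fun w => Real.log (max r ‖w‖) - Real.log (max (b k) ‖w‖)) σ := h1.sub h2
  simp only [excess]
  rw [integral_sub h12 ((integrable_const _).indicator (measurableSet_norm_le _)),
    integral_sub h1 h2, integral_indicator (measurableSet_norm_le _), setIntegral_const,
    ← h.meanObstacle_eq (Or.inl rfl), smul_eq_mul]
  simp only [meanObstacle]
  ring

lemma excess_inner {r₁ r : ℝ} {w : ℂ} (h : ‖w‖ ≤ r₁) :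
    excess r₁ r w = Real.log (max r ‖w‖) - Real.log r := by
  rw [excess, Set.indicator_of_mem (by exact h), max_eq_left h]
  ring

lemma excess_outer {r₁ r : ℝ} {w : ℂ} (h : r₁ < ‖w‖) :
    excess r₁ r w = Real.log (max r ‖w‖) - Real.log ‖w‖ := by
  rw [excess, Set.indicator_of_notMem (by simpa using h), max_eq_right h.le]
  ring

lemma excess_nonneg {r₁ r : ℝ} (h1 : 0 < r₁) (hr : 0 < r) (w : ℂ) : 0 ≤ excess r₁ r w := by
  rcases le_or_gt ‖w‖ r₁ with h | h
  · rw [excess_inner h, sub_nonneg]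
    exact Real.log_le_log hr (le_max_left _ _)
  · rw [excess_outer h, sub_nonneg]
    exact Real.log_le_log (h1.trans h) (le_max_right _ _)

/-- Since `σ` does not charge the gap, `log (max r ‖w‖)` is exactly `log r` for the mass inside and
does not depend on `r` for the mass outside. -/
lemma integral_excess_gap (h : IsGapPotential q σ N a b k) {r : ℝ} (h1 : b k ≤ r)
    (h2 : r ≤ a (k + 1)) : ∫ w, excess (b k) r w ∂σ = 0 := by
  refine (integral_congr_ae ?_).trans (integral_zero _ _)
  filter_upwards [h.ae_norm] with w hw
  have := h.gap_lt
  rcases hw with hw | hw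
  · rw [excess_inner hw, max_eq_left (hw.trans h1), sub_self]
  · rw [excess_outer (by linarith), max_eq_right (h2.trans hw), sub_self]

/-- The mass enclosed by the gap. -/
noncomputable def innerMass (σ : Measure ℂ) (r : ℝ) : ℝ := σ.real {w | ‖w‖ ≤ r}

/-- At both edges the obstacle and its circular mean equal `q`, so the slope of the obstacle is that
of the mean, which is linear over the gap. With `innerMass_pos` and `innerMass_lt_one` this places
the critical index `B n / 2` strictly between `0` and `n`, at distance proportional to `n` from
both. -/
lemma gapSlope_eq (h : IsGapPotential q σ N a b k) :
    gapSlope q σ (b k) (a (k + 1)) = 2 * innerMass σ (b k) := by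
  have h0 := h.inner_pos
  have h1 := h.gap_lt
  have h2 : 0 < a (k + 1) := h0.trans h1
  have n1 : ‖((b k : ℝ) : ℂ)‖ = b k := by simp [abs_of_pos h0]
  have n2 : ‖((a (k + 1) : ℝ) : ℂ)‖ = a (k + 1) := by simp [abs_of_pos h2]
  have e1 : obstacle (radialPotential q) σ ((b k : ℝ) : ℂ) = q (b k) := by
    rw [h.obstacle_eq, n1]
    exact h.mem_droplet_inner (by rw [n1]; exact (h.radii_lt k h.gap_index.le).le) n1.le
  have e2 : obstacle (radialPotential q) σ ((a (k + 1) : ℝ) : ℂ) = q (a (k + 1)) := by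
    rw [h.obstacle_eq, n2]
    exact h.mem_droplet_outer n2.ge (by rw [n2]; exact (h.radii_lt (k + 1) h.gap_index).le)
  have hlog : 0 < Real.log (a (k + 1)) - Real.log (b k) := sub_pos.2 (Real.log_lt_log h0 h1)
  have h3 := h.integral_excess h2
  rw [h.integral_excess_gap h1.le le_rfl, h.meanObstacle_eq (Or.inr rfl)] at h3
  rw [gapSlope, e1, e2, div_eq_iff hlog.ne', innerMass]
  linarith

lemma innerMass_pos (h : IsGapPotential q σ N a b k) : 0 < innerMass σ (b k) := by
  have := h.equilibrium.isProbabilityMeasure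
  refine ENNReal.toReal_pos ?_ (measure_ne_top _ _)
  refine ((h.measure_inner_pos (ρ := b k - 1) (by linarith)).trans_le (measure_mono ?_)).ne'
  exact fun w hw => hw.2

lemma innerMass_lt_one (h : IsGapPotential q σ N a b k) : innerMass σ (b k) < 1 := by
  have := h.equilibrium.isProbabilityMeasure
  have h1 := h.measure_outer_pos (ρ := a (k + 1) + 1) (by linarith)
  have h2 : 0 < σ.real {w : ℂ | ‖w‖ ≤ b k}ᶜ := by
    refine ENNReal.toReal_pos ?_ (measure_ne_top _ _)
    refine (h1.trans_le (measure_mono fun w hw => ?_)).ne'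
    have := hw.1
    have := h.gap_lt
    simp only [Set.mem_compl_iff, Set.mem_ofPred_eq, not_le]
    linarith
  rw [probReal_compl_eq_one_sub (measurableSet_norm_le _)] at h2
  rw [innerMass]
  linarith

lemma integral_excess_ge (h : IsGapPotential q σ N a b k) {r : ℝ} (hr : 0 < r) {s : Set ℂ}
    (hs : MeasurableSet s) {c : ℝ} (hc : ∀ w ∈ s, c ≤ excess (b k) r w) :
    σ.real s * c ≤ ∫ w, excess (b k) r w ∂σ := by
  have := h.equilibrium.isProbabilityMeasure
  have h1 : ∫ w, s.indicator (fun _ => c) w ∂σ = σ.real s * c := by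
    rw [integral_indicator hs, setIntegral_const, smul_eq_mul]
  rw [← h1]
  refine integral_mono ((integrable_const _).indicator hs) (h.integrable_excess hr) fun w => ?_
  by_cases hw : w ∈ s
  · rw [Set.indicator_of_mem hw]; exact hc w hw
  · rw [Set.indicator_of_notMem hw]; exact excess_nonneg h.inner_pos hr w

lemma excess_inner_ge {r₁ r ρ : ℝ} (hρ : 0 < ρ) {w : ℂ} (h1 : ρ ≤ ‖w‖) (h2 : ‖w‖ ≤ r₁) :
    Real.log ρ - Real.log r ≤ excess r₁ r w := by
  rw [excess_inner h2]
  gcongr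
  exact h1.trans (le_max_right _ _)

lemma excess_outer_ge {r₁ r₂ r ρ : ℝ} (h0 : 0 < r₁) (hr : 0 < r) (h12 : r₁ < r₂) {w : ℂ}
    (h1 : r₂ ≤ ‖w‖) (h2 : ‖w‖ ≤ ρ) : Real.log r - Real.log ρ ≤ excess r₁ r w := by
  rw [excess_outer (h12.trans_le h1)]
  have : 0 < ‖w‖ := by linarith
  gcongr
  exact le_max_left _ _

end IsGapPotential

/-- The potential in the variable `y = log r`, with the tangent line over the gap subtracted. -/
noncomputable def gapProfile (q : ℝ → ℝ) (r₁ B y : ℝ) : ℝ :=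
  q (Real.exp y) - q r₁ - B * (y - Real.log r₁)

/-! ### Positivity and growth of the profile -/

namespace IsGapPotential

variable {q : ℝ → ℝ} {σ : Measure ℂ} {N : ℕ} {a b : ℕ → ℝ} {k : ℕ}

/-- Replacing `q` by the smaller mean obstacle turns the profile into twice the integrated excess,
which is nonnegative and grows with the distance from the gap. -/
lemma le_gapProfile (h : IsGapPotential q σ N a b k) (y : ℝ) :
    2 * ∫ w, excess (b k) (Real.exp y) w ∂σ ≤
      gapProfile q (b k) (gapSlope q σ (b k) (a (k + 1))) y := by
  have h1 := h.integral_excess (Real.exp_pos y)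
  have h2 := h.meanObstacle_le (Real.exp_pos y)
  rw [Real.log_exp] at h1
  rw [h1, gapProfile, h.gapSlope_eq, innerMass]
  linarith

lemma gapProfile_nonneg (h : IsGapPotential q σ N a b k) (y : ℝ) :
    0 ≤ gapProfile q (b k) (gapSlope q σ (b k) (a (k + 1))) y :=
  (mul_nonneg zero_le_two (integral_nonneg fun w =>
    excess_nonneg h.inner_pos (Real.exp_pos y) w)).trans (h.le_gapProfile y)

lemma gapProfile_pos (h : IsGapPotential q σ N a b k) {y : ℝ} (h1 : Real.log (b k) < y)
    (h2 : y < Real.log (a (k + 1))) :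
    0 < gapProfile q (b k) (gapSlope q σ (b k) (a (k + 1))) y := by
  have h0 := h.inner_pos
  rw [Real.log_lt_iff_lt_exp h0] at h1
  rw [Real.lt_log_iff_exp_lt (h0.trans h.gap_lt)] at h2
  have h3 := h.integral_excess (Real.exp_pos y)
  have h4 := h.meanObstacle_lt h1 h2
  rw [h.integral_excess_gap h1.le h2.le, Real.log_exp] at h3
  rw [gapProfile, h.gapSlope_eq, innerMass]
  linarith

lemma gapProfile_inner (h : IsGapPotential q σ N a b k) (B : ℝ) :
    gapProfile q (b k) B (Real.log (b k)) = 0 := by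
  rw [gapProfile, Real.exp_log h.inner_pos]
  ring

lemma gapProfile_outer (h : IsGapPotential q σ N a b k) :
    gapProfile q (b k) (gapSlope q σ (b k) (a (k + 1))) (Real.log (a (k + 1))) = 0 := by
  have h2 := h.inner_pos.trans h.gap_lt
  have h3 := h.integral_excess h2
  rw [h.integral_excess_gap h.gap_lt.le le_rfl, h.meanObstacle_eq (Or.inr rfl)] at h3
  rw [gapProfile, Real.exp_log h2, h.gapSlope_eq, innerMass]
  linarith

lemma gapProfile_eq_radial (y r₁ B : ℝ) : gapProfile q r₁ B y =
    radialPotential q (Real.exp y : ℂ) + (-q r₁ - B * (y - Real.log r₁)) := by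
  rw [gapProfile, radialPotential, Complex.norm_real, Real.norm_eq_abs,
    Real.abs_exp]
  ring

lemma lowerSemicontinuous_gapProfile (h : IsGapPotential q σ N a b k) (B : ℝ) :
    LowerSemicontinuous (gapProfile q (b k) B) := by
  have h1 : LowerSemicontinuous fun y : ℝ => radialPotential q (Real.exp y : ℂ) :=
    h.lowerSemicontinuous.comp (by fun_prop)
  have h2 : Continuous fun y : ℝ => -q (b k) - B * (y - Real.log (b k)) := by fun_prop
  have := h1.add h2.lowerSemicontinuous
  rwa [show gapProfile q (b k) B = _ from funext fun y => gapProfile_eq_radial y (b k) B]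

/-- Away from the edges of the gap the profile grows at least linearly. -/
lemma exists_gapProfile_ge (h : IsGapPotential q σ N a b k) {δ : ℝ} (hδ : 0 < δ) :
    ∃ c > 0, ∀ y, δ ≤ |y - Real.log (b k)| → δ ≤ |y - Real.log (a (k + 1))| →
      c * (1 + |y - Real.log (b k)|) ≤
        gapProfile q (b k) (gapSlope q σ (b k) (a (k + 1))) y := by
  have hP := h.equilibrium.isProbabilityMeasure
  have h0 := h.inner_pos
  have h12 := h.gap_lt
  have h2 := h0.trans h12
  set y₁ := Real.log (b k) with hy₁
  set y₂ := Real.log (a (k + 1)) with hy₂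
  have hy12 : y₁ < y₂ := Real.log_lt_log h0 h12
  have e1 : Real.exp y₁ = b k := Real.exp_log h0
  have e2 : Real.exp y₂ = a (k + 1) := Real.exp_log h2
  set v := gapProfile q (b k) (gapSlope q σ (b k) (a (k + 1))) with hv
  have ms : ∀ s t : ℝ, MeasurableSet {w : ℂ | s ≤ ‖w‖ ∧ ‖w‖ ≤ t} := fun s t =>
    (measurableSet_le measurable_const measurable_norm).inter
      (measurableSet_le measurable_norm measurable_const)
  -- left of the gap
  set s₁ := {w : ℂ | Real.exp (y₁ - δ / 2) ≤ ‖w‖ ∧ ‖w‖ ≤ b k} with hs₁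
  have m1 : 0 < σ.real s₁ := ENNReal.toReal_pos (h.measure_inner_pos (by
    rw [← e1]; exact Real.exp_lt_exp.2 (by linarith))).ne' (measure_ne_top _ _)
  have hleft : ∀ y, y ≤ y₁ - δ → 2 * (σ.real s₁ * (y₁ - δ / 2 - y)) ≤ v y := by
    intro y _
    refine le_trans ?_ (h.le_gapProfile y)
    refine mul_le_mul_of_nonneg_left (h.integral_excess_ge (Real.exp_pos y) (ms _ _) ?_) zero_le_two
    rintro w ⟨hw1, hw2⟩
    have := excess_inner_ge (r := Real.exp y) (Real.exp_pos _) hw1 hw2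
    simpa only [Real.log_exp] using this
  -- right of the gap
  set s₂ := {w : ℂ | a (k + 1) ≤ ‖w‖ ∧ ‖w‖ ≤ Real.exp (y₂ + δ / 2)} with hs₂
  have m2 : 0 < σ.real s₂ := ENNReal.toReal_pos (h.measure_outer_pos (by
    rw [← e2]; exact Real.exp_lt_exp.2 (by linarith))).ne' (measure_ne_top _ _)
  have hright : ∀ y, y₂ + δ ≤ y → 2 * (σ.real s₂ * (y - (y₂ + δ / 2))) ≤ v y := by
    intro y _
    refine le_trans ?_ (h.le_gapProfile y)
    refine mul_le_mul_of_nonneg_left (h.integral_excess_ge (Real.exp_pos y) (ms _ _) ?_) zero_le_two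
    rintro w ⟨hw1, hw2⟩
    have := excess_outer_ge h0 (Real.exp_pos y) h12 hw1 hw2
    simpa only [Real.log_exp] using this
  -- inside the gap
  obtain ⟨η, hη, hmid⟩ : ∃ η > 0, ∀ y ∈ Set.Icc (y₁ + δ) (y₂ - δ), η ≤ v y := by
    rcases (Set.Icc (y₁ + δ) (y₂ - δ)).eq_empty_or_nonempty with he | hne
    · exact ⟨1, one_pos, by simp [he]⟩
    · obtain ⟨y, hy, hmin⟩ := LowerSemicontinuousOn.exists_isMinOn hne isCompact_Icc
        ((h.lowerSemicontinuous_gapProfile (gapSlope q σ (b k) (a (k + 1)))).lowerSemicontinuousOn _)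
      exact ⟨v y, h.gapProfile_pos (by linarith [hy.1]) (by linarith [hy.2]),
        fun z hz => hmin hz⟩
  set D := y₂ - y₁ with hD
  have hD0 : 0 < D := sub_pos.2 hy12
  -- One constant per region. At distance `t ≥ δ` outside an edge, `2 (t - δ/2) ≥ t`, and `t ≥ δ /
  -- (1 + δ) * (1 + t)`; on the right `|y - y₁| = D + t` replaces `1 + δ` by `1 + δ + D`. Inside the
  -- gap `1 + |y - y₁| ≤ 1 + D`.
  refine ⟨min (σ.real s₁ * (δ / (1 + δ))) (min (σ.real s₂ * (δ / (1 + δ + D))) (η / (1 + D))),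
    by positivity, fun y ha hb => ?_⟩
  have hA : (0 : ℝ) ≤ 1 + |y - y₁| := by positivity
  rcases le_or_gt y y₁ with hy | hy
  · rw [abs_of_nonpos (by linarith)] at ha hA ⊢
    refine le_trans (mul_le_mul_of_nonneg_right (min_le_left _ _) hA) ?_
    refine le_trans ?_ (hleft y (by linarith))
    rw [mul_assoc, mul_left_comm 2]
    refine mul_le_mul_of_nonneg_left ?_ m1.le
    rw [div_mul_eq_mul_div, div_le_iff₀ (by positivity)]
    nlinarith
  · rcases le_or_gt y y₂ with hy' | hy'
    · rw [abs_of_pos (by linarith)] at ha hA ⊢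
      rw [abs_of_nonpos (by linarith)] at hb
      refine le_trans (mul_le_mul_of_nonneg_right ((min_le_right _ _).trans (min_le_right _ _)) hA)
        ?_
      refine le_trans ?_ (hmid y ⟨by linarith, by linarith⟩)
      rw [div_mul_eq_mul_div, div_le_iff₀ (by positivity)]
      exact mul_le_mul_of_nonneg_left (by linarith) hη.le
    · rw [abs_of_pos (by linarith)] at ha hA ⊢
      rw [abs_of_pos (by linarith)] at hb
      refine le_trans (mul_le_mul_of_nonneg_right ((min_le_right _ _).trans (min_le_left _ _)) hA)
        ?_
      refine le_trans ?_ (hright y (by linarith))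
      rw [mul_assoc, mul_left_comm 2]
      refine mul_le_mul_of_nonneg_left ?_ m2.le
      rw [div_mul_eq_mul_div, div_le_iff₀ (by positivity)]
      nlinarith

end IsGapPotential

/-! ### The profile at the edges of the gap -/

/-- The mean value inequality on the segment from `x₀` raises the order of vanishing by one. Two
applications to a Lipschitz second derivative give the Taylor estimate below. -/
lemma abs_sub_le_of_hasDerivAt {f f' : ℝ → ℝ} {x₀ δ C : ℝ} (hC : 0 ≤ C) (m : ℕ)
    (hf : ∀ x, |x - x₀| < δ → HasDerivAt f (f' x) x)
    (hb : ∀ x, |x - x₀| < δ → |f' x| ≤ C * |x - x₀| ^ m) (h0 : f x₀ = 0) {x : ℝ}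
    (hx : |x - x₀| < δ) : |f x| ≤ C * |x - x₀| ^ (m + 1) := by
  have hseg : ∀ y ∈ Set.uIcc x₀ x, |y - x₀| ≤ |x - x₀| := fun y hy =>
    Set.abs_sub_left_of_mem_uIcc hy
  have := (convex_uIcc x₀ x).norm_image_sub_le_of_norm_hasDerivWithin_le (f := f) (f' := f')
    (C := C * |x - x₀| ^ m)
    (fun y hy => (hf y ((hseg y hy).trans_lt hx)).hasDerivWithinAt)
    (fun y hy => (hb y ((hseg y hy).trans_lt hx)).trans
      (mul_le_mul_of_nonneg_left (pow_le_pow_left₀ (abs_nonneg _) (hseg y hy) m) hC))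
    Set.left_mem_uIcc Set.right_mem_uIcc
  rw [h0, sub_zero, Real.norm_eq_abs, Real.norm_eq_abs] at this
  rw [pow_succ, ← mul_assoc]
  exact this

/-- Second-order Taylor expansion with cubic remainder. -/
lemma exists_taylor_two {f : ℝ → ℝ} {x₀ : ℝ} (hf : ContDiffAt ℝ 3 f x₀) :
    ∃ C > 0, ∃ δ > 0, ∀ x, |x - x₀| < δ →
      |f x - f x₀ - deriv f x₀ * (x - x₀) - deriv (deriv f) x₀ / 2 * (x - x₀) ^ 2|
        ≤ C * |x - x₀| ^ 3 := by
  have h1 : ContDiffAt ℝ 2 (deriv f) x₀ := hf.derivWithin (m := 2) (n := 3) (by norm_num)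
  have h2 : ContDiffAt ℝ 1 (deriv (deriv f)) x₀ := h1.derivWithin (m := 1) (n := 2) (by norm_num)
  obtain ⟨K, t, ht, hK⟩ := h2.exists_lipschitzOnWith
  have e0 : ∀ᶠ x in 𝓝 x₀, DifferentiableAt ℝ f x :=
    (hf.eventually (by norm_num)).mono fun x hx => hx.differentiableAt (by norm_num)
  have e1 : ∀ᶠ x in 𝓝 x₀, DifferentiableAt ℝ (deriv f) x :=
    (h1.eventually (by norm_num)).mono fun x hx => hx.differentiableAt (by norm_num)
  obtain ⟨δ, hδ, hball⟩ := Metric.eventually_nhds_iff.1 (e0.and (e1.and ht))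
  simp only [Real.dist_eq] at hball
  have b2 : ∀ x, |x - x₀| < δ → |deriv (deriv f) x - deriv (deriv f) x₀| ≤
      (K + 1 : ℝ) * |x - x₀| ^ 1 := by
    intro x hx
    have := hK.dist_le_mul x (hball hx).2.2 x₀ (mem_of_mem_nhds ht)
    rw [Real.dist_eq, Real.dist_eq] at this
    rw [pow_one]
    exact this.trans (by gcongr; linarith)
  have hK0 : (0 : ℝ) ≤ K + 1 := by positivity
  have b1 : ∀ x, |x - x₀| < δ →
      |deriv f x - deriv f x₀ - deriv (deriv f) x₀ * (x - x₀)| ≤ (K + 1 : ℝ) * |x - x₀| ^ 2 := by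
    intro x hx
    refine abs_sub_le_of_hasDerivAt (f := fun x => deriv f x - deriv f x₀
      - deriv (deriv f) x₀ * (x - x₀)) (f' := fun x => deriv (deriv f) x - deriv (deriv f) x₀)
      hK0 1 (fun y hy => ?_) b2 (by ring) hx
    have := ((hball hy).2.1.hasDerivAt.sub_const (deriv f x₀)).sub
      (((hasDerivAt_id y).sub_const x₀).const_mul (deriv (deriv f) x₀))
    exact this.congr_deriv (by simp)
  refine ⟨K + 1, by positivity, δ, hδ, fun x hx => ?_⟩
  refine abs_sub_le_of_hasDerivAt (f := fun x => f x - f x₀ - deriv f x₀ * (x - x₀)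
    - deriv (deriv f) x₀ / 2 * (x - x₀) ^ 2)
    (f' := fun x => deriv f x - deriv f x₀ - deriv (deriv f) x₀ * (x - x₀))
    hK0 2 (fun y hy => ?_) b1 (by ring) hx
  have := (((hball hy).1.hasDerivAt.sub_const (f x₀)).sub
    (((hasDerivAt_id y).sub_const x₀).const_mul (deriv f x₀))).sub
    ((((hasDerivAt_id y).sub_const x₀).pow 2).const_mul (deriv (deriv f) x₀ / 2))
  refine this.congr_deriv ?_
  simp
  ring

/-- The second derivative along a logarithmic curve `t ↦ r e^{t ω}`. -/
lemma deriv_deriv_comp_exp {Q : ℂ → ℝ} {r : ℝ} (hQ : ContDiffAt ℝ 2 Q (r : ℂ)) (ω : ℂ) :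
    deriv (deriv fun t : ℝ => Q (r * Complex.exp (t * ω))) 0 =
      fderiv ℝ (fderiv ℝ Q) r (ω * r) (ω * r) + fderiv ℝ Q r (ω * (ω * r)) := by
  set c : ℝ → ℂ := fun t => r * Complex.exp (t * ω) with hc
  have c0 : c 0 = r := by simp [hc]
  have hc' : ∀ t, HasDerivAt c (ω * c t) t := by
    intro t
    have h1 : HasDerivAt (fun t : ℝ => (t : ℂ) * ω) (1 * ω) t :=
      (Complex.ofRealCLM.hasDerivAt (x := t)).mul_const ω
    have := (h1.cexp).const_mul (r : ℂ)
    refine this.congr_deriv ?_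
    simp only [hc]
    ring
  have hcc : ContinuousAt c 0 := (hc' 0).continuousAt
  have hev : ∀ᶠ t in 𝓝 (0 : ℝ), DifferentiableAt ℝ Q (c t) := by
    refine hcc.eventually (p := fun z => DifferentiableAt ℝ Q z) ?_
    rw [c0]
    exact (hQ.eventually (by norm_num)).mono fun x hx => hx.differentiableAt (by norm_num)
  have hd : (deriv fun t : ℝ => Q (c t)) =ᶠ[𝓝 0] fun t => fderiv ℝ Q (c t) (ω * c t) := by
    filter_upwards [hev] with t ht
    exact (ht.hasFDerivAt.comp_hasDerivAt t (hc' t)).deriv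
  rw [hd.deriv_eq]
  have hD : HasFDerivAt (fderiv ℝ Q) (fderiv ℝ (fderiv ℝ Q) (c 0)) (c 0) := by
    rw [c0]
    exact ((hQ.fderiv_right (m := 1) (by norm_num)).differentiableAt (by norm_num)).hasFDerivAt
  have h3 := (hD.comp_hasDerivAt (0 : ℝ) (hc' 0)).clm_apply ((hc' 0).const_mul ω)
  rw [c0] at h3
  have h4 := h3.deriv
  simp only [Function.comp_apply, c0] at h4
  exact h4

/-- The Laplacian of a radial function in the logarithmic variable. -/
lemma deriv_deriv_radial {q : ℝ → ℝ} {r : ℝ} (hr : 0 < r)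
    (hQ : ContDiffAt ℝ 2 (radialPotential q) (r : ℂ)) :
    deriv (deriv fun y : ℝ => q (Real.exp y)) (Real.log r) =
      4 * r ^ 2 * quarterLaplacian (radialPotential q) (r : ℂ) := by
  set Q := radialPotential q with hQdef
  -- The direction `1` is radial and `I` is angular, where `Q` is constant. Adding the two second
  -- derivatives gives `r²` times the Laplacian, and the first-order terms cancel because `I² = -1`.
  have h1 := deriv_deriv_comp_exp hQ 1
  have h2 := deriv_deriv_comp_exp hQ Complex.I
  have e1 : (fun t : ℝ => Q (r * Complex.exp (t * 1))) =
      fun t => (fun y : ℝ => q (Real.exp y)) (Real.log r + t) := by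
    ext t
    change q _ = q (Real.exp (Real.log r + t))
    rw [Real.exp_add, Real.exp_log hr, mul_one, norm_mul,
      Complex.norm_exp, Complex.norm_real, Complex.ofReal_re, Real.norm_of_nonneg hr.le]
  have e2 : (fun t : ℝ => Q (r * Complex.exp (t * Complex.I))) = fun _ => q r := by
    ext t
    rw [hQdef, radialPotential, norm_mul, Complex.norm_exp_ofReal_mul_I, Complex.norm_real,
      Real.norm_of_nonneg hr.le, mul_one]
  rw [e1] at h1
  have e3 : (deriv fun t => (fun y : ℝ => q (Real.exp y)) (Real.log r + t)) =
      fun t => deriv (fun y : ℝ => q (Real.exp y)) (Real.log r + t) := by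
    ext t
    exact deriv_comp_const_add (f := fun y : ℝ => q (Real.exp y)) (Real.log r) t
  rw [e3, deriv_comp_const_add, add_zero] at h1
  rw [e2] at h2
  simp only [deriv_const', deriv_const] at h2
  have s1 : (1 : ℂ) * r = r • (1 : ℂ) := by simp
  have s2 : (1 : ℂ) * (1 * r) = r • (1 : ℂ) := by simp
  have s3 : Complex.I * r = r • Complex.I := by simp [mul_comm]
  have s4 : Complex.I * (Complex.I * r) = -(r • (1 : ℂ)) := by
    rw [← mul_assoc, Complex.I_mul_I]; simp
  rw [s2, s1] at h1
  rw [s4, s3] at h2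
  simp only [map_smul, map_neg, smul_apply, smul_eq_mul] at h1 h2
  rw [h1, quarterLaplacian, InnerProductSpace.laplacian_eq_iteratedFDeriv_complexPlane]
  simp only [iteratedFDeriv_two_apply, Matrix.cons_val_zero, Matrix.cons_val_one]
  linear_combination h2

namespace IsGapPotential

variable {q : ℝ → ℝ} {σ : Measure ℂ} {N : ℕ} {a b : ℕ → ℝ} {k : ℕ}

/-- The edge is a global minimum of the profile with value `0`, so the constant and linear Taylor
terms vanish. Half the second derivative in `log r` is `2 ΔQ(r) r²`. -/
lemma exists_gapProfile_expansion (h : IsGapPotential q σ N a b k) {r : ℝ}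
    (hr : r = b k ∨ r = a (k + 1)) :
    ∃ C > 0, ∃ δ > 0, ∀ y, |y - Real.log r| < δ →
      |gapProfile q (b k) (gapSlope q σ (b k) (a (k + 1))) y
        - 2 * quarterLaplacian (radialPotential q) (r : ℂ) * r ^ 2 * (y - Real.log r) ^ 2|
        ≤ C * |y - Real.log r| ^ 3 := by
  have hr0 : 0 < r := by rcases hr with rfl | rfl <;> linarith [h.inner_pos, h.gap_lt]
  set B := gapSlope q σ (b k) (a (k + 1)) with hB
  set g : ℝ → ℝ := fun y => q (Real.exp y) with hg
  have hgQ : g = fun y : ℝ => radialPotential q (Real.exp y : ℂ) := by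
    ext y
    rw [hg, radialPotential, Complex.norm_real, Real.norm_eq_abs, Real.abs_exp]
  have hQ := h.contDiffAt hr
  have hgc : ContDiffAt ℝ 3 g (Real.log r) := by
    rw [hgQ]
    have h1 : ContDiffAt ℝ 3 (fun y : ℝ => (Real.exp y : ℂ)) (Real.log r) :=
      (Complex.ofRealCLM.contDiff.comp Real.contDiff_exp).contDiffAt
    have h2 : ContDiffAt ℝ 3 (radialPotential q) (Real.exp (Real.log r) : ℂ) := by
      rw [Real.exp_log hr0]
      exact hQ.of_le (by norm_num)
    exact ContDiffAt.comp (g := radialPotential q) (f := fun y : ℝ => (Real.exp y : ℂ)) _ h2 h1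
  have hv0 : gapProfile q (b k) B (Real.log r) = 0 := by
    rcases hr with rfl | rfl
    exacts [h.gapProfile_inner B, h.gapProfile_outer]
  have hd : HasDerivAt (gapProfile q (b k) B) (deriv g (Real.log r) - B) (Real.log r) := by
    have := ((hgc.differentiableAt (by norm_num)).hasDerivAt.sub_const (q (b k))).sub
      (((hasDerivAt_id (Real.log r)).sub_const (Real.log (b k))).const_mul B)
    exact this.congr_deriv (by simp)
  have hmin : IsLocalMin (gapProfile q (b k) B) (Real.log r) :=
    Eventually.of_forall fun y => by
      rw [hv0]
      exact h.gapProfile_nonneg y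
  have hz := hmin.hasDerivAt_eq_zero hd
  have hdd := deriv_deriv_radial hr0 (hQ.of_le (by norm_num))
  obtain ⟨C, hC, δ, hδ, hT⟩ := exists_taylor_two hgc
  refine ⟨C, hC, δ, hδ, fun y hy => ?_⟩
  refine le_of_eq_of_le ?_ (hT y hy)
  congr 1
  rw [hdd]
  rw [gapProfile] at hv0 ⊢
  simp only [hg]
  linear_combination hv0 + (y - Real.log r) * hz

end IsGapPotential

/-! ### Laplace asymptotics for a double well -/

/-- A measurable function on the line with two nondegenerate zero minima `y₁ < y₂`. -/
structure DoubleWell (v : ℝ → ℝ) (y₁ y₂ α₁ α₂ C c δ : ℝ) : Prop where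
  measurable : Measurable v
  lt : y₁ < y₂
  α₁_pos : 0 < α₁
  α₂_pos : 0 < α₂
  C_pos : 0 < C
  c_pos : 0 < c
  δ_pos : 0 < δ
  two_mul_lt : 2 * δ < y₂ - y₁
  small₁ : C * δ ≤ α₁ / 2
  small₂ : C * δ ≤ α₂ / 2
  near₁ : ∀ y, |y - y₁| ≤ δ → |v y - α₁ * (y - y₁) ^ 2| ≤ C * |y - y₁| ^ 3
  near₂ : ∀ y, |y - y₂| ≤ δ → |v y - α₂ * (y - y₂) ^ 2| ≤ C * |y - y₂| ^ 3
  far : ∀ y, δ ≤ |y - y₁| → δ ≤ |y - y₂| → c * (1 + |y - y₁|) ≤ v y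

/-- The exponential moments `∫ exp (p y - n v(y)) dy`. -/
noncomputable def expMoment (v : ℝ → ℝ) (n p : ℝ) : ℝ := ∫ y, Real.exp (p * y - n * v y)

/-- Both powers are at most `1 + x⁴`, which the quadratic lower bound for the exponential absorbs.
Polynomial factors thus cost only a small part of a Gaussian exponent. -/
lemma le_mul_exp_sq {β : ℝ} (hβ : 0 < β) (x : ℝ) :
    x ≤ (1 + 2 / β ^ 2) * Real.exp (β * x ^ 2) ∧ x ^ 3 ≤ (1 + 2 / β ^ 2) * Real.exp (β * x ^ 2) := by
  have h1 := Real.quadratic_le_exp_of_nonneg (x := β * x ^ 2) (by positivity)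
  have h2 : 1 + x ^ 4 ≤ (1 + 2 / β ^ 2) * Real.exp (β * x ^ 2) := by
    calc 1 + x ^ 4 = 1 + 2 / β ^ 2 * ((β * x ^ 2) ^ 2 / 2) := by field_simp
      _ ≤ Real.exp (β * x ^ 2) + 2 / β ^ 2 * Real.exp (β * x ^ 2) := by
        gcongr
        · exact Real.one_le_exp (by positivity)
        · have : 0 ≤ β * x ^ 2 := by positivity
          linarith
      _ = _ := by ring
  have h3 : x ≤ 1 + x ^ 4 := by nlinarith [sq_nonneg (x ^ 2 - 1 / 2), sq_nonneg (x - 1 / 2)]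
  have h4 : x ^ 3 ≤ 1 + x ^ 4 := by
    nlinarith [sq_nonneg (x ^ 2 - x / 2), sq_nonneg x, sq_nonneg (x ^ 2 - 1)]
  exact ⟨h3.trans h2, h4.trans h2⟩

lemma sq_mul_le_well {α C δ u V : ℝ} (hC : 0 < C) (hsm : C * δ ≤ α / 2) (hu : |u| ≤ δ)
    (hV : |V - α * u ^ 2| ≤ C * |u| ^ 3) : α / 2 * u ^ 2 ≤ V := by
  have h1 := (abs_le.1 hV).1
  have h2 : C * |u| ^ 3 ≤ α / 2 * u ^ 2 := by
    rw [← sq_abs u, pow_succ, mul_comm (|u| ^ 2), ← mul_assoc]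
    gcongr
    exact (mul_le_mul_of_nonneg_left hu hC.le).trans hsm
  linarith

lemma well_le {α C δ u V : ℝ} (hC : 0 < C) (hu : |u| ≤ δ)
    (hV : |V - α * u ^ 2| ≤ C * |u| ^ 3) : V ≤ (α + C * δ) * u ^ 2 := by
  have h1 := (abs_le.1 hV).2
  have h2 : C * |u| ^ 3 ≤ C * δ * u ^ 2 := by
    rw [← sq_abs u, pow_succ, mul_comm (|u| ^ 2), ← mul_assoc]
    gcongr
  linarith

/-- Completing the square. The weight is chosen so that a quarter of the exponent `n α u²` pays for
the linear term; the remainder `p² / (n α)` is bounded when `|p| ≤ √n`. -/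
lemma abs_mul_abs_le {n α p u : ℝ} (hn : 0 < n) (hα : 0 < α) :
    |p| * |u| ≤ p ^ 2 / (n * α) + n * α / 4 * u ^ 2 := by
  rw [← sq_abs p, ← sq_abs u]
  have h : 0 < n * α := by positivity
  have : |p| ^ 2 / (n * α) + n * α / 4 * |u| ^ 2 - |p| * |u| =
      (|p| - n * α / 2 * |u|) ^ 2 / (n * α) := by field_simp; ring
  have : 0 ≤ (|p| - n * α / 2 * |u|) ^ 2 / (n * α) := by positivity
  linarith

lemma abs_exp_sub_exp_le {x y M : ℝ} (hx : x ≤ M) (hy : y ≤ M) :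
    |Real.exp x - Real.exp y| ≤ |x - y| * Real.exp M := by
  wlog h : y ≤ x generalizing x y
  · rw [abs_sub_comm, abs_sub_comm x]
    exact this hy hx (by linarith)
  rw [abs_of_nonneg (sub_nonneg.2 (Real.exp_le_exp.2 h)), abs_of_nonneg (sub_nonneg.2 h)]
  have h1 : 1 - Real.exp (y - x) ≤ x - y := by linarith [Real.add_one_le_exp (y - x)]
  calc Real.exp x - Real.exp y = (1 - Real.exp (y - x)) * Real.exp x := by
        rw [sub_mul, ← Real.exp_add]; ring_nf
    _ ≤ (x - y) * Real.exp M := by gcongr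

/-- The constant in the Gaussian comparison at a single well. -/
noncomputable def wellConst (α C δ : ℝ) : ℝ :=
  (1 + C + 1 / δ) * (1 + 2 / (α / 8) ^ 2) * Real.exp (1 / α)

lemma abs_sqrt_mul_pow {n u : ℝ} (hn : 0 < n) : (Real.sqrt n * |u|) ^ 2 = n * u ^ 2 := by
  rw [mul_pow, Real.sq_sqrt hn.le, sq_abs]

lemma wellConst_pos {α C δ : ℝ} (hC : 0 < C) (hδ : 0 < δ) :
    0 < wellConst α C δ := by unfold wellConst; positivity

/-- Comparison with the Gaussian near a well. -/
lemma abs_exp_sub_gauss_le {α C δ n p u V : ℝ} (hα : 0 < α) (hC : 0 < C) (hδ : 0 < δ)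
    (hsm : C * δ ≤ α / 2) (hn : 1 ≤ n) (hp : |p| ≤ Real.sqrt n) (hu : |u| ≤ δ)
    (hV : |V - α * u ^ 2| ≤ C * |u| ^ 3) :
    |Real.exp (p * u - n * V) - Real.exp (-(n * α * u ^ 2))| ≤
      wellConst α C δ * (1 + |p|) / Real.sqrt n * Real.exp (-(n * α / 8 * u ^ 2)) := by
  have hn0 : 0 < n := by linarith
  have hs : 0 < Real.sqrt n := Real.sqrt_pos.2 hn0
  set X := Real.sqrt n * |u| with hX
  have hX0 : 0 ≤ X := by positivity
  have hX2 : X ^ 2 = n * u ^ 2 := abs_sqrt_mul_pow hn0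
  have hp2 : p ^ 2 / (n * α) ≤ 1 / α := by
    rw [← sq_abs p, div_le_div_iff₀ (by positivity) hα]
    have : |p| ^ 2 ≤ n := by
      calc |p| ^ 2 ≤ Real.sqrt n ^ 2 := by gcongr
        _ = n := Real.sq_sqrt hn0.le
    nlinarith
  have h1 := abs_mul_abs_le (p := p) (u := u) hn0 hα
  have hpu : p * u ≤ |p| * |u| := by rw [← abs_mul]; exact le_abs_self _
  have hlow := sq_mul_le_well hC hsm hu hV
  -- The cubic error takes half of `α` and the linear term another quarter, which leaves a common
  -- Gaussian majorant for both exponents.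
  have hM1 : p * u - n * V ≤ 1 / α - n * α / 4 * u ^ 2 := by
    have := mul_le_mul_of_nonneg_left hlow hn0.le
    nlinarith
  have hM2 : -(n * α * u ^ 2) ≤ 1 / α - n * α / 4 * u ^ 2 := by
    have : 0 ≤ n * α * u ^ 2 := by positivity
    have : 0 < 1 / α := by positivity
    linarith
  refine (abs_exp_sub_exp_le hM1 hM2).trans ?_
  -- In the scaled variable `X = √n |u|` the exponents differ by at most `(|p| X + C X³) / √n`.
  -- Absorbing the powers costs `α / 8`, half of what is left. The summand `1 / δ` is there for
  -- `gauss_le_of_le_abs`, which shares the constant.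
  have hd : |p * u - n * V - -(n * α * u ^ 2)| ≤ (1 + C + 1 / δ) * (1 + |p|) / Real.sqrt n *
      ((1 + 2 / (α / 8) ^ 2) * Real.exp (α / 8 * X ^ 2)) := by
    obtain ⟨hX1, hX3⟩ := le_mul_exp_sq (by positivity : 0 < α / 8) X
    set E := (1 + 2 / (α / 8) ^ 2) * Real.exp (α / 8 * X ^ 2) with hE
    have hE0 : 0 ≤ E := by positivity
    have eu : |u| = X / Real.sqrt n := by rw [hX]; field_simp
    have eu3 : n * |u| ^ 3 = X ^ 3 / Real.sqrt n := by
      rw [hX]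
      rw [eq_div_iff hs.ne']
      calc n * |u| ^ 3 * Real.sqrt n = Real.sqrt n * Real.sqrt n * |u| ^ 3 * Real.sqrt n := by
            rw [Real.mul_self_sqrt hn0.le]
        _ = _ := by ring
    calc |p * u - n * V - -(n * α * u ^ 2)| = |p * u + -(n * (V - α * u ^ 2))| := by
          congr 1; ring
      _ ≤ |p| * |u| + n * (C * |u| ^ 3) := by
        refine (abs_add_le _ _).trans ?_
        rw [abs_neg, abs_mul, abs_mul, abs_of_pos hn0]
        gcongr
      _ = (|p| * X + C * X ^ 3) / Real.sqrt n := by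
        rw [mul_left_comm n, eu3, eu]; ring
      _ ≤ ((1 + C + 1 / δ) * (1 + |p|) * E) / Real.sqrt n := by
        gcongr
        have h5 : |p| * X ≤ |p| * E := by gcongr
        have h6 : C * X ^ 3 ≤ C * E := by gcongr
        have h7 : 0 ≤ |p| * E := by positivity
        have h8 : 0 ≤ C * |p| * E := by positivity
        have h9 : 0 ≤ 1 / δ * (1 + |p|) * E := by positivity
        nlinarith
      _ = _ := by ring
  calc |p * u - n * V - -(n * α * u ^ 2)| * Real.exp (1 / α - n * α / 4 * u ^ 2)
      ≤ ((1 + C + 1 / δ) * (1 + |p|) / Real.sqrt n *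
      ((1 + 2 / (α / 8) ^ 2) * Real.exp (α / 8 * X ^ 2))) *
        Real.exp (1 / α - n * α / 4 * u ^ 2) := by gcongr
    _ = (1 + C + 1 / δ) * (1 + 2 / (α / 8) ^ 2) * (1 + |p|) / Real.sqrt n *
        (Real.exp (α / 8 * X ^ 2) * Real.exp (1 / α - n * α / 4 * u ^ 2)) := by ring
    _ = (1 + C + 1 / δ) * (1 + 2 / (α / 8) ^ 2) * (1 + |p|) / Real.sqrt n *
        (Real.exp (1 / α) * Real.exp (-(n * α / 8 * u ^ 2))) := by
      rw [← Real.exp_add, ← Real.exp_add, hX2]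
      congr 2
      ring
    _ = _ := by unfold wellConst; ring

/-- The Gaussian is negligible away from the well. -/
lemma gauss_le_of_le_abs {α C δ n p u : ℝ} (hα : 0 < α) (hC : 0 < C) (hδ : 0 < δ)
    (hn : 1 ≤ n) (hu : δ ≤ |u|) :
    Real.exp (-(n * α * u ^ 2)) ≤
      wellConst α C δ * (1 + |p|) / Real.sqrt n * Real.exp (-(n * α / 8 * u ^ 2)) := by
  have hn0 : 0 < n := by linarith
  have hs : 0 < Real.sqrt n := Real.sqrt_pos.2 hn0
  set X := Real.sqrt n * |u| with hX
  have hX0 : 0 ≤ X := by positivity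
  have hX2 : X ^ 2 = n * u ^ 2 := abs_sqrt_mul_pow hn0
  obtain ⟨hX1, -⟩ := le_mul_exp_sq (by positivity : 0 < α / 8) X
  have h1 : 1 ≤ 1 / δ / Real.sqrt n * ((1 + 2 / (α / 8) ^ 2) * Real.exp (α / 8 * X ^ 2)) := by
    refine le_trans ?_ (mul_le_mul_of_nonneg_left hX1 (by positivity))
    rw [hX]
    field_simp
    exact hu
  calc Real.exp (-(n * α * u ^ 2)) ≤
        (1 / δ / Real.sqrt n * ((1 + 2 / (α / 8) ^ 2) * Real.exp (α / 8 * X ^ 2))) *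
          Real.exp (-(n * α * u ^ 2)) := le_mul_of_one_le_left (Real.exp_pos _).le h1
    _ = 1 / δ * (1 + 2 / (α / 8) ^ 2) * 1 * 1 / Real.sqrt n *
        (Real.exp (α / 8 * X ^ 2) * Real.exp (-(n * α * u ^ 2))) := by ring
    _ ≤ (1 + C + 1 / δ) * (1 + 2 / (α / 8) ^ 2) * Real.exp (1 / α) * (1 + |p|) / Real.sqrt n *
        Real.exp (-(n * α / 8 * u ^ 2)) := by
      rw [← Real.exp_add, hX2]
      have e1 : 1 ≤ Real.exp (1 / α) := Real.one_le_exp (by positivity)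
      have e2 : 1 ≤ 1 + |p| := by linarith [abs_nonneg p]
      gcongr
      · linarith
      · have : 0 ≤ n * α * u ^ 2 := by positivity
        linarith
    _ = _ := rfl

lemma integrable_exp_neg_abs : Integrable fun u : ℝ => Real.exp (-|u|) := by
  have h1 : IntegrableOn (fun u : ℝ => Real.exp (-|u|)) (Set.Ioi 0) := by
    refine (integrableOn_exp_neg_Ioi 0).congr_fun (fun u hu => ?_) measurableSet_Ioi
    rw [abs_of_pos hu]
  have h2 : IntegrableOn (fun u : ℝ => Real.exp (-|u|)) (Set.Iic 0) := by
    refine (integrableOn_exp_Iic 0).congr_fun (fun u hu => ?_) measurableSet_Iic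
    rw [abs_of_nonpos hu, neg_neg]
  rw [← integrableOn_univ, ← Set.Iic_union_Ioi (a := (0 : ℝ))]
  exact h2.union h1

lemma integrable_gauss_shift {b : ℝ} (hb : 0 < b) (y₀ : ℝ) :
    Integrable fun y : ℝ => Real.exp (-(b * (y - y₀) ^ 2)) := by
  have := (integrable_exp_neg_mul_sq hb).comp_sub_right y₀
  simpa only [neg_mul] using this

lemma integral_gauss_shift (b y₀ : ℝ) :
    ∫ y : ℝ, Real.exp (-(b * (y - y₀) ^ 2)) = Real.sqrt (Real.pi / b) := by
  rw [integral_sub_right_eq_self (fun y : ℝ => Real.exp (-(b * y ^ 2))) y₀, ← integral_gaussian b]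
  simp only [neg_mul]

lemma integral_add_three {f g h : ℝ → ℝ} (hf : Integrable f) (hg : Integrable g)
    (hh : Integrable h) : ∫ x, (f x + g x + h x) = (∫ x, f x) + (∫ x, g x) + ∫ x, h x := by
  have h1 : Integrable fun x => f x + g x := hf.add hg
  rw [integral_add h1 hh, integral_add hf hg]

lemma integral_sub_add {f g h : ℝ → ℝ} (hf : Integrable f) (hg : Integrable g)
    (hh : Integrable h) : ∫ x, (f x - (g x + h x)) = (∫ x, f x) - ((∫ x, g x) + ∫ x, h x) := by
  have h1 : Integrable fun x => g x + h x := hg.add hh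
  rw [integral_sub hf h1, integral_add hg hh]

/-! ### Two-sided bounds for the moments of a double well -/

namespace DoubleWell

variable {v : ℝ → ℝ} {y₁ y₂ α₁ α₂ C c δ : ℝ}

lemma le_abs_sub₂ (h : DoubleWell v y₁ y₂ α₁ α₂ C c δ) {y : ℝ} (hy : |y - y₁| ≤ δ) :
    δ ≤ |y - y₂| := by
  have h1 := h.two_mul_lt
  have h2 := (abs_le.1 hy).2
  rw [abs_of_neg (by linarith [h.δ_pos])]
  linarith

lemma measurable_exp (h : DoubleWell v y₁ y₂ α₁ α₂ C c δ) (n p : ℝ) :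
    Measurable fun y => Real.exp (p * y - n * v y) :=
  ((measurable_id.const_mul p).sub (h.measurable.const_mul n)).exp

/-- In `n c (1 + |y - y₁|)` the constant part gives `e^{-nc} ≤ 1 / (n c)`, half of the linear part
pays for `p (y - y₁)`, and the other half leaves an integrable tail. -/
lemma exp_far_le (h : DoubleWell v y₁ y₂ α₁ α₂ C c δ) {n p y : ℝ} (hn : 2 ≤ n * c)
    (hp : |p| ≤ n * c / 2) (h1 : δ ≤ |y - y₁|) (h2 : δ ≤ |y - y₂|) :
    Real.exp (p * y - n * v y) ≤ Real.exp (p * y₁) * (1 / (n * c) * Real.exp (-|y - y₁|)) := by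
  have hf := h.far y h1 h2
  have hn0 : 0 < n := pos_of_mul_pos_left (by linarith : 0 < n * c) h.c_pos.le
  have hu := abs_nonneg (y - y₁)
  have e1 : p * (y - y₁) ≤ n * c / 2 * |y - y₁| := by
    refine (le_abs_self _).trans ?_
    rw [abs_mul]
    gcongr
  have e2 := mul_le_mul_of_nonneg_left hf hn0.le
  have e3 : 1 * |y - y₁| ≤ n * c / 2 * |y - y₁| := by gcongr; linarith
  have e4 : p * y - n * v y ≤ p * y₁ + (-(n * c) + -|y - y₁|) := by
    have : p * y = p * y₁ + p * (y - y₁) := by ring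
    nlinarith
  have e5 : Real.exp (-(n * c)) ≤ 1 / (n * c) := by
    rw [Real.exp_neg, one_div]
    exact inv_anti₀ (by linarith) (by linarith [Real.add_one_le_exp (n * c)])
  calc Real.exp (p * y - n * v y) ≤ Real.exp (p * y₁ + (-(n * c) + -|y - y₁|)) :=
        Real.exp_le_exp.2 e4
    _ = Real.exp (p * y₁) * (Real.exp (-(n * c)) * Real.exp (-|y - y₁|)) := by
      rw [Real.exp_add, Real.exp_add]
    _ ≤ _ := by gcongr

/-- The pointwise error in the Gaussian approximation of the integrand. -/
noncomputable def errorBound (y₁ y₂ α₁ α₂ C c δ n p y : ℝ) : ℝ :=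
  Real.exp (p * y₁) * (wellConst α₁ C δ * (1 + |p|) / Real.sqrt n *
      Real.exp (-(n * α₁ / 8 * (y - y₁) ^ 2)))
    + Real.exp (p * y₂) * (wellConst α₂ C δ * (1 + |p|) / Real.sqrt n *
      Real.exp (-(n * α₂ / 8 * (y - y₂) ^ 2)))
    + Real.exp (p * y₁) * (1 / (n * c) * Real.exp (-|y - y₁|))

/-- Both Gaussians are subtracted at every `y`: within `δ` of one well the other Gaussian is
negligible, and far from both wells all three terms are. -/
lemma abs_exp_sub_le (h : DoubleWell v y₁ y₂ α₁ α₂ C c δ) {n p : ℝ} (hn1 : 1 ≤ n)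
    (hn : 2 ≤ n * c) (hp : |p| ≤ Real.sqrt n) (hp' : |p| ≤ n * c / 2) (y : ℝ) :
    |Real.exp (p * y - n * v y) - (Real.exp (p * y₁) * Real.exp (-(n * α₁ * (y - y₁) ^ 2))
      + Real.exp (p * y₂) * Real.exp (-(n * α₂ * (y - y₂) ^ 2)))| ≤
      errorBound y₁ y₂ α₁ α₂ C c δ n p y := by
  have hsplit : ∀ y₀, Real.exp (p * y - n * v y) =
      Real.exp (p * y₀) * Real.exp (p * (y - y₀) - n * v y) := fun y₀ => by
    rw [← Real.exp_add]; ring_nf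
  have hC := h.C_pos
  have hδ := h.δ_pos
  have hs : 0 < Real.sqrt n := Real.sqrt_pos.2 (by linarith)
  have hc := h.c_pos
  have w1 := wellConst_pos (α := α₁) hC hδ
  have w2 := wellConst_pos (α := α₂) hC hδ
  have t3 : 0 ≤ Real.exp (p * y₁) * (1 / (n * c) * Real.exp (-|y - y₁|)) := by positivity
  have t1 : 0 ≤ Real.exp (p * y₁) * (wellConst α₁ C δ * (1 + |p|) / Real.sqrt n *
      Real.exp (-(n * α₁ / 8 * (y - y₁) ^ 2))) := by positivity
  have t2 : 0 ≤ Real.exp (p * y₂) * (wellConst α₂ C δ * (1 + |p|) / Real.sqrt n *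
      Real.exp (-(n * α₂ / 8 * (y - y₂) ^ 2))) := by positivity
  have g1 : 0 ≤ Real.exp (p * y₁) * Real.exp (-(n * α₁ * (y - y₁) ^ 2)) := by positivity
  have g2 : 0 ≤ Real.exp (p * y₂) * Real.exp (-(n * α₂ * (y - y₂) ^ 2)) := by positivity
  have s1 : δ ≤ |y - y₁| → Real.exp (p * y₁) * Real.exp (-(n * α₁ * (y - y₁) ^ 2)) ≤
      Real.exp (p * y₁) * (wellConst α₁ C δ * (1 + |p|) / Real.sqrt n *
      Real.exp (-(n * α₁ / 8 * (y - y₁) ^ 2))) := fun hu => by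
    gcongr; exact gauss_le_of_le_abs h.α₁_pos hC hδ hn1 hu
  have s2 : δ ≤ |y - y₂| → Real.exp (p * y₂) * Real.exp (-(n * α₂ * (y - y₂) ^ 2)) ≤
      Real.exp (p * y₂) * (wellConst α₂ C δ * (1 + |p|) / Real.sqrt n *
      Real.exp (-(n * α₂ / 8 * (y - y₂) ^ 2))) := fun hu => by
    gcongr; exact gauss_le_of_le_abs h.α₂_pos hC hδ hn1 hu
  rcases le_total |y - y₁| δ with hy1 | hy1
  · have hy2 := h.le_abs_sub₂ hy1
    have m := abs_exp_sub_gauss_le h.α₁_pos hC hδ h.small₁ hn1 hp hy1 (h.near₁ y hy1)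
    have m' := mul_le_mul_of_nonneg_left m (Real.exp_pos (p * y₁)).le
    rw [← abs_of_pos (Real.exp_pos (p * y₁)), ← abs_mul, abs_of_pos (Real.exp_pos (p * y₁)),
      mul_sub, ← hsplit, abs_le] at m'
    have := s2 hy2
    rw [errorBound, abs_le]
    constructor <;> linarith
  · rcases le_total |y - y₂| δ with hy2 | hy2
    · have m := abs_exp_sub_gauss_le h.α₂_pos hC hδ h.small₂ hn1 hp hy2 (h.near₂ y hy2)
      have m' := mul_le_mul_of_nonneg_left m (Real.exp_pos (p * y₂)).le
      rw [← abs_of_pos (Real.exp_pos (p * y₂)), ← abs_mul, abs_of_pos (Real.exp_pos (p * y₂)),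
        mul_sub, ← hsplit, abs_le] at m'
      have := s1 hy1
      rw [errorBound, abs_le]
      constructor <;> linarith
    · have m := h.exp_far_le hn hp' hy1 hy2
      have := s1 hy1
      have := s2 hy2
      have := Real.exp_pos (p * y - n * v y)
      rw [errorBound, abs_le]
      constructor <;> linarith

lemma integrable_errorBound (h : DoubleWell v y₁ y₂ α₁ α₂ C c δ) {n : ℝ} (hn : 0 < n) (p : ℝ) :
    Integrable (errorBound y₁ y₂ α₁ α₂ C c δ n p) := by
  have h1 := h.α₁_pos
  have h2 := h.α₂_pos
  exact ((((integrable_gauss_shift (by positivity) y₁).const_mul _).const_mul _).add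
    (((integrable_gauss_shift (by positivity) y₂).const_mul _).const_mul _)).add
    (((integrable_exp_neg_abs.comp_sub_right y₁).const_mul _).const_mul _)

lemma integral_errorBound (h : DoubleWell v y₁ y₂ α₁ α₂ C c δ) {n : ℝ} (hn : 0 < n) (p : ℝ) :
    ∫ y, errorBound y₁ y₂ α₁ α₂ C c δ n p y =
      Real.exp (p * y₁) * (wellConst α₁ C δ * (1 + |p|) / Real.sqrt n *
        Real.sqrt (Real.pi / (n * α₁ / 8)))
      + Real.exp (p * y₂) * (wellConst α₂ C δ * (1 + |p|) / Real.sqrt n *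
        Real.sqrt (Real.pi / (n * α₂ / 8)))
      + Real.exp (p * y₁) * (1 / (n * c) * ∫ u : ℝ, Real.exp (-|u|)) := by
  have h1 := h.α₁_pos
  have h2 := h.α₂_pos
  have i1 : Integrable fun y => Real.exp (p * y₁) * (wellConst α₁ C δ * (1 + |p|) / Real.sqrt n *
      Real.exp (-(n * α₁ / 8 * (y - y₁) ^ 2))) :=
    ((integrable_gauss_shift (by positivity) y₁).const_mul _).const_mul _
  have i2 : Integrable fun y => Real.exp (p * y₂) * (wellConst α₂ C δ * (1 + |p|) / Real.sqrt n *
      Real.exp (-(n * α₂ / 8 * (y - y₂) ^ 2))) :=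
    ((integrable_gauss_shift (by positivity) y₂).const_mul _).const_mul _
  have i3 : Integrable fun y => Real.exp (p * y₁) * (1 / (n * c) * Real.exp (-|y - y₁|)) :=
    ((integrable_exp_neg_abs.comp_sub_right y₁).const_mul _).const_mul _
  simp only [errorBound]
  rw [integral_add_three i1 i2 i3]
  simp only [integral_const_mul]
  rw [integral_gauss_shift, integral_gauss_shift,
    integral_sub_right_eq_self (fun y : ℝ => Real.exp (-|y|)) y₁]

/-- Laplace asymptotics of the exponential moments, uniformly for `|p| ≤ √n`. -/
theorem exists_expMoment_asymp (h : DoubleWell v y₁ y₂ α₁ α₂ C c δ) :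
    ∃ K > 0, ∃ n₀ ≥ 1, ∀ n ≥ n₀, ∀ p, |p| ≤ Real.sqrt n →
      (Integrable fun y => Real.exp (p * y - n * v y)) ∧
      |expMoment v n p - (Real.exp (p * y₁) * Real.sqrt (Real.pi / (n * α₁))
        + Real.exp (p * y₂) * Real.sqrt (Real.pi / (n * α₂)))| ≤
        K * (1 + |p|) / n * (Real.exp (p * y₁) + Real.exp (p * y₂)) := by
  have hc := h.c_pos
  have ha1 := h.α₁_pos
  have ha2 := h.α₂_pos
  have w1 := wellConst_pos (α := α₁) h.C_pos h.δ_pos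
  have w2 := wellConst_pos (α := α₂) h.C_pos h.δ_pos
  set I := ∫ u : ℝ, Real.exp (-|u|) with hI
  have hI0 : 0 ≤ I := integral_nonneg fun u => (Real.exp_pos _).le
  -- The three summands are the integrals of the three error terms. The threshold on `n` gives `n c
  -- ≥ 2` and `√n ≥ 2 / c`, hence `|p| ≤ √n ≤ n c / 2`.
  refine ⟨wellConst α₁ C δ * Real.sqrt (Real.pi / (α₁ / 8)) +
    wellConst α₂ C δ * Real.sqrt (Real.pi / (α₂ / 8)) + 1 / c * I, by positivity,
    max 1 (max (2 / c) ((2 / c) ^ 2)), le_max_left _ _, fun n hn p hp => ?_⟩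
  have hn1 : 1 ≤ n := (le_max_left _ _).trans hn
  have hn0 : 0 < n := by linarith
  have hnc : 2 ≤ n * c := by
    rw [← div_le_iff₀ hc]
    exact ((le_max_left _ _).trans (le_max_right _ _)).trans hn
  have hs : 0 < Real.sqrt n := Real.sqrt_pos.2 hn0
  have hss : Real.sqrt n * Real.sqrt n = n := Real.mul_self_sqrt hn0.le
  have hp' : |p| ≤ n * c / 2 := by
    refine hp.trans ?_
    have h1 : 2 / c ≤ Real.sqrt n :=
      Real.le_sqrt_of_sq_le (((le_max_right _ _).trans (le_max_right _ _)).trans hn)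
    rw [div_le_iff₀ hc] at h1
    nlinarith
  have hb := h.abs_exp_sub_le hn1 hnc hp hp'
  have iG1 : Integrable fun y => Real.exp (p * y₁) * Real.exp (-(n * α₁ * (y - y₁) ^ 2)) :=
    (integrable_gauss_shift (by positivity) y₁).const_mul _
  have iG2 : Integrable fun y => Real.exp (p * y₂) * Real.exp (-(n * α₂ * (y - y₂) ^ 2)) :=
    (integrable_gauss_shift (by positivity) y₂).const_mul _
  have iD : Integrable fun y => Real.exp (p * y - n * v y) -
      (Real.exp (p * y₁) * Real.exp (-(n * α₁ * (y - y₁) ^ 2))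
      + Real.exp (p * y₂) * Real.exp (-(n * α₂ * (y - y₂) ^ 2))) := by
    refine Integrable.mono' (h.integrable_errorBound hn0 p) ?_ (Eventually.of_forall hb)
    exact (h.measurable_exp n p).aestronglyMeasurable.sub (iG1.add iG2).aestronglyMeasurable
  have iE : Integrable fun y => Real.exp (p * y - n * v y) := by
    refine (iD.add (iG1.add iG2)).congr (Eventually.of_forall fun y => ?_)
    simp
  refine ⟨iE, ?_⟩
  have e1 : expMoment v n p - (Real.exp (p * y₁) * Real.sqrt (Real.pi / (n * α₁))
        + Real.exp (p * y₂) * Real.sqrt (Real.pi / (n * α₂))) =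
      ∫ y, (Real.exp (p * y - n * v y) -
      (Real.exp (p * y₁) * Real.exp (-(n * α₁ * (y - y₁) ^ 2))
      + Real.exp (p * y₂) * Real.exp (-(n * α₂ * (y - y₂) ^ 2)))) := by
    rw [integral_sub_add iE iG1 iG2, integral_const_mul,
      integral_const_mul, integral_gauss_shift, integral_gauss_shift, expMoment]
  rw [e1, ← Real.norm_eq_abs]
  refine (norm_integral_le_of_norm_le (h.integrable_errorBound hn0 p)
    (Eventually.of_forall fun y => (Real.norm_eq_abs _).trans_le (hb y))).trans ?_
  rw [h.integral_errorBound hn0]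
  have sq : ∀ α : ℝ, Real.sqrt (Real.pi / (n * α / 8)) =
      Real.sqrt (Real.pi / (α / 8)) / Real.sqrt n := fun α => by
    rw [mul_div_assoc, mul_comm n, ← div_div, Real.sqrt_div' _ hn0.le]
  rw [sq, sq]
  set s₁ := Real.sqrt (Real.pi / (α₁ / 8))
  set s₂ := Real.sqrt (Real.pi / (α₂ / 8))
  have hP : 1 ≤ 1 + |p| := by linarith [abs_nonneg p]
  have t1 : Real.exp (p * y₁) * (wellConst α₁ C δ * (1 + |p|) / Real.sqrt n * (s₁ / Real.sqrt n)) =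
      (wellConst α₁ C δ * s₁) * ((1 + |p|) / n) * Real.exp (p * y₁) := by
    rw [div_mul_div_comm, hss]; ring
  have t2 : Real.exp (p * y₂) * (wellConst α₂ C δ * (1 + |p|) / Real.sqrt n * (s₂ / Real.sqrt n)) =
      (wellConst α₂ C δ * s₂) * ((1 + |p|) / n) * Real.exp (p * y₂) := by
    rw [div_mul_div_comm, hss]; ring
  have t3 : Real.exp (p * y₁) * (1 / (n * c) * I) ≤
      (1 / c * I) * ((1 + |p|) / n) * Real.exp (p * y₁) := by
    have : 1 / n ≤ (1 + |p|) / n := by gcongr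
    calc Real.exp (p * y₁) * (1 / (n * c) * I) = (1 / c * I) * (1 / n) * Real.exp (p * y₁) := by
          field_simp
      _ ≤ _ := by gcongr
  rw [t1, t2, mul_div_assoc]
  set P := (1 + |p|) / n
  have hP0 : 0 ≤ P := by positivity
  have x1 := Real.exp_pos (p * y₁)
  have x2 := Real.exp_pos (p * y₂)
  have q1 : 0 ≤ wellConst α₁ C δ * s₁ * P * Real.exp (p * y₂) := by positivity
  have q2 : 0 ≤ wellConst α₂ C δ * s₂ * P * Real.exp (p * y₁) := by positivity
  have q3 : 0 ≤ 1 / c * I * P * Real.exp (p * y₂) := by positivity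
  nlinarith

/-- Upper bound for the moments with large negative exponent. -/
theorem exists_expMoment_le (h : DoubleWell v y₁ y₂ α₁ α₂ C c δ) :
    ∃ K > 0, ∃ n₀ ≥ 1, ∀ n ≥ n₀, ∀ p ≤ 0, -(n * c / 2) ≤ p →
      (Integrable fun y => Real.exp (p * y - n * v y)) ∧
      expMoment v n p ≤ K * Real.exp (p * y₁ + K * p ^ 2 / n) := by
  have hc := h.c_pos
  have ha1 := h.α₁_pos
  have ha2 := h.α₂_pos
  set I := ∫ u : ℝ, Real.exp (-|u|) with hI
  have hI0 : 0 ≤ I := integral_nonneg fun u => (Real.exp_pos _).le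
  set g₁ := Real.sqrt (Real.pi / (α₁ / 4)) with hg₁
  set g₂ := Real.sqrt (Real.pi / (α₂ / 4)) with hg₂
  set K₀ := 1 / α₁ + 1 / α₂ with hK₀
  have hK₀p : 0 < K₀ := by positivity
  refine ⟨K₀ + (g₁ + g₂ + I), by positivity, max 1 (2 / c), le_max_left _ _,
    fun n hn p hp hp' => ?_⟩
  have hn1 : 1 ≤ n := (le_max_left _ _).trans hn
  have hn0 : 0 < n := by linarith
  have hnc : 2 ≤ n * c := by
    rw [← div_le_iff₀ hc]
    exact (le_max_right _ _).trans hn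
  have habs : |p| ≤ n * c / 2 := by rw [abs_of_nonpos hp]; linarith
  set A := Real.exp (p * y₁ + K₀ * p ^ 2 / n) with hA
  have hA0 : 0 < A := Real.exp_pos _
  set D : ℝ → ℝ := fun y => A * (Real.exp (-(α₁ / 4 * (y - y₁) ^ 2)) +
    Real.exp (-(α₂ / 4 * (y - y₂) ^ 2)) + Real.exp (-|y - y₁|)) with hD
  have i1 := integrable_gauss_shift (by positivity : 0 < α₁ / 4) y₁
  have i2 := integrable_gauss_shift (by positivity : 0 < α₂ / 4) y₂
  have i3 := integrable_exp_neg_abs.comp_sub_right y₁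
  have iD : Integrable D := ((i1.add i2).add i3).const_mul A
  -- Since `p ≤ 0` and `y₁ < y₂`, the second well contributes at most on the scale `exp (p y₁)` too.
  -- The linear term costs `p² / (n α)`, which is recorded in `A`.
  have hnear : ∀ α y₀ y, 0 < α → 1 / α ≤ K₀ → C * δ ≤ α / 2 → p * y₀ ≤ p * y₁ → |y - y₀| ≤ δ →
      |v y - α * (y - y₀) ^ 2| ≤ C * |y - y₀| ^ 3 →
      Real.exp (p * y - n * v y) ≤ A * Real.exp (-(α / 4 * (y - y₀) ^ 2)) := by
    intro α y₀ y hα hαK hsm hy₀ hu hV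
    rw [hA, ← Real.exp_add, Real.exp_le_exp]
    have e1 := abs_mul_abs_le (p := p) (u := y - y₀) hn0 hα
    have e2 := sq_mul_le_well h.C_pos hsm hu hV
    have e3 : p * (y - y₀) ≤ |p| * |y - y₀| := by rw [← abs_mul]; exact le_abs_self _
    have e4 : p ^ 2 / (n * α) ≤ K₀ * p ^ 2 / n := by
      calc p ^ 2 / (n * α) = 1 / α * p ^ 2 / n := by field_simp
        _ ≤ _ := by gcongr
    have e5 : n * (α / 2 * (y - y₀) ^ 2) ≤ n * v y := by gcongr
    have e6 : 1 * (α / 4 * (y - y₀) ^ 2) ≤ n * (α / 4 * (y - y₀) ^ 2) := by gcongr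
    nlinarith
  have hb : ∀ y, Real.exp (p * y - n * v y) ≤ D y := by
    intro y
    have x1 := mul_pos hA0 (Real.exp_pos (-(α₁ / 4 * (y - y₁) ^ 2)))
    have x2 := mul_pos hA0 (Real.exp_pos (-(α₂ / 4 * (y - y₂) ^ 2)))
    have x3 := mul_pos hA0 (Real.exp_pos (-|y - y₁|))
    simp only [hD, mul_add]
    rcases le_total |y - y₁| δ with hy1 | hy1
    · have := hnear α₁ y₁ y ha1 (by rw [hK₀]; linarith [one_div_pos.2 ha2]) h.small₁ le_rfl hy1
        (h.near₁ y hy1)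
      linarith
    · rcases le_total |y - y₂| δ with hy2 | hy2
      · have := hnear α₂ y₂ y ha2 (by rw [hK₀]; linarith [one_div_pos.2 ha1]) h.small₂
          (mul_le_mul_of_nonpos_left h.lt.le hp) hy2 (h.near₂ y hy2)
        linarith
      · have h1 := h.exp_far_le hnc habs hy1 hy2
        have h2 : Real.exp (p * y₁) * (1 / (n * c) * Real.exp (-|y - y₁|)) ≤
            A * (1 * Real.exp (-|y - y₁|)) := by
          gcongr
          · rw [hA, Real.exp_le_exp]
            have : 0 ≤ K₀ * p ^ 2 / n := by positivity
            linarith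
          · rw [div_le_one (by linarith)]; linarith
        linarith
  have iE : Integrable fun y => Real.exp (p * y - n * v y) := by
    refine Integrable.mono' iD (h.measurable_exp n p).aestronglyMeasurable
      (Eventually.of_forall fun y => ?_)
    rw [Real.norm_of_nonneg (Real.exp_pos _).le]
    exact hb y
  refine ⟨iE, ?_⟩
  have e1 : expMoment v n p ≤ A * (g₁ + g₂ + I) := by
    refine (integral_mono iE iD hb).trans (le_of_eq ?_)
    simp only [hD]
    rw [integral_const_mul, integral_add_three i1 i2 i3, integral_gauss_shift,
      integral_gauss_shift, integral_sub_right_eq_self (fun y : ℝ => Real.exp (-|y|)) y₁]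
  refine e1.trans ?_
  rw [mul_comm]
  have hG : 0 ≤ g₁ + g₂ + I := by positivity
  refine mul_le_mul (by linarith) (Real.exp_le_exp.2 ?_) hA0.le (by linarith)
  gcongr
  linarith

/-- Lower bound for the moments with negative exponent, from the left side of the first well. -/
theorem exists_le_expMoment_left (h : DoubleWell v y₁ y₂ α₁ α₂ C c δ) {M : ℝ} (hM : 0 ≤ M) :
    ∃ κ > 0, ∃ n₀ ≥ 1, ∀ n ≥ n₀, ∀ p ≤ 0,
      (Integrable fun y => Real.exp (p * y - n * v y)) →
      κ / Real.sqrt n * Real.exp (p * y₁ - p * M / Real.sqrt n) ≤ expMoment v n p := by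
  have hCp := h.C_pos
  have hδp := h.δ_pos
  have ha := h.α₁_pos
  set E := Real.exp (-((α₁ + C * δ) * (M + 1) ^ 2)) with hE
  refine ⟨E, Real.exp_pos _, max 1 (((M + 1) / δ) ^ 2), le_max_left _ _, fun n hn p hp hint => ?_⟩
  have hn1 : 1 ≤ n := (le_max_left _ _).trans hn
  have hn0 : 0 < n := by linarith
  have hs : 0 < Real.sqrt n := Real.sqrt_pos.2 hn0
  have hss : Real.sqrt n ^ 2 = n := Real.sq_sqrt hn0.le
  have hMδ : (M + 1) / Real.sqrt n ≤ δ := by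
    have : (M + 1) / δ ≤ Real.sqrt n := Real.le_sqrt_of_sq_le ((le_max_right _ _).trans hn)
    rw [div_le_iff₀ hδp] at this
    rw [div_le_iff₀ hs]
    linarith
  -- On this interval of length `1 / √n` the product `n v` is bounded, and lying `M / √n` to the
  -- left of the well gains `exp (-p M / √n)` for `p ≤ 0`.
  set J := Set.Icc (y₁ - (M + 1) / Real.sqrt n) (y₁ - M / Real.sqrt n) with hJ
  have hb : ∀ y ∈ J, E * Real.exp (p * y₁ - p * M / Real.sqrt n) ≤ Real.exp (p * y - n * v y) := by
    rintro y ⟨hy1, hy2⟩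
    have hM0 : 0 ≤ M / Real.sqrt n := by positivity
    have hu : |y - y₁| ≤ (M + 1) / Real.sqrt n := by
      rw [abs_of_nonpos (by linarith)]; linarith
    have hv := well_le hCp (hu.trans hMδ) (h.near₁ y (hu.trans hMδ))
    have hsq : n * (y - y₁) ^ 2 ≤ (M + 1) ^ 2 := by
      rw [← sq_abs (y - y₁)]
      calc n * |y - y₁| ^ 2 ≤ n * ((M + 1) / Real.sqrt n) ^ 2 := by gcongr
        _ = (M + 1) ^ 2 := by rw [div_pow, hss]; field_simp
    rw [hE, ← Real.exp_add, Real.exp_le_exp]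
    have e1 : n * v y ≤ (α₁ + C * δ) * (M + 1) ^ 2 := by
      calc n * v y ≤ n * ((α₁ + C * δ) * (y - y₁) ^ 2) := by gcongr
        _ = (α₁ + C * δ) * (n * (y - y₁) ^ 2) := by ring
        _ ≤ _ := by gcongr
    have e2 : p * (y₁ - M / Real.sqrt n) ≤ p * y := mul_le_mul_of_nonpos_left hy2 hp
    have e3 : p * (y₁ - M / Real.sqrt n) = p * y₁ - p * M / Real.sqrt n := by ring
    linarith
  have hvol : volume.real J = 1 / Real.sqrt n := by
    rw [hJ, Real.volume_real_Icc_of_le (by gcongr; linarith)]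
    ring
  calc E / Real.sqrt n * Real.exp (p * y₁ - p * M / Real.sqrt n)
      = ∫ _ in J, E * Real.exp (p * y₁ - p * M / Real.sqrt n) := by
        rw [setIntegral_const, hvol, smul_eq_mul]; ring
    _ ≤ ∫ y in J, Real.exp (p * y - n * v y) :=
        setIntegral_mono_on (integrableOn_const (by rw [hJ]; simp)) hint.integrableOn
          measurableSet_Icc hb
    _ ≤ expMoment v n p :=
        setIntegral_le_integral hint (Eventually.of_forall fun y => (Real.exp_pos _).le)

/-- Lower bound for the moments with positive exponent, from the right side of the second well. -/
theorem exists_le_expMoment_right (h : DoubleWell v y₁ y₂ α₁ α₂ C c δ) :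
    ∃ κ > 0, ∃ n₀ ≥ 1, ∀ n ≥ n₀, ∀ p ≥ 0,
      (Integrable fun y => Real.exp (p * y - n * v y)) →
      κ / Real.sqrt n * Real.exp (p * y₂) ≤ expMoment v n p := by
  have hCp := h.C_pos
  have hδp := h.δ_pos
  have ha := h.α₂_pos
  set E := Real.exp (-(α₂ + C * δ)) with hE
  refine ⟨E, Real.exp_pos _, max 1 ((1 / δ) ^ 2), le_max_left _ _, fun n hn p hp hint => ?_⟩
  have hn1 : 1 ≤ n := (le_max_left _ _).trans hn
  have hn0 : 0 < n := by linarith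
  have hs : 0 < Real.sqrt n := Real.sqrt_pos.2 hn0
  have hss : Real.sqrt n ^ 2 = n := Real.sq_sqrt hn0.le
  have hMδ : 1 / Real.sqrt n ≤ δ := by
    have : 1 / δ ≤ Real.sqrt n := Real.le_sqrt_of_sq_le ((le_max_right _ _).trans hn)
    rw [div_le_iff₀ hδp] at this
    rw [div_le_iff₀ hs]
    linarith
  set J := Set.Icc y₂ (y₂ + 1 / Real.sqrt n) with hJ
  have hb : ∀ y ∈ J, E * Real.exp (p * y₂) ≤ Real.exp (p * y - n * v y) := by
    rintro y ⟨hy1, hy2⟩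
    have hu : |y - y₂| ≤ 1 / Real.sqrt n := by
      rw [abs_of_nonneg (by linarith)]; linarith
    have hv := well_le hCp (hu.trans hMδ) (h.near₂ y (hu.trans hMδ))
    have hsq : n * (y - y₂) ^ 2 ≤ 1 := by
      rw [← sq_abs (y - y₂)]
      calc n * |y - y₂| ^ 2 ≤ n * (1 / Real.sqrt n) ^ 2 := by gcongr
        _ = 1 := by rw [div_pow, hss]; field_simp
    rw [hE, ← Real.exp_add, Real.exp_le_exp]
    have e1 : n * v y ≤ (α₂ + C * δ) * 1 := by
      calc n * v y ≤ n * ((α₂ + C * δ) * (y - y₂) ^ 2) := by gcongr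
        _ = (α₂ + C * δ) * (n * (y - y₂) ^ 2) := by ring
        _ ≤ _ := by gcongr
    have e2 : p * y₂ ≤ p * y := mul_le_mul_of_nonneg_left hy1 hp
    linarith
  have hvol : volume.real J = 1 / Real.sqrt n := by
    rw [hJ, Real.volume_real_Icc_of_le (by linarith [one_div_pos.2 hs])]
    ring
  calc E / Real.sqrt n * Real.exp (p * y₂)
      = ∫ _ in J, E * Real.exp (p * y₂) := by
        rw [setIntegral_const, hvol, smul_eq_mul]; ring
    _ ≤ ∫ y in J, Real.exp (p * y - n * v y) :=
        setIntegral_mono_on (integrableOn_const (by rw [hJ]; simp)) hint.integrableOn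
          measurableSet_Icc hb
    _ ≤ expMoment v n p :=
        setIntegral_le_integral hint (Eventually.of_forall fun y => (Real.exp_pos _).le)

end DoubleWell

/-! ### The coefficients of the kernel -/

/-- The size of the term of index `j = β + τ` of the correlation kernel. -/
noncomputable def coeff (v : ℝ → ℝ) (n Y τ : ℝ) : ℝ :=
  Real.exp (τ * Y) / expMoment v n (2 * τ + 2)

/-- The limiting profile of the coefficients across the gap. -/
noncomputable def gapWeight (κ d τ : ℝ) : ℝ := 1 / (1 + κ * Real.exp ((2 * τ + 2) * d))

lemma gapWeight_pos {κ : ℝ} (hκ : 0 < κ) (d τ : ℝ) : 0 < gapWeight κ d τ := by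
  unfold gapWeight; positivity

lemma gapWeight_le_one {κ : ℝ} (hκ : 0 < κ) (d τ : ℝ) : gapWeight κ d τ ≤ 1 := by
  unfold gapWeight
  rw [div_le_one (by positivity)]
  have : 0 < κ * Real.exp ((2 * τ + 2) * d) := by positivity
  linarith

lemma gapWeight_le {κ : ℝ} (hκ : 0 < κ) (d τ : ℝ) :
    gapWeight κ d τ ≤ κ⁻¹ * Real.exp (-((2 * τ + 2) * d)) := by
  unfold gapWeight
  rw [Real.exp_neg, ← mul_inv, one_div]
  exact inv_anti₀ (by positivity) (by linarith)

lemma one_sub_gapWeight_le {κ : ℝ} (hκ : 0 < κ) (d τ : ℝ) :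
    1 - gapWeight κ d τ ≤ κ * Real.exp ((2 * τ + 2) * d) := by
  unfold gapWeight
  set E := κ * Real.exp ((2 * τ + 2) * d) with hE
  have hE0 : 0 < E := by positivity
  rw [one_sub_div (by positivity), div_le_iff₀ (by positivity)]
  nlinarith

lemma abs_exp_sub_one_le_two_mul {x : ℝ} (hx : |x| ≤ 1) : |Real.exp x - 1| ≤ 2 * |x| := by
  simpa using Real.abs_exp_sub_one_le hx

/-- Perturbation of a quotient. -/
lemma abs_div_sub_div_le {N N₀ J J₀ ε₁ ε₂ : ℝ} (hN₀ : 0 < N₀) (hJ₀ : 0 < J₀) (hε₂ : ε₂ ≤ 1 / 2)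
    (hN : |N - N₀| ≤ ε₁ * N₀) (hJ : |J - J₀| ≤ ε₂ * J₀) :
    |N / J - N₀ / J₀| ≤ (2 * ε₁ + 2 * ε₂) * (N₀ / J₀) := by
  have hJ2 : J₀ / 2 ≤ J := by
    have := (abs_le.1 hJ).1
    nlinarith
  have hJp : 0 < J := by linarith
  have e : N / J - N₀ / J₀ = ((N - N₀) * J₀ - N₀ * (J - J₀)) / (J * J₀) := by
    field_simp; ring
  rw [e, abs_div, abs_of_pos (by positivity : 0 < J * J₀), div_le_iff₀ (by positivity)]
  have h1 : |(N - N₀) * J₀ - N₀ * (J - J₀)| ≤ ε₁ * N₀ * J₀ + N₀ * (ε₂ * J₀) := by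
    refine (abs_sub _ _).trans ?_
    rw [abs_mul, abs_mul, abs_of_pos hJ₀, abs_of_pos hN₀]
    gcongr
  have hε : 0 ≤ ε₁ + ε₂ := by
    have h2 : 0 ≤ ε₁ * N₀ := (abs_nonneg _).trans hN
    have h3 : 0 ≤ ε₂ * J₀ := (abs_nonneg _).trans hJ
    exact add_nonneg (nonneg_of_mul_nonneg_left h2 hN₀) (nonneg_of_mul_nonneg_left h3 hJ₀)
  refine h1.trans ?_
  have e2 : (2 * ε₁ + 2 * ε₂) * (N₀ / J₀) * (J * J₀) = (ε₁ + ε₂) * N₀ * (2 * J) := by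
    field_simp
  rw [e2]
  have : (ε₁ + ε₂) * N₀ * J₀ ≤ (ε₁ + ε₂) * N₀ * (2 * J) := by
    gcongr
    linarith
  linarith

lemma expMoment_nonneg (v : ℝ → ℝ) (n p : ℝ) : 0 ≤ expMoment v n p :=
  integral_nonneg fun _ => (Real.exp_pos _).le

lemma coeff_nonneg (v : ℝ → ℝ) (n Y τ : ℝ) : 0 ≤ coeff v n Y τ :=
  div_nonneg (Real.exp_pos _).le (expMoment_nonneg v n _)

/-! ### Size of the coefficients near and away from the critical index -/

namespace DoubleWell

variable {v : ℝ → ℝ} {y₁ y₂ α₁ α₂ C c δ : ℝ}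

/-- Asymptotics of the coefficients near the critical index. -/
theorem exists_coeff_asymp (h : DoubleWell v y₁ y₂ α₁ α₂ C c δ) {M : ℝ} (hM : 0 ≤ M) :
    ∃ K > 0, ∃ n₀ ≥ 1, ∀ n ≥ n₀, ∀ Y, |Y - 2 * y₁| ≤ M / Real.sqrt n → ∀ τ,
      K * (1 + |τ|) ≤ Real.sqrt n →
      |coeff v n Y τ - Real.sqrt n * (Real.exp (-(2 * y₁)) * Real.sqrt (α₁ / Real.pi) *
        gapWeight (Real.sqrt (α₁ / α₂)) (y₂ - y₁) τ)| ≤ K * (1 + |τ|) := by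
  obtain ⟨K₁, hK₁, n₀, hn₀, hasy⟩ := h.exists_expMoment_asymp
  have hα₁ := h.α₁_pos
  have hα₂ := h.α₂_pos
  have hπ := Real.pi_pos
  set a₁ := Real.sqrt (α₁ / Real.pi) with ha₁
  set a₂ := Real.sqrt (α₂ / Real.pi) with ha₂
  have ha₁p : 0 < a₁ := Real.sqrt_pos.2 (by positivity)
  have ha₂p : 0 < a₂ := Real.sqrt_pos.2 (by positivity)
  have hκ : Real.sqrt (α₁ / α₂) = a₁ / a₂ := by
    rw [ha₁, ha₂, ← Real.sqrt_div' _ (by positivity)]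
    congr 1
    field_simp
  set A := Real.exp (-(2 * y₁)) * a₁ with hA
  have hAp : 0 < A := by positivity
  -- The first group makes `K (1 + |τ|) ≤ √n` imply `|p| ≤ √n`, `ε₂ ≤ 1/2` and `M T / √n ≤ 1`; the
  -- second is the error constant itself.
  set K := (2 + 6 * K₁ * (a₁ + a₂) + M) + (4 * M + 6 * K₁ * (a₁ + a₂)) * A with hK
  have hKp : 0 < K := by positivity
  refine ⟨K, hKp, n₀, hn₀, fun n hn Y hY τ hτ => ?_⟩
  have hn0 : 0 < n := by linarith
  set s := Real.sqrt n with hs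
  have hsp : 0 < s := Real.sqrt_pos.2 hn0
  have hss : s * s = n := Real.mul_self_sqrt hn0.le
  set T := 1 + |τ| with hT
  have hT1 : 1 ≤ T := by rw [hT]; linarith [abs_nonneg τ]
  have hτT : |τ| ≤ T := by rw [hT]; linarith
  have hK0 : (2 + 6 * K₁ * (a₁ + a₂) + M) * T ≤ s := by
    refine le_trans ?_ hτ
    gcongr
    rw [hK]
    have : 0 ≤ (4 * M + 6 * K₁ * (a₁ + a₂)) * A := by positivity
    linarith
  have hpos2 : 0 ≤ 6 * K₁ * (a₁ + a₂) * T := by positivity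
  have hpos3 : 0 ≤ M * T := by positivity
  set p := 2 * τ + 2 with hp
  have hpT : |p| ≤ 2 * T := by
    rw [hp, hT]
    refine (abs_add_le _ _).trans ?_
    rw [abs_mul]
    norm_num
    linarith
  obtain ⟨-, hJ⟩ := hasy n hn p (by linarith)
  have hsq : ∀ α > 0, Real.sqrt (Real.pi / (n * α)) = 1 / (s * Real.sqrt (α / Real.pi)) := by
    intro α hα
    rw [hs, ← Real.sqrt_mul hn0.le, one_div, ← Real.sqrt_inv]
    congr 1
    field_simp
  rw [hsq α₁ hα₁, hsq α₂ hα₂, ← ha₁, ← ha₂] at hJ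
  set e₁ := Real.exp (p * y₁) with he₁
  set e₂ := Real.exp (p * y₂) with he₂
  have he₁p : 0 < e₁ := Real.exp_pos _
  have he₂p : 0 < e₂ := Real.exp_pos _
  set J₀ := e₁ * (1 / (s * a₁)) + e₂ * (1 / (s * a₂)) with hJ₀
  have hJ₀p : 0 < J₀ := by positivity
  have hee : e₁ + e₂ ≤ s * (a₁ + a₂) * J₀ := by
    have : s * (a₁ + a₂) * J₀ = (e₁ + e₂) + (a₂ / a₁ * e₁ + a₁ / a₂ * e₂) := by
      rw [hJ₀]; field_simp; ring
    have : 0 < a₂ / a₁ * e₁ + a₁ / a₂ * e₂ := by positivity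
    linarith
  set ε₂ := 3 * K₁ * (a₁ + a₂) * T / s with hε₂
  have hJ' : |expMoment v n p - J₀| ≤ ε₂ * J₀ := by
    refine hJ.trans ?_
    calc K₁ * (1 + |p|) / n * (e₁ + e₂) ≤ K₁ * (3 * T) / n * (s * (a₁ + a₂) * J₀) := by
          gcongr; linarith
      _ = _ := by rw [hε₂, ← hss]; field_simp
  have hε₂h : ε₂ ≤ 1 / 2 := by
    rw [hε₂, div_le_iff₀ hsp]
    linarith
  set N₀ := Real.exp (2 * τ * y₁) with hN₀
  have hN₀p : 0 < N₀ := Real.exp_pos _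
  set ε₁ := 2 * (M * T / s) with hε₁
  have hx : |τ * (Y - 2 * y₁)| ≤ M * T / s := by
    rw [abs_mul]
    calc |τ| * |Y - 2 * y₁| ≤ T * (M / s) := by gcongr
      _ = _ := by ring
  have hx1 : M * T / s ≤ 1 := by
    rw [div_le_one hsp]
    linarith
  have hN : |Real.exp (τ * Y) - N₀| ≤ ε₁ * N₀ := by
    have e : Real.exp (τ * Y) - N₀ = (Real.exp (τ * (Y - 2 * y₁)) - 1) * N₀ := by
      rw [sub_mul, hN₀, ← Real.exp_add]; ring_nf
    rw [e, abs_mul, abs_of_pos hN₀p]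
    gcongr
    refine (abs_exp_sub_one_le_two_mul (hx.trans hx1)).trans ?_
    rw [hε₁]
    gcongr
  have hq := abs_div_sub_div_le hN₀p hJ₀p hε₂h hN hJ'
  -- The contributions of the two wells have ratio `(a₁ / a₂) exp ((2τ + 2)(y₂ - y₁))`, so dividing
  -- by the first leaves exactly the Szegő weight.
  have hmain : N₀ / J₀ = s * (A * gapWeight (a₁ / a₂) (y₂ - y₁) τ) := by
    have x1 : e₁ = N₀ * Real.exp (2 * y₁) := by
      rw [he₁, hN₀, ← Real.exp_add, hp]; ring_nf
    have x2 : e₂ = e₁ * Real.exp ((2 * τ + 2) * (y₂ - y₁)) := by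
      rw [he₁, he₂, ← Real.exp_add, hp]; ring_nf
    rw [gapWeight, hJ₀, x2, x1, hA, Real.exp_neg]
    field_simp
  rw [hκ]
  rw [hmain] at hq
  rw [coeff, ← hp]
  refine hq.trans ?_
  have hg1 := gapWeight_le_one (by positivity : 0 < a₁ / a₂) (y₂ - y₁) τ
  have hg0 := gapWeight_pos (by positivity : 0 < a₁ / a₂) (y₂ - y₁) τ
  have hε0 : 0 ≤ 2 * ε₁ + 2 * ε₂ := by rw [hε₁, hε₂]; positivity
  calc (2 * ε₁ + 2 * ε₂) * (s * (A * gapWeight (a₁ / a₂) (y₂ - y₁) τ))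
      ≤ (2 * ε₁ + 2 * ε₂) * (s * (A * 1)) := by gcongr
    _ = (4 * M + 6 * K₁ * (a₁ + a₂)) * A * T := by rw [hε₁, hε₂]; field_simp; ring
    _ ≤ K * T := by
      gcongr
      rw [hK]
      have : 0 ≤ 2 + 6 * K₁ * (a₁ + a₂) + M := by positivity
      linarith

/-- Exponential decay of the coefficients to the left, on the scale `√n`. -/
theorem exists_coeff_le_left (h : DoubleWell v y₁ y₂ α₁ α₂ C c δ) {M : ℝ} (hM : 0 ≤ M) :
    ∃ K > 0, ∃ n₀ ≥ 1, ∀ n ≥ n₀, ∀ Y, |Y - 2 * y₁| ≤ M / Real.sqrt n → ∀ τ ≤ -1,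
      coeff v n Y τ ≤ K * Real.sqrt n * Real.exp (τ / Real.sqrt n) := by
  -- As `p = 2τ + 2`, a shift by `(M + 1) / 2` gains about `exp ((M + 1)|τ| / √n)`. The part with
  -- `M` offsets the displacement of `Y`, and the rest is the claimed decay.
  obtain ⟨κ, hκ, n₀, hn₀, hlow⟩ := h.exists_le_expMoment_left (M := (M + 1) / 2) (by positivity)
  refine ⟨1 / κ * Real.exp (-(2 * y₁) + (M + 1)), by positivity, n₀, hn₀, fun n hn Y hY τ hτ => ?_⟩
  have hn1 : 1 ≤ n := hn₀.trans hn
  have hn0 : 0 < n := by linarith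
  set s := Real.sqrt n with hs
  have hsp : 0 < s := Real.sqrt_pos.2 hn0
  have hs1 : 1 ≤ s := Real.one_le_sqrt.2 hn1
  by_cases hint : Integrable fun y => Real.exp ((2 * τ + 2) * y - n * v y)
  · have h1 := hlow n hn (2 * τ + 2) (by linarith) hint
    set E := Real.exp ((2 * τ + 2) * y₁ - (2 * τ + 2) * ((M + 1) / 2) / s) with hE
    have hE0 : 0 < E := Real.exp_pos _
    have h2 : coeff v n Y τ ≤ Real.exp (τ * Y) / (κ / s * E) := by
      unfold coeff
      gcongr
    refine h2.trans ?_
    rw [div_le_iff₀ (by positivity)]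
    have e1 : 1 / κ * Real.exp (-(2 * y₁) + (M + 1)) * s * Real.exp (τ / s) * (κ / s * E) =
        Real.exp (-(2 * y₁) + (M + 1) + τ / s +
          ((2 * τ + 2) * y₁ - (2 * τ + 2) * ((M + 1) / 2) / s)) := by
      rw [Real.exp_add (-(2 * y₁) + (M + 1) + τ / s), Real.exp_add (-(2 * y₁) + (M + 1)), ← hE]
      field_simp
    rw [e1, Real.exp_le_exp]
    have e2 : τ * (Y - 2 * y₁) ≤ -τ * (M / s) := by
      refine (le_abs_self _).trans ?_
      rw [abs_mul, abs_of_nonpos (by linarith : τ ≤ 0)]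
      exact mul_le_mul_of_nonneg_left hY (by linarith)
    have e3 : (M + 1) / s ≤ M + 1 := div_le_self (by positivity) hs1
    have e4 : (2 * τ + 2) * ((M + 1) / 2) / s = τ * (M / s) + τ / s + (M + 1) / s := by
      field_simp
    rw [e4]
    linarith
  -- A divergent moment is `0` by convention, so the coefficient is `0`, as the kernel requires.
  · rw [coeff, expMoment, integral_undef hint, div_zero]
    positivity

/-- Exponential decay of the coefficients to the right. -/
theorem exists_coeff_le_right (h : DoubleWell v y₁ y₂ α₁ α₂ C c δ) (M : ℝ) :
    ∃ K > 0, ∃ n₀ ≥ 1, ∀ n ≥ n₀, ∀ Y, |Y - 2 * y₁| ≤ M / Real.sqrt n → ∀ τ ≥ 0,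
      coeff v n Y τ ≤ K * Real.sqrt n * Real.exp (-((y₂ - y₁) * τ)) := by
  obtain ⟨κ, hκ, n₀, hn₀, hlow⟩ := h.exists_le_expMoment_right
  have hd : 0 < y₂ - y₁ := sub_pos.2 h.lt
  -- The threshold gives `M / √n ≤ y₂ - y₁`: of the decay rate `2 (y₂ - y₁)`, one half pays for the
  -- displacement of `Y`.
  refine ⟨1 / κ * Real.exp (-(2 * y₂)), by positivity, max n₀ ((M / (y₂ - y₁)) ^ 2),
    hn₀.trans (le_max_left _ _), fun n hn Y hY τ hτ => ?_⟩
  have hn1 : 1 ≤ n := hn₀.trans ((le_max_left _ _).trans hn)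
  have hn0 : 0 < n := by linarith
  set s := Real.sqrt n with hs
  have hsp : 0 < s := Real.sqrt_pos.2 hn0
  have hMs : M / s ≤ y₂ - y₁ := by
    have : M / (y₂ - y₁) ≤ s := Real.le_sqrt_of_sq_le ((le_max_right _ _).trans hn)
    rw [div_le_iff₀ hd] at this
    rw [div_le_iff₀ hsp]
    linarith
  by_cases hint : Integrable fun y => Real.exp ((2 * τ + 2) * y - n * v y)
  · have h1 := hlow n ((le_max_left _ _).trans hn) (2 * τ + 2) (by linarith) hint
    set E := Real.exp ((2 * τ + 2) * y₂) with hE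
    have hE0 : 0 < E := Real.exp_pos _
    have h2 : coeff v n Y τ ≤ Real.exp (τ * Y) / (κ / s * E) := by
      unfold coeff
      gcongr
    refine h2.trans ?_
    rw [div_le_iff₀ (by positivity)]
    have e1 : 1 / κ * Real.exp (-(2 * y₂)) * s * Real.exp (-((y₂ - y₁) * τ)) * (κ / s * E) =
        Real.exp (-(2 * y₂) + -((y₂ - y₁) * τ) + (2 * τ + 2) * y₂) := by
      rw [Real.exp_add, Real.exp_add (-(2 * y₂)), ← hE]
      field_simp
    rw [e1, Real.exp_le_exp]
    have e2 : τ * (Y - 2 * y₁) ≤ τ * (y₂ - y₁) := by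
      exact mul_le_mul_of_nonneg_left ((le_abs_self _).trans (hY.trans hMs)) hτ
    linarith
  · rw [coeff, expMoment, integral_undef hint, div_zero]
    positivity

/-- Lower bound for the coefficients of index far to the left. -/
theorem exists_le_coeff (h : DoubleWell v y₁ y₂ α₁ α₂ C c δ) {M : ℝ} (hM : 0 ≤ M) :
    ∃ K > 0, ∃ n₀ ≥ 1, ∀ n ≥ n₀, ∀ Y, |Y - 2 * y₁| ≤ M / Real.sqrt n → ∀ τ ≤ -1,
      K * |τ| ≤ n →
      (Integrable fun y => Real.exp ((2 * τ + 2) * y - n * v y)) ∧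
      1 / K * Real.exp (-(K * (|τ| / Real.sqrt n)) - K * τ ^ 2 / n) ≤ coeff v n Y τ := by
  obtain ⟨K, hK, n₀, hn₀, hup⟩ := h.exists_expMoment_le
  have hc := h.c_pos
  set K' := K * Real.exp (2 * |y₁|) + M + 4 * K + 4 / c with hK'
  have hK'p : 0 < K' := by positivity
  refine ⟨K', hK'p, n₀, hn₀, fun n hn Y hY τ hτ hτn => ?_⟩
  have hn1 : 1 ≤ n := hn₀.trans hn
  have hn0 : 0 < n := by linarith
  set s := Real.sqrt n with hs
  have hsp : 0 < s := Real.sqrt_pos.2 hn0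
  have habs : |τ| = -τ := abs_of_nonpos (by linarith)
  have hp : -(n * c / 2) ≤ 2 * τ + 2 := by
    have h1 : 4 / c * |τ| ≤ n := by
      refine le_trans ?_ hτn
      gcongr
      rw [hK']
      have : 0 ≤ K * Real.exp (2 * |y₁|) + M + 4 * K := by positivity
      linarith
    rw [div_mul_eq_mul_div, div_le_iff₀ hc, habs] at h1
    linarith
  obtain ⟨hint, hle⟩ := hup n hn (2 * τ + 2) (by linarith) hp
  refine ⟨hint, ?_⟩
  have hpos : 0 < expMoment v n (2 * τ + 2) := by
    unfold expMoment
    exact integral_exp_pos hint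
  unfold coeff
  rw [le_div_iff₀ hpos]
  refine (mul_le_mul_of_nonneg_left hle (by positivity)).trans ?_
  have hKK : K ≤ K' * Real.exp (-(2 * |y₁|)) := by
    rw [Real.exp_neg, ← div_eq_mul_inv, le_div_iff₀ (Real.exp_pos _), hK']
    have : 0 ≤ M + 4 * K + 4 / c := by positivity
    linarith
  have hp2 : K * (2 * τ + 2) ^ 2 / n ≤ K' * τ ^ 2 / n := by
    have h1 : (2 * τ + 2) ^ 2 ≤ 4 * τ ^ 2 := by nlinarith
    have h2 : 4 * K ≤ K' := by
      rw [hK']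
      have : 0 ≤ K * Real.exp (2 * |y₁|) + M + 4 / c := by positivity
      linarith
    calc K * (2 * τ + 2) ^ 2 / n ≤ K * (4 * τ ^ 2) / n := by gcongr
      _ = 4 * K * τ ^ 2 / n := by ring
      _ ≤ _ := by gcongr
  have hMK : M ≤ K' := by
    rw [hK']
    have : 0 ≤ K * Real.exp (2 * |y₁|) + 4 * K + 4 / c := by positivity
    linarith
  have e2 : -(τ * (Y - 2 * y₁)) ≤ K' * (|τ| / s) := by
    refine (neg_le_abs _).trans ?_
    rw [abs_mul]
    calc |τ| * |Y - 2 * y₁| ≤ |τ| * (M / s) := by gcongr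
      _ = M * (|τ| / s) := by ring
      _ ≤ _ := by gcongr
  set u := -(K' * (|τ| / s)) - K' * τ ^ 2 / n with hu
  calc 1 / K' * Real.exp u * (K * Real.exp ((2 * τ + 2) * y₁ + K * (2 * τ + 2) ^ 2 / n))
      ≤ 1 / K' * Real.exp u * (K' * Real.exp (-(2 * |y₁|)) *
          Real.exp ((2 * τ + 2) * y₁ + K * (2 * τ + 2) ^ 2 / n)) := by gcongr
    _ = Real.exp (u + -(2 * |y₁|) + ((2 * τ + 2) * y₁ + K * (2 * τ + 2) ^ 2 / n)) := by
      rw [Real.exp_add (u + -(2 * |y₁|)), Real.exp_add u]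
      field_simp
    _ ≤ Real.exp (τ * Y) := by
      rw [Real.exp_le_exp, hu]
      have := le_abs_self y₁
      linarith

end DoubleWell

/-- Log-convexity of the exponential moments. -/
lemma expMoment_sq_le {v : ℝ → ℝ} {n p : ℝ}
    (h0 : Integrable fun y => Real.exp (p * y - n * v y))
    (h1 : Integrable fun y => Real.exp ((p + 2) * y - n * v y))
    (h2 : Integrable fun y => Real.exp ((p + 4) * y - n * v y)) :
    expMoment v n (p + 2) ^ 2 ≤ expMoment v n p * expMoment v n (p + 4) := by
  have hpos : 0 < expMoment v n p := integral_exp_pos h0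
  -- Cauchy–Schwarz by the discriminant: `∫ (e^{2y} - l)² e^{py - nv} ≥ 0` at its minimizing `l`.
  set l := expMoment v n (p + 2) / expMoment v n p with hl
  have key : 0 ≤ ∫ y, (Real.exp ((p + 4) * y - n * v y) -
      (2 * l * Real.exp ((p + 2) * y - n * v y) + -l ^ 2 * Real.exp (p * y - n * v y))) := by
    refine integral_nonneg fun y => ?_
    have e1 : Real.exp ((p + 2) * y - n * v y) =
        Real.exp (2 * y) * Real.exp (p * y - n * v y) := by rw [← Real.exp_add]; ring_nf
    have e2 : Real.exp ((p + 4) * y - n * v y) =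
        Real.exp (2 * y) ^ 2 * Real.exp (p * y - n * v y) := by
      rw [← Real.exp_nat_mul, ← Real.exp_add]; push_cast; ring_nf
    beta_reduce
    rw [e1, e2, Pi.zero_apply]
    have : 0 ≤ (Real.exp (2 * y) - l) ^ 2 * Real.exp (p * y - n * v y) := by positivity
    linarith
  rw [integral_sub_add h2 (h1.const_mul _) (h0.const_mul _), integral_const_mul,
    integral_const_mul] at key
  change 0 ≤ expMoment v n (p + 4) - (2 * l * expMoment v n (p + 2) + -l ^ 2 * expMoment v n p)
    at key
  have e3 : l * expMoment v n p = expMoment v n (p + 2) := by rw [hl]; field_simp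
  have e4 : 0 ≤ (expMoment v n (p + 4) -
    (2 * l * expMoment v n (p + 2) + -l ^ 2 * expMoment v n p)) * expMoment v n p := by positivity
  rw [← e3] at e4 ⊢
  nlinarith

/-- The numerator is log-linear in `τ`, so log-convexity of the moments gives log-concavity of the
coefficients; a unit step in `τ` is a step of `2` in the exponent of the moment. -/
lemma coeff_mul_le {v : ℝ → ℝ} {n Y τ : ℝ}
    (h0 : Integrable fun y => Real.exp ((2 * τ + 2) * y - n * v y))
    (h1 : Integrable fun y => Real.exp ((2 * (τ + 1) + 2) * y - n * v y))
    (h2 : Integrable fun y => Real.exp ((2 * (τ + 2) + 2) * y - n * v y)) :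
    coeff v n Y τ * coeff v n Y (τ + 2) ≤ coeff v n Y (τ + 1) ^ 2 := by
  have e1 : 2 * (τ + 1) + 2 = 2 * τ + 2 + 2 := by ring
  have e2 : 2 * (τ + 2) + 2 = 2 * τ + 2 + 4 := by ring
  have p0 : 0 < expMoment v n (2 * τ + 2) := integral_exp_pos h0
  have p1 : 0 < expMoment v n (2 * (τ + 1) + 2) := integral_exp_pos h1
  have p2 : 0 < expMoment v n (2 * (τ + 2) + 2) := integral_exp_pos h2
  have h3 : expMoment v n (2 * (τ + 1) + 2) ^ 2 ≤
      expMoment v n (2 * τ + 2) * expMoment v n (2 * (τ + 2) + 2) := by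
    rw [e1] at h1 ⊢
    rw [e2] at h2 ⊢
    exact expMoment_sq_le h0 h1 h2
  unfold coeff
  rw [div_mul_div_comm, div_pow, ← Real.exp_add, ← Real.exp_nat_mul]
  have e3 : τ * Y + (τ + 2) * Y = (2 : ℕ) * ((τ + 1) * Y) := by push_cast; ring
  rw [e3]
  gcongr

/-! ### Summation by parts for log-concave sequences -/

lemma sub_one_mul_sum_pow_mul (ω : ℂ) (f : ℕ → ℂ) {p q : ℕ} (hpq : p ≤ q) :
    (ω - 1) * ∑ j ∈ Finset.Ico p q, ω ^ j * f j =
      ω ^ q * f q - ω ^ p * f p - ∑ j ∈ Finset.Ico p q, ω ^ (j + 1) * (f (j + 1) - f j) := by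
  induction q, hpq using Nat.le_induction with
  | base => simp
  | succ q hq ih =>
    rw [Finset.sum_Ico_succ_top hq, Finset.sum_Ico_succ_top hq, mul_add, ih, pow_succ]
    ring

/-- Two summations by parts. The upper boundary term has the size of the main term and is kept
exactly, to be merged with the central sum; everything else is estimated. -/
lemma norm_sum_pow_mul_sub_le {ω : ℂ} (hω : ‖ω‖ = 1) (hω1 : ω ≠ 1) (f : ℕ → ℝ) {p q : ℕ}
    (hpq : p ≤ q) :
    ‖∑ j ∈ Finset.Ico p q, ω ^ j * (f j : ℂ) - ω ^ q * (f q : ℂ) / (ω - 1)‖ ≤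
      |f p| / ‖ω - 1‖ + (|f (q + 1) - f q| + |f (p + 1) - f p|
        + ∑ j ∈ Finset.Ico p q, |f (j + 2) - f (j + 1) - (f (j + 1) - f j)|) / ‖ω - 1‖ ^ 2 := by
  have hD : ω - 1 ≠ 0 := sub_ne_zero.2 hω1
  have hDp : 0 < ‖ω - 1‖ := norm_pos_iff.2 hD
  have h1 := sub_one_mul_sum_pow_mul ω (fun j => (f j : ℂ)) hpq
  have h2 := sub_one_mul_sum_pow_mul ω (fun j => (f (j + 1) : ℂ) - f j) hpq
  set S := ∑ j ∈ Finset.Ico p q, ω ^ j * (f j : ℂ)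
  set T := ∑ j ∈ Finset.Ico p q, ω ^ j * ((f (j + 1) : ℂ) - f j)
  set U := ∑ j ∈ Finset.Ico p q, ω ^ (j + 1) * (((f (j + 1 + 1) : ℂ) - f (j + 1)) - (f (j + 1) - f j))
  have h3 : ∑ j ∈ Finset.Ico p q, ω ^ (j + 1) * ((f (j + 1) : ℂ) - f j) = ω * T := by
    rw [Finset.mul_sum]
    exact Finset.sum_congr rfl fun j _ => by rw [pow_succ]; ring
  rw [h3] at h1
  have e : S - ω ^ q * (f q : ℂ) / (ω - 1) = -(ω ^ p * f p) / (ω - 1)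
      - ω * (ω ^ q * (f (q + 1) - f q) - ω ^ p * (f (p + 1) - f p) - U) / (ω - 1) ^ 2 := by
    field_simp
    linear_combination (ω - 1) * h1 - ω * h2
  have hU : ‖U‖ ≤ ∑ j ∈ Finset.Ico p q, |f (j + 2) - f (j + 1) - (f (j + 1) - f j)| := by
    refine (norm_sum_le _ _).trans (le_of_eq (Finset.sum_congr rfl fun j _ => ?_))
    rw [norm_mul, norm_pow, hω, one_pow, one_mul, ← Real.norm_eq_abs, ← Complex.norm_real]
    push_cast
    rfl
  have n1 : ‖ω ^ q * ((f (q + 1) : ℂ) - f q)‖ = |f (q + 1) - f q| := by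
    rw [norm_mul, norm_pow, hω, one_pow, one_mul, ← Real.norm_eq_abs, ← Complex.norm_real]
    push_cast
    rfl
  have n2 : ‖ω ^ p * ((f (p + 1) : ℂ) - f p)‖ = |f (p + 1) - f p| := by
    rw [norm_mul, norm_pow, hω, one_pow, one_mul, ← Real.norm_eq_abs, ← Complex.norm_real]
    push_cast
    rfl
  rw [e]
  refine (norm_sub_le _ _).trans ?_
  rw [norm_div, norm_neg, norm_mul, norm_pow, hω, one_pow, one_mul, Complex.norm_real,
    Real.norm_eq_abs, norm_div, norm_mul, hω, one_mul, norm_pow]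
  gcongr
  refine (norm_sub_le _ _).trans (add_le_add ((norm_sub_le _ _).trans ?_) hU)
  rw [n1, n2]

lemma ratio_antitone {f : ℕ → ℝ} {p q : ℕ} (hpos : ∀ j, p ≤ j → j ≤ q + 1 → 0 < f j)
    (hlc : ∀ j, p ≤ j → j < q → f j * f (j + 2) ≤ f (j + 1) ^ 2) {i j : ℕ} (hpi : p ≤ i)
    (hij : i ≤ j) (hjq : j ≤ q) : f (j + 1) / f j ≤ f (i + 1) / f i := by
  induction j, hij using Nat.le_induction with
  | base => exact le_rfl
  | succ j hj ih =>
    refine le_trans ?_ (ih (by omega))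
    have h0 := hpos j (by omega) (by omega)
    have h1 := hpos (j + 1) (by omega) (by omega)
    rw [div_le_div_iff₀ h1 h0]
    have := hlc j (by omega) (by omega)
    nlinarith

/-- Ratios decrease, so each of the `i` steps multiplies by at least the last ratio. Read backwards,
a bound on the total growth bounds that ratio. -/
lemma ratio_pow_mul_le {f : ℕ → ℝ} {p q : ℕ} (hpos : ∀ j, p ≤ j → j ≤ q + 1 → 0 < f j)
    (hlc : ∀ j, p ≤ j → j < q → f j * f (j + 2) ≤ f (j + 1) ^ 2) {i : ℕ} (hpi : p + i ≤ q) :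
    (f (q + 1) / f q) ^ i * f p ≤ f (p + i) := by
  induction i with
  | zero => simp
  | succ i ih =>
    have h0 := hpos (p + i) (by omega) (by omega)
    have hq := hpos q (by omega) (by omega)
    have hq1 := hpos (q + 1) (by omega) (by omega)
    have h1 := ratio_antitone hpos hlc (i := p + i) (j := q) (by omega) (by omega) le_rfl
    calc (f (q + 1) / f q) ^ (i + 1) * f p = f (q + 1) / f q * ((f (q + 1) / f q) ^ i * f p) := by
          rw [pow_succ]; ring
      _ ≤ f (p + i + 1) / f (p + i) * f (p + i) := by
        refine mul_le_mul h1 (ih (by omega)) ?_ (div_pos (hpos _ (by omega) (by omega)) h0).le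
        exact mul_nonneg (pow_nonneg (div_pos hq1 hq).le _) (hpos p le_rfl (by omega)).le
      _ = f (p + (i + 1)) := by rw [div_mul_cancel₀ _ h0.ne']; rfl

/-- A log-concave sequence that varies slowly has small second variation. -/
lemma sum_abs_second_diff_le {f : ℕ → ℝ} {p q : ℕ} (hpq : p ≤ q)
    (hpos : ∀ j, p ≤ j → j ≤ q + 1 → 0 < f j)
    (hlc : ∀ j, p ≤ j → j < q → f j * f (j + 2) ≤ f (j + 1) ^ 2) {F ε : ℝ}
    (hF : ∀ j, p ≤ j → j ≤ q + 1 → f j ≤ F) (hp : f (p + 1) / f p ≤ 1 + ε)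
    (hq : 1 - ε ≤ f (q + 1) / f q) :
    (∀ j, p ≤ j → j ≤ q → |f (j + 1) - f j| ≤ ε * F) ∧
    ∑ j ∈ Finset.Ico p q, |f (j + 2) - f (j + 1) - (f (j + 1) - f j)| ≤
      F * (2 * ε) + (q - p : ℕ) * (F * ε ^ 2) := by
  set g : ℕ → ℝ := fun j => f (j + 1) / f j with hg
  have hfg : ∀ j, p ≤ j → j ≤ q → f (j + 1) = g j * f j := fun j h1 h2 => by
    simp only [hg]
    rw [div_mul_cancel₀ _ (hpos j h1 (by omega)).ne']
  have hgε : ∀ j, p ≤ j → j ≤ q → |g j - 1| ≤ ε := by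
    intro j h1 h2
    have a1 := ratio_antitone hpos hlc le_rfl h1 h2
    have a2 := ratio_antitone hpos hlc h1 h2 le_rfl
    rw [abs_le]
    simp only [hg]
    constructor <;> linarith
  have hF0 : 0 < F := (hpos p le_rfl (by omega)).trans_le (hF p le_rfl (by omega))
  have hε : 0 ≤ ε := (abs_nonneg _).trans (hgε p le_rfl hpq)
  refine ⟨fun j h1 h2 => ?_, ?_⟩
  · have : f (j + 1) - f j = (g j - 1) * f j := by rw [hfg j h1 h2]; ring
    rw [this, abs_mul, abs_of_pos (hpos j h1 (by omega))]
    exact mul_le_mul (hgε j h1 h2) (hF j h1 (by omega)) (hpos j h1 (by omega)).le hε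
  · have hterm : ∀ j ∈ Finset.Ico p q, |f (j + 2) - f (j + 1) - (f (j + 1) - f j)| ≤
        F * (g j - g (j + 1)) + F * ε ^ 2 := by
      intro j hj
      obtain ⟨h1, h2⟩ := Finset.mem_Ico.1 hj
      have e1 := hfg j h1 h2.le
      have e2 := hfg (j + 1) (by omega) h2
      have hmono := ratio_antitone hpos hlc h1 (Nat.le_succ j) h2
      -- The first term has a fixed sign because the ratios `g` decrease, and its sum telescopes;
      -- the second is quadratic in `ε`.
      have e3 : f (j + 2) - f (j + 1) - (f (j + 1) - f j) =
          -(f (j + 1) * (g j - g (j + 1))) + f j * (g j - 1) ^ 2 := by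
        rw [show f (j + 2) = g (j + 1) * f (j + 1) from e2, e1]
        ring
      rw [e3]
      have hd : 0 ≤ g j - g (j + 1) := sub_nonneg.2 hmono
      have hf1 := hpos (j + 1) (by omega) (by omega)
      have hf0 := hpos j h1 (by omega)
      refine (abs_add_le _ _).trans ?_
      rw [abs_neg, abs_of_nonneg (by positivity), abs_of_nonneg (by positivity)]
      have h3 : (g j - 1) ^ 2 ≤ ε ^ 2 := by
        rw [← sq_abs]
        gcongr
        exact hgε j h1 h2.le
      gcongr
      · exact hF (j + 1) (by omega) (by omega)
      · exact hF j h1 (by omega)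
    refine (Finset.sum_le_sum hterm).trans ?_
    rw [Finset.sum_add_distrib, ← Finset.mul_sum, Finset.sum_const, Nat.card_Ico, nsmul_eq_mul]
    gcongr
    have htel : ∑ j ∈ Finset.Ico p q, (g j - g (j + 1)) = g p - g q := by
      have := Finset.sum_Ico_sub g hpq
      rw [← neg_inj, ← Finset.sum_neg_distrib]
      simp only [neg_sub]
      exact this
    rw [htel]
    have h1 := (abs_le.1 (hgε p le_rfl hpq)).2
    have h2 := (abs_le.1 (hgε q hpq le_rfl)).1
    linarith

/-! ### Oscillating sums of log-concave sequences -/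

lemma norm_sum_pow_mul_le {ω : ℂ} (hω : ‖ω‖ = 1) (f : ℕ → ℝ) (s : Finset ℕ) :
    ‖∑ j ∈ s, ω ^ j * (f j : ℂ)‖ ≤ ∑ j ∈ s, |f j| := by
  refine (norm_sum_le _ _).trans (le_of_eq (Finset.sum_congr rfl fun j _ => ?_))
  rw [norm_mul, norm_pow, hω, one_pow, one_mul, Complex.norm_real, Real.norm_eq_abs]

lemma exp_half_le_one_add {x : ℝ} (h0 : 0 ≤ x) (h1 : x ≤ 1) : Real.exp (x / 2) ≤ 1 + x := by
  have := (abs_le.1 (abs_exp_sub_one_le_two_mul (x := x / 2) (by rw [abs_le]; constructor <;> linarith))).2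
  rw [abs_of_nonneg (by linarith)] at this
  linarith

/-- An oscillating sum over a window on which the coefficients are log-concave, at most of
order `R`, and vary slowly. The window `[p₀, q]` has two halves; the growth of the sequence on the
left half controls its ratios on the right half. -/
lemma norm_sum_window_le {ω : ℂ} (hω : ‖ω‖ = 1) (hω1 : ω ≠ 1) {f : ℕ → ℝ} {p i q : ℕ}
    {K a b c R ℓ : ℝ} (hK : 0 < K) (ha : 0 < a) (hb : 0 < b) (hc : 0 < c) (hℓ : 1 ≤ ℓ)
    (hR : (a + b / c) * ℓ ≤ R) (hpq : p + i ≤ q) (hi : 2 * R * ℓ ≤ i)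
    (hqi : (q - (p + i) : ℕ) ≤ 3 * R * ℓ)
    (hpos : ∀ j, p ≤ j → j ≤ q + 1 → 0 < f j)
    (hlc : ∀ j, p ≤ j → j < q → f j * f (j + 2) ≤ f (j + 1) ^ 2)
    (hF : ∀ j, p ≤ j → j ≤ q + 1 → f j ≤ K * R) (hp1 : f (p + i) ≤ 1)
    (hp : Real.exp (-(a * ℓ ^ 2)) ≤ f p) (hq : f q - f (q + 1) ≤ b * ℓ) (hcq : c * R ≤ f q) :
    ‖∑ j ∈ Finset.Ico (p + i) q, ω ^ j * (f j : ℂ) - ω ^ q * (f q : ℂ) / (ω - 1)‖ ≤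
      (1 / ‖ω - 1‖ + (4 * K * (a + b / c) + 3 * K * (a + b / c) ^ 2) / ‖ω - 1‖ ^ 2) * ℓ ^ 3 := by
  set e := a + b / c with he
  have he0 : 0 < e := by positivity
  have hR0 : 0 < R := lt_of_lt_of_le (by positivity) hR
  -- In `e = a + b / c`, the part `a` serves the left ratio and `b / c` the right one, where a drop
  -- `b ℓ` is divided by a value at least `c R`.
  set ε := e * ℓ / R with hε
  have hε0 : 0 < ε := by positivity
  have hε1 : ε ≤ 1 := by rw [hε, div_le_one hR0]; exact hR
  have hi0 : i ≠ 0 := by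
    rintro rfl
    have : 0 < 2 * R * ℓ := by positivity
    simp only [Nat.cast_zero] at hi
    linarith
  have hD : 0 < ‖ω - 1‖ := norm_pos_iff.2 (sub_ne_zero.2 hω1)
  have hratio_q : 1 - ε ≤ f (q + 1) / f q := by
    have hq0 := hpos q (by omega) (by omega)
    rw [le_div_iff₀ hq0]
    have h1 : b * ℓ ≤ ε * f q := by
      calc b * ℓ = b / c * ℓ / R * (c * R) := by field_simp
        _ ≤ ε * f q := by
          rw [hε, he]
          gcongr
          linarith
    linarith
  -- Otherwise the sequence would grow over the left half by more than `(1 + ε)^i ≥ exp (a ℓ²)`,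
  -- which carries `f p ≥ exp (-a ℓ²)` above `1 ≥ f (p + i)`.
  have hratio_p : f (p + i + 1) / f (p + i) ≤ 1 + ε := by
    by_contra! hlt
    have h1 := ratio_pow_mul_le (f := f) (p := p) (q := p + i)
      (fun j h1 h2 => hpos j h1 (by omega)) (fun j h1 h2 => hlc j h1 (by omega)) (i := i) le_rfl
    have h2 : Real.exp (a * ℓ ^ 2) < (f (p + i + 1) / f (p + i)) ^ i := by
      calc Real.exp (a * ℓ ^ 2) ≤ Real.exp (i * (ε / 2)) := by
            rw [Real.exp_le_exp]
            calc a * ℓ ^ 2 ≤ e * ℓ ^ 2 := by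
                  gcongr
                  rw [he]
                  linarith [div_pos hb hc]
              _ = 2 * R * ℓ * (ε / 2) := by rw [hε]; field_simp
              _ ≤ _ := by gcongr
        _ = Real.exp (ε / 2) ^ i := by rw [← Real.exp_nat_mul]
        _ ≤ (1 + ε) ^ i := by
          gcongr
          exact exp_half_le_one_add hε0.le hε1
        _ < _ := pow_lt_pow_left₀ hlt (by positivity) hi0
    have h3 : 1 < (f (p + i + 1) / f (p + i)) ^ i * f p := by
      calc (1 : ℝ) = Real.exp (a * ℓ ^ 2) * Real.exp (-(a * ℓ ^ 2)) := by
            rw [← Real.exp_add, add_neg_cancel, Real.exp_zero]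
        _ < _ := mul_lt_mul h2 hp (Real.exp_pos _) ((Real.exp_pos _).trans h2).le
    linarith
  obtain ⟨h1, h2⟩ := sum_abs_second_diff_le hpq (fun j h1 h2 => hpos j (by omega) h2)
    (fun j h1 h2 => hlc j (by omega) h2) (fun j h1 h2 => hF j (by omega) h2) hratio_p hratio_q
  refine (norm_sum_pow_mul_sub_le hω hω1 f hpq).trans ?_
  have hℓ2 : ℓ ≤ ℓ ^ 3 := le_self_pow₀ hℓ (by norm_num)
  have hεR : ε * (K * R) = K * e * ℓ := by rw [hε]; field_simp
  have h3 : |f (q + 1) - f q| + |f (p + i + 1) - f (p + i)|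
        + ∑ j ∈ Finset.Ico (p + i) q, |f (j + 2) - f (j + 1) - (f (j + 1) - f j)| ≤
      (4 * K * e + 3 * K * e ^ 2) * ℓ ^ 3 := by
    have a1 := h1 q hpq le_rfl
    have a2 := h1 (p + i) le_rfl hpq
    have a3 : ((q - (p + i) : ℕ) : ℝ) * (K * R * ε ^ 2) ≤ 3 * K * e ^ 2 * ℓ ^ 3 := by
      calc ((q - (p + i) : ℕ) : ℝ) * (K * R * ε ^ 2) ≤ (3 * R * ℓ) * (K * R * ε ^ 2) := by gcongr
        _ = 3 * K * e ^ 2 * ℓ ^ 3 := by rw [hε]; field_simp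
    have a4 : K * e * ℓ ≤ K * e * ℓ ^ 3 := by gcongr
    rw [hεR] at a1 a2
    have a5 : K * R * (2 * ε) = 2 * (K * e * ℓ) := by rw [← hεR]; ring
    rw [a5] at h2
    calc _ ≤ 4 * (K * e * ℓ) + 3 * K * e ^ 2 * ℓ ^ 3 := by linarith
      _ ≤ 4 * (K * e * ℓ ^ 3) + 3 * K * e ^ 2 * ℓ ^ 3 := by linarith
      _ = _ := by ring
  have h4 : |f (p + i)| ≤ ℓ ^ 3 := by
    rw [abs_of_pos (hpos _ (by omega) (by omega))]
    exact hp1.trans (one_le_pow₀ hℓ)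
  rw [add_mul, div_mul_eq_mul_div, div_mul_eq_mul_div, one_mul]
  gcongr

/-! ### The Szegő series -/

/-- The Abel-summed series `∑_{l ∈ ℤ} ζ ^ l G(l - x)`, for the profile `G = gapWeight κ d`. -/
noncomputable def szegoSeries (κ d x : ℝ) (ζ : ℂ) : ℂ :=
  1 / (ζ - 1) + ∑' l : ℕ, ζ ^ l * (gapWeight κ d (l - x) : ℂ)
    - ∑' l : ℕ, (ζ⁻¹) ^ (l + 1) * ((1 - gapWeight κ d (-((l : ℝ) + 1) - x) : ℝ) : ℂ)

lemma abs_gapWeight_nat_le {κ d x : ℝ} (hκ : 0 < κ) (hd : 0 < d) (hx1 : x ≤ 1) (l : ℕ) :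
    |gapWeight κ d (l - x)| ≤ κ⁻¹ * Real.exp (-(2 * d)) ^ l := by
  rw [abs_of_pos (gapWeight_pos hκ _ _), ← Real.exp_nat_mul]
  refine (gapWeight_le hκ _ _).trans ?_
  gcongr
  nlinarith

lemma abs_one_sub_gapWeight_neg_le {κ d x : ℝ} (hκ : 0 < κ) (hd : 0 < d) (hx0 : 0 ≤ x) (l : ℕ) :
    |1 - gapWeight κ d (-((l : ℝ) + 1) - x)| ≤ κ * Real.exp (-(2 * d)) ^ l := by
  rw [abs_of_nonneg (sub_nonneg.2 (gapWeight_le_one hκ _ _)), ← Real.exp_nat_mul]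
  refine (one_sub_gapWeight_le hκ _ _).trans (mul_le_mul_of_nonneg_left (Real.exp_le_exp.2 ?_) hκ.le)
  have := mul_nonneg hx0 hd.le
  linarith

lemma exp_neg_two_mul_lt_one {d : ℝ} (hd : 0 < d) : Real.exp (-(2 * d)) < 1 :=
  Real.exp_zero ▸ Real.exp_lt_exp.2 (by linarith)

lemma norm_tsum_tail_le {g : ℕ → ℂ} {C r : ℝ} (hr0 : 0 ≤ r) (hr : r < 1)
    (hg : ∀ l, ‖g l‖ ≤ C * r ^ l) (L : ℕ) :
    Summable g ∧ ‖∑' l, g l - ∑ l ∈ Finset.range L, g l‖ ≤ C * r ^ L / (1 - r) := by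
  have hs : Summable fun l => C * r ^ l := (summable_geometric_of_lt_one hr0 hr).mul_left C
  have hsg : Summable g := hs.of_norm_bounded hg
  refine ⟨hsg, ?_⟩
  rw [← hsg.sum_add_tsum_nat_add L, add_sub_cancel_left]
  have h1 : HasSum (fun l => C * r ^ L * r ^ l) (C * r ^ L * (1 - r)⁻¹) :=
    (hasSum_geometric_of_lt_one hr0 hr).mul_left _
  rw [div_eq_mul_inv]
  refine tsum_of_norm_bounded h1 fun l => (hg _).trans (le_of_eq ?_)
  rw [pow_add]; ring

/-- At negative index the weight is `1` minus an exponentially small quantity. The ones sum to `(ω^L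
- 1) / (ω - 1)`: here `ω^L / (ω - 1)` is the Abel term, and `-1 / (ω - 1)` is cancelled by the
boundary term up to an exponentially small error. What remains are tails of geometrically bounded
series. -/
lemma norm_sum_sub_szegoSeries_le {κ d x : ℝ} (hκ : 0 < κ) (hd : 0 < d) (hx0 : 0 ≤ x) (hx1 : x ≤ 1)
    {ω : ℂ} (hω : ‖ω‖ = 1) (hω1 : ω ≠ 1) {L : ℕ} (hL : 1 ≤ L) :
    ‖∑ i ∈ Finset.range (L + L), ω ^ i * (gapWeight κ d ((i : ℝ) - L - x) : ℂ)
        + (gapWeight κ d (-(L : ℝ) - x) : ℂ) / (ω - 1) - ω ^ L * szegoSeries κ d x ω‖ ≤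
      (κ * Real.exp (2 * d) / ‖ω - 1‖ + (κ⁻¹ + κ) / (1 - Real.exp (-(2 * d)))) *
        Real.exp (-(2 * d)) ^ L := by
  set r := Real.exp (-(2 * d)) with hr
  have hr1 : r < 1 := exp_neg_two_mul_lt_one hd
  have hr0 : 0 < r := Real.exp_pos _
  have hω0 : ω ≠ 0 := by rintro rfl; simp at hω
  have hD : ω - 1 ≠ 0 := sub_ne_zero.2 hω1
  have n1 : ∀ l : ℕ, ‖ω ^ l * (gapWeight κ d (l - x) : ℂ)‖ ≤ κ⁻¹ * r ^ l := fun l => by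
    rw [norm_mul, norm_pow, hω, one_pow, one_mul, Complex.norm_real]
    exact abs_gapWeight_nat_le hκ hd hx1 l
  have n2 : ∀ l : ℕ, ‖(ω⁻¹) ^ (l + 1) * ((1 - gapWeight κ d (-((l : ℝ) + 1) - x) : ℝ) : ℂ)‖ ≤
      κ * r ^ l := fun l => by
    rw [norm_mul, norm_pow, norm_inv, hω, inv_one, one_pow, one_mul, Complex.norm_real]
    exact abs_one_sub_gapWeight_neg_le hκ hd hx0 l
  obtain ⟨-, t1⟩ := norm_tsum_tail_le hr0.le hr1 n1 L
  obtain ⟨-, t2⟩ := norm_tsum_tail_le hr0.le hr1 n2 L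
  have e0 : ∑ i ∈ Finset.range L, ω ^ i * (gapWeight κ d ((i : ℝ) - L - x) : ℂ) =
      (ω ^ L - 1) / (ω - 1) - ω ^ L * ∑ l ∈ Finset.range L,
        (ω⁻¹) ^ (l + 1) * ((1 - gapWeight κ d (-((l : ℝ) + 1) - x) : ℝ) : ℂ) := by
    rw [← geom_sum_eq hω1, ← Finset.sum_range_reflect (fun i => ω ^ i) L, Finset.mul_sum,
      ← Finset.sum_sub_distrib, ← Finset.sum_range_reflect]
    refine Finset.sum_congr rfl fun l hl => ?_
    have hl' := Finset.mem_range.1 hl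
    have e1 : ((L - 1 - l : ℕ) : ℝ) - L - x = -((l : ℝ) + 1) - x := by
      rw [show L - 1 - l = L - (l + 1) by omega, Nat.cast_sub (by omega)]
      push_cast; ring
    have e2 : ω ^ (L - 1 - l) = ω ^ L * (ω⁻¹) ^ (l + 1) := by
      rw [inv_pow, ← div_eq_mul_inv, eq_div_iff (pow_ne_zero _ hω0), ← pow_add]
      congr 1
      omega
    rw [e1, ← mul_assoc, ← e2]
    push_cast
    ring
  have e3 : ∑ i ∈ Finset.range (L + L), ω ^ i * (gapWeight κ d ((i : ℝ) - L - x) : ℂ) =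
      (ω ^ L - 1) / (ω - 1) - ω ^ L * ∑ l ∈ Finset.range L,
        (ω⁻¹) ^ (l + 1) * ((1 - gapWeight κ d (-((l : ℝ) + 1) - x) : ℝ) : ℂ)
      + ω ^ L * ∑ l ∈ Finset.range L, ω ^ l * (gapWeight κ d (l - x) : ℂ) := by
    rw [Finset.sum_range_add, e0, Finset.mul_sum (s := Finset.range L)
      (f := fun l => ω ^ l * (gapWeight κ d (l - x) : ℂ))]
    congr 1
    refine Finset.sum_congr rfl fun l _ => ?_
    rw [pow_add, mul_assoc]
    congr 4
    push_cast; ring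
  have e4 : ∑ i ∈ Finset.range (L + L), ω ^ i * (gapWeight κ d ((i : ℝ) - L - x) : ℂ)
        + (gapWeight κ d (-(L : ℝ) - x) : ℂ) / (ω - 1) - ω ^ L * szegoSeries κ d x ω =
      -(((1 - gapWeight κ d (-(L : ℝ) - x) : ℝ) : ℂ) / (ω - 1))
      - ω ^ L * (∑' l : ℕ, ω ^ l * (gapWeight κ d (l - x) : ℂ)
          - ∑ l ∈ Finset.range L, ω ^ l * (gapWeight κ d (l - x) : ℂ))
      + ω ^ L * (∑' l : ℕ, (ω⁻¹) ^ (l + 1) * ((1 - gapWeight κ d (-((l : ℝ) + 1) - x) : ℝ) : ℂ)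
          - ∑ l ∈ Finset.range L,
            (ω⁻¹) ^ (l + 1) * ((1 - gapWeight κ d (-((l : ℝ) + 1) - x) : ℝ) : ℂ)) := by
    rw [e3, szegoSeries, Complex.ofReal_sub, Complex.ofReal_one]
    field_simp
    ring
  have hωL : ‖ω ^ L‖ = 1 := by rw [norm_pow, hω, one_pow]
  have t3 : ‖((1 - gapWeight κ d (-(L : ℝ) - x) : ℝ) : ℂ) / (ω - 1)‖ ≤
      κ * Real.exp (2 * d) / ‖ω - 1‖ * r ^ L := by
    rw [norm_div, Complex.norm_real, div_mul_eq_mul_div]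
    gcongr
    obtain ⟨l, rfl⟩ : ∃ l, L = l + 1 := ⟨L - 1, by omega⟩
    have := abs_one_sub_gapWeight_neg_le hκ hd hx0 l
    push_cast
    refine this.trans (le_of_eq ?_)
    have : Real.exp (2 * d) * r = 1 := by rw [hr, ← Real.exp_add, add_neg_cancel, Real.exp_zero]
    rw [pow_succ]
    linear_combination (-κ * r ^ l) * this
  rw [e4]
  refine (norm_add_le _ _).trans ((add_le_add_left (norm_sub_le _ _) _).trans ?_)
  rw [norm_neg, norm_mul, norm_mul, hωL, one_mul, one_mul]
  refine (add_le_add (add_le_add t3 t1) t2).trans (le_of_eq ?_)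
  ring

/-! ### Asymptotics of the oscillating sum of coefficients -/

/-- Head and far right are bounded absolutely, the left window by oscillation, the centre by Laplace
asymptotics. The boundary term of the window is replaced by its limit, at cost `E₃ / ‖ω - 1‖`, and
completes the central sum to the Abel sum. -/
lemma norm_sum_range_sub_szegoSeries_le {κ d x : ℝ} (hκ : 0 < κ) (hd : 0 < d) (hx0 : 0 ≤ x)
    (hx1 : x ≤ 1) {ω : ℂ} (hω : ‖ω‖ = 1) (hω1 : ω ≠ 1) {f : ℕ → ℝ} {n m p L : ℕ} (hL : 1 ≤ L)
    (hp : p + L ≤ m) (hn : m + L ≤ n) {W E₁ E₂ E₃ E₄ E₅ : ℝ} (hW : 0 ≤ W)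
    (h₁ : ∑ j ∈ Finset.range p, |f j| ≤ E₁)
    (h₂ : ‖∑ j ∈ Finset.Ico p (m - L), ω ^ j * (f j : ℂ)
      - ω ^ (m - L) * (f (m - L) : ℂ) / (ω - 1)‖ ≤ E₂)
    (h₃ : ∀ j, m - L ≤ j → j < m + L → |f j - W * gapWeight κ d (j - (m + x))| ≤ E₃)
    (h₄ : W * Real.exp (-(2 * d)) ^ L ≤ E₄) (h₅ : ∑ j ∈ Finset.Ico (m + L) n, |f j| ≤ E₅) :
    ‖∑ j ∈ Finset.range n, ω ^ j * (f j : ℂ) - ω ^ m * (W * szegoSeries κ d x ω)‖ ≤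
      E₁ + E₂ + (L + L : ℕ) * E₃ + E₃ / ‖ω - 1‖
        + (κ * Real.exp (2 * d) / ‖ω - 1‖ + (κ⁻¹ + κ) / (1 - Real.exp (-(2 * d)))) * E₄ + E₅ := by
  obtain ⟨q, rfl⟩ : ∃ q, m = q + L := ⟨m - L, by omega⟩
  rw [Nat.add_sub_cancel] at h₂ h₃
  set G : ℕ → ℝ := fun i => gapWeight κ d ((i : ℝ) - L - x) with hG
  have hτ : ∀ i : ℕ, gapWeight κ d (((q + i : ℕ) : ℝ) - ((q + L : ℕ) + x)) = G i := fun i => by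
    simp only [hG]
    congr 1
    push_cast; ring
  have hG0 : gapWeight κ d (-(L : ℝ) - x) = G 0 := by
    simp only [hG]
    congr 1
    push_cast; ring
  have n3 : ‖∑ i ∈ Finset.range (L + L), ω ^ (q + i) * (((f (q + i) - W * G i : ℝ)) : ℂ)‖ ≤
      (L + L : ℕ) * E₃ := by
    refine (norm_sum_le _ _).trans ?_
    rw [← nsmul_eq_mul]
    conv_rhs => rw [← Finset.card_range (L + L)]
    refine Finset.sum_le_card_nsmul _ _ _ fun i hi => ?_
    have hi' := Finset.mem_range.1 hi
    rw [norm_mul, norm_pow, hω, one_pow, one_mul, Complex.norm_real, Real.norm_eq_abs, ← hτ]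
    exact h₃ _ (by omega) (by omega)
  have n3' : ‖ω ^ q * (((f q - W * G 0 : ℝ)) : ℂ) / (ω - 1)‖ ≤ E₃ / ‖ω - 1‖ := by
    rw [norm_div, norm_mul, norm_pow, hω, one_pow, one_mul, Complex.norm_real, Real.norm_eq_abs,
      ← hτ, add_zero]
    gcongr
    exact h₃ _ le_rfl (by omega)
  have n4 := norm_sum_sub_szegoSeries_le hκ hd hx0 hx1 hω hω1 hL
  rw [hG0] at n4
  set Z := ∑ i ∈ Finset.range (L + L), ω ^ i * (gapWeight κ d ((i : ℝ) - L - x) : ℂ)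
        + (G 0 : ℂ) / (ω - 1) - ω ^ L * szegoSeries κ d x ω with hZ
  have hr1 := exp_neg_two_mul_lt_one hd
  have n4' : ‖ω ^ q * (W * Z)‖ ≤
      (κ * Real.exp (2 * d) / ‖ω - 1‖ + (κ⁻¹ + κ) / (1 - Real.exp (-(2 * d)))) * E₄ := by
    rw [norm_mul, norm_pow, hω, one_pow, one_mul, norm_mul, Complex.norm_real, Real.norm_eq_abs,
      abs_of_nonneg hW]
    have h0 : 0 ≤ κ * Real.exp (2 * d) / ‖ω - 1‖ + (κ⁻¹ + κ) / (1 - Real.exp (-(2 * d))) :=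
      add_nonneg (by positivity) (div_nonneg (by positivity) (by linarith))
    calc W * ‖Z‖ ≤ W * _ := mul_le_mul_of_nonneg_left n4 hW
      _ = (κ * Real.exp (2 * d) / ‖ω - 1‖ + (κ⁻¹ + κ) / (1 - Real.exp (-(2 * d)))) *
          (W * Real.exp (-(2 * d)) ^ L) := by ring
      _ ≤ _ := mul_le_mul_of_nonneg_left h₄ h0
  have n1 := (norm_sum_pow_mul_le hω f (Finset.range p)).trans h₁
  have n5 := (norm_sum_pow_mul_le hω f (Finset.Ico (q + L + L) n)).trans h₅
  have hsplit : ∑ j ∈ Finset.range n, ω ^ j * (f j : ℂ) =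
      ∑ j ∈ Finset.range p, ω ^ j * (f j : ℂ) + ∑ j ∈ Finset.Ico p q, ω ^ j * (f j : ℂ)
      + ∑ i ∈ Finset.range (L + L), ω ^ (q + i) * (f (q + i) : ℂ)
      + ∑ j ∈ Finset.Ico (q + L + L) n, ω ^ j * (f j : ℂ) := by
    rw [Finset.sum_range_add_sum_Ico _ (by omega : p ≤ q), add_assoc q L L,
      ← Finset.sum_range_add (fun j => ω ^ j * (f j : ℂ)) q (L + L),
      Finset.sum_range_add_sum_Ico _ (by omega)]
  have hsum : ∑ i ∈ Finset.range (L + L), ω ^ (q + i) * (f (q + i) : ℂ) =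
      ∑ i ∈ Finset.range (L + L), ω ^ (q + i) * (((f (q + i) - W * G i : ℝ)) : ℂ)
      + ω ^ q * (W * ∑ i ∈ Finset.range (L + L), ω ^ i * (G i : ℂ)) := by
    rw [Finset.mul_sum, Finset.mul_sum, ← Finset.sum_add_distrib]
    refine Finset.sum_congr rfl fun i _ => ?_
    push_cast
    rw [pow_add]
    ring
  have key : ∑ j ∈ Finset.range n, ω ^ j * (f j : ℂ) - ω ^ (q + L) * (W * szegoSeries κ d x ω) =
      ∑ j ∈ Finset.range p, ω ^ j * (f j : ℂ)
      + (∑ j ∈ Finset.Ico p q, ω ^ j * (f j : ℂ) - ω ^ q * (f q : ℂ) / (ω - 1))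
      + ∑ i ∈ Finset.range (L + L), ω ^ (q + i) * (((f (q + i) - W * G i : ℝ)) : ℂ)
      + ω ^ q * (((f q - W * G 0 : ℝ)) : ℂ) / (ω - 1)
      + ω ^ q * (W * Z)
      + ∑ j ∈ Finset.Ico (q + L + L) n, ω ^ j * (f j : ℂ) := by
    rw [hsplit, hsum, hZ, pow_add]
    push_cast
    ring
  rw [key]
  refine (norm_add_le _ _).trans (add_le_add ((norm_add_le _ _).trans (add_le_add
    ((norm_add_le _ _).trans (add_le_add ((norm_add_le _ _).trans (add_le_add
    ((norm_add_le _ _).trans (add_le_add n1 h₂)) n3)) n3')) n4')) n5)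

lemma eventually_log_pow_le_sqrt (C : ℝ) (k : ℕ) :
    ∀ᶠ n : ℕ in atTop, C * Real.log n ^ k ≤ Real.sqrt n := by
  have h1 : (fun x : ℝ => Real.log x ^ k) =o[atTop] fun x => x ^ (1 / 2 : ℝ) := by
    have := isLittleO_log_rpow_rpow_atTop (k : ℝ) (show (0 : ℝ) < 1 / 2 by norm_num)
    simpa using this
  have h2 := (h1.comp_tendsto tendsto_natCast_atTop_atTop).bound
    (show (0 : ℝ) < 1 / (|C| + 1) by positivity)
  filter_upwards [h2] with n hn
  simp only [Function.comp] at hn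
  rw [← Real.sqrt_eq_rpow, Real.norm_eq_abs, Real.norm_eq_abs, abs_of_nonneg (Real.sqrt_nonneg _),
    div_mul_eq_mul_div, one_mul, le_div_iff₀ (by positivity)] at hn
  calc C * Real.log n ^ k ≤ |C * Real.log n ^ k| := le_abs_self _
    _ = |Real.log n ^ k| * |C| := by rw [abs_mul, mul_comm]
    _ ≤ |Real.log n ^ k| * (|C| + 1) := by gcongr; linarith
    _ ≤ _ := hn

namespace DoubleWell

variable {v : ℝ → ℝ} {y₁ y₂ α₁ α₂ C c δ : ℝ}

set_option maxHeartbeats 2000000 in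
/-- The sum `∑_{j<n} ω ^ j coeff (j - B n / 2)` concentrates near `j = B n / 2`, where it is
given by the Szegő series. -/
theorem exists_sum_coeff_asymp (h : DoubleWell v y₁ y₂ α₁ α₂ C c δ) {B M : ℝ} (hB0 : 0 < B)
    (hB2 : B < 2) (hM : 0 ≤ M) {ω : ℂ} (hω : ‖ω‖ = 1) (hω1 : ω ≠ 1) :
    ∃ C' : ℝ, ∀ᶠ n : ℕ in atTop, ∀ Y, |Y - 2 * y₁| ≤ M / Real.sqrt n →
      ‖∑ j ∈ Finset.range n, ω ^ j * (coeff v n Y ((j : ℝ) - B * n / 2) : ℂ)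
        - ω ^ ⌊B * n / 2⌋₊ * ((Real.sqrt n * (Real.exp (-(2 * y₁)) * Real.sqrt (α₁ / Real.pi)) : ℝ)
          * szegoSeries (Real.sqrt (α₁ / α₂)) (y₂ - y₁) (Int.fract (B * n / 2)) ω)‖ ≤
      C' * Real.log n ^ 3 := by
  obtain ⟨K₁, hK₁, n₁, hn₁, hasy⟩ := h.exists_coeff_asymp hM
  obtain ⟨K₂, hK₂, n₂, hn₂, hleft⟩ := h.exists_coeff_le_left hM
  obtain ⟨K₃, hK₃, n₃, hn₃, hright⟩ := h.exists_coeff_le_right M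
  obtain ⟨K₄, hK₄, n₄, hn₄, hlow⟩ := h.exists_le_coeff hM
  have hα₁ := h.α₁_pos
  have hα₂ := h.α₂_pos
  have hπ := Real.pi_pos
  set A := Real.exp (-(2 * y₁)) * Real.sqrt (α₁ / Real.pi) with hA
  have hA0 : 0 < A := mul_pos (Real.exp_pos _) (Real.sqrt_pos.2 (by positivity))
  set κ := Real.sqrt (α₁ / α₂) with hκdef
  have hκ : 0 < κ := Real.sqrt_pos.2 (by positivity)
  set d := y₂ - y₁ with hddef
  have hd : 0 < d := sub_pos.2 h.lt
  set cL := 1 / d + 3 with hcL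
  have hcL0 : 0 < cL := by positivity
  set E := κ * Real.exp (4 * d) with hE
  have hE0 : 0 < E := by positivity
  set b := A * E + 2 * (K₁ * (cL + 3)) with hb
  have hb0 : 0 < b := by positivity
  set a := 57 * K₄ with ha
  have ha0 : 0 < a := by positivity
  set e := a + b / (A / 2) with he
  have he0 : 0 < e := by positivity
  have hB2' : 0 < 2 - B := by linarith
  -- `Λ` collects what `√n / log n` must exceed: that the windows fit into `[0, n)`, that the
  -- asymptotics apply in the centre, and that `f` is at least `A √n / 2` at its left end.
  set Λ := cL + 16 / B + 2 * cL / (2 - B) + K₁ * (cL + 3) + 7 * K₄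
    + 2 * (A * E + K₁ * (cL + 3)) / A + e + K₂ with hΛ
  have hr1 := exp_neg_two_mul_lt_one hd
  set D₁ := κ * Real.exp (2 * d) / ‖ω - 1‖ + (κ⁻¹ + κ) / (1 - Real.exp (-(2 * d))) with hD₁
  have hD₁0 : 0 ≤ D₁ := add_nonneg (by positivity) (div_nonneg (by positivity) (by linarith))
  set D₂ := 1 / ‖ω - 1‖ + (4 * K₂ * e + 3 * K₂ * e ^ 2) / ‖ω - 1‖ ^ 2 with hD₂
  set D₅ := K₃ * Real.exp d / (1 - Real.exp (-d)) with hD₅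
  have hrd1 : Real.exp (-d) < 1 := Real.exp_zero ▸ Real.exp_lt_exp.2 (by linarith)
  have hD₅0 : 0 ≤ D₅ := div_nonneg (by positivity) (by linarith)
  clear_value A κ d cL E b a Λ D₅
  refine ⟨1 + D₂ + 2 * cL * (K₁ * (cL + 3)) + K₁ * (cL + 3) / ‖ω - 1‖ + D₁ * A + D₅, ?_⟩
  filter_upwards [eventually_log_pow_le_sqrt Λ 3, eventually_ge_atTop 3,
    tendsto_natCast_atTop_atTop.eventually_ge_atTop (n₁ + n₂ + n₃ + n₄)] with n hΛn hn3 hnn Y hY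
  have hn0 : (0 : ℝ) < n := by positivity
  have hn3' : (3 : ℝ) ≤ n := by exact_mod_cast hn3
  replace hasy := hasy n (by linarith) Y hY
  replace hleft := hleft n (by linarith) Y hY
  replace hright := hright n (by linarith) Y hY
  replace hlow := hlow n (by linarith) Y hY
  set R := Real.sqrt n with hR
  set ℓ := Real.log n with hℓ
  have hRR : R ^ 2 = n := Real.sq_sqrt hn0.le
  have hℓ1 : 1 ≤ ℓ := by
    rw [hℓ, Real.le_log_iff_exp_le hn0]
    linarith [Real.exp_one_lt_three]
  have hR1 : 1 ≤ R := by rw [hR, Real.one_le_sqrt]; linarith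
  have hR0 : 0 < R := by linarith
  have hℓ13 : ℓ ≤ ℓ ^ 3 := le_self_pow₀ hℓ1 (by norm_num)
  have hℓ23 : ℓ ^ 2 ≤ ℓ ^ 3 := pow_le_pow_right₀ hℓ1 (by norm_num)
  have hΛR : ∀ X : ℝ, 0 ≤ X → X ≤ Λ → X * ℓ ≤ R := fun X hX hXΛ =>
    (mul_le_mul hXΛ hℓ13 (by positivity) (hX.trans hXΛ)).trans hΛn
  have p1 : 0 < 16 / B := by positivity
  have p2 : 0 < 2 * cL / (2 - B) := by positivity
  have p3 : 0 < K₁ * (cL + 3) := by positivity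
  have p4 : 0 < 2 * (A * E + K₁ * (cL + 3)) / A := by positivity
  have q1 := hΛR cL hcL0.le (by linarith)
  have q2 := hΛR (16 / B) p1.le (by linarith)
  have q3 := hΛR (2 * cL / (2 - B)) p2.le (by linarith)
  have q4 := hΛR (K₁ * (cL + 3)) p3.le (by linarith)
  have q5 := hΛR (7 * K₄) (by positivity) (by linarith)
  have q6 := hΛR _ p4.le (by linarith)
  have q7 := hΛR e he0.le (by linarith)
  have q8 := hΛR K₂ hK₂.le (by linarith)
  have hK₂R : K₂ ≤ R := (le_mul_of_one_le_right hK₂.le hℓ1).trans q8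
  have hexpℓ : Real.exp (-ℓ) = (R ^ 2)⁻¹ := by
    rw [hRR, Real.exp_neg, hℓ, Real.exp_log hn0]
  -- the cutoffs
  set L := ⌈ℓ / d⌉₊ + 2 with hL
  -- At distance `2 √n log n` to the left the decay factor is at most `n⁻²`, so each term of the
  -- head is at most `1 / n`.
  set i := ⌈2 * R * ℓ⌉₊ with hi
  set β := B * n / 2 with hβ
  have hβ0 : 0 < β := by positivity
  set m := ⌊β⌋₊ with hm
  have hmβ : (m : ℝ) ≤ β := Nat.floor_le hβ0.le
  have hβm : β < m + 1 := Nat.lt_floor_add_one β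
  have hx : Int.fract β = β - m := by
    rw [← Int.self_sub_floor, ← natCast_floor_eq_intCast_floor hβ0.le]
  have hL1 : ℓ / d + 2 ≤ L := by
    rw [hL]; push_cast; linarith [Nat.le_ceil (ℓ / d)]
  have hL2 : (L : ℝ) ≤ cL * ℓ := by
    have := Nat.ceil_lt_add_one (show 0 ≤ ℓ / d by positivity)
    have e1 : cL * ℓ = ℓ / d + 3 * ℓ := by rw [hcL]; ring
    rw [hL, e1]; push_cast; linarith
  have hi1 : 2 * R * ℓ ≤ i := Nat.le_ceil _
  clear_value L R ℓ
  have hRℓ : 1 ≤ R * ℓ := one_le_mul_of_one_le_of_one_le hR1 hℓ1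
  have hi2 : (i : ℝ) ≤ 3 * R * ℓ := by
    have := Nat.ceil_lt_add_one (show 0 ≤ 2 * R * ℓ by positivity)
    rw [hi]; linarith
  have hRRℓ : R ≤ R * ℓ := le_mul_of_one_le_right hR0.le hℓ1
  have hLi : L ≤ i := by
    have : (L : ℝ) ≤ i := by linarith
    exact_mod_cast this
  have him : i + i + 1 ≤ m := by
    have h1 : 8 * (R * ℓ) ≤ β := by
      have : 16 / B * ℓ * R ≤ R * R := by gcongr
      have h2 : β = B / 2 * (R * R) := by rw [hβ, ← hRR]; ring
      rw [h2]
      calc 8 * (R * ℓ) = B / 2 * (16 / B * ℓ * R) := by field_simp; norm_num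
        _ ≤ _ := by gcongr
    have : ((i + i + 1 : ℕ) : ℝ) ≤ m := by push_cast; linarith
    exact_mod_cast this
  have hmL : m + L ≤ n := by
    have h1 : cL * ℓ ≤ n - β := by
      have h2 : n - β = (2 - B) / 2 * (R * R) := by rw [hβ, ← hRR]; ring
      rw [h2]
      calc cL * ℓ = (2 - B) / 2 * (2 * cL / (2 - B) * ℓ * 1) := by field_simp
        _ ≤ _ := by gcongr
    have : ((m + L : ℕ) : ℝ) ≤ n := by push_cast; linarith
    exact_mod_cast this
  -- `L ≥ log n / d` makes the exponentials at both ends of the central window at most `1 / n`.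
  have hexpL : Real.exp (-(d * L)) ≤ (R ^ 2)⁻¹ := by
    rw [← hexpℓ, Real.exp_le_exp]
    have : d * (ℓ / d + 2) ≤ d * L := by gcongr
    have e1 : d * (ℓ / d + 2) = ℓ + 2 * d := by field_simp
    linarith
  have hRinv : (R ^ 2)⁻¹ ≤ R⁻¹ := by
    gcongr
    exact le_self_pow₀ hR1 (by norm_num)
  have hRinv1 : R⁻¹ ≤ 1 := inv_le_one_of_one_le₀ hR1
  set f : ℕ → ℝ := fun j => coeff v n Y ((j : ℝ) - β) with hf
  have hf0 : ∀ j, 0 ≤ f j := fun j => coeff_nonneg _ _ _ _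
  have hcast : ∀ j t : ℕ, f (j + t) = coeff v n Y ((j : ℝ) - β + t) := fun j t => by
    simp only [hf]; congr 1; push_cast; ring
  have hfl : ∀ j, j + 1 ≤ m → f j ≤ K₂ * R * Real.exp (((j : ℝ) - β) / R) := fun j hj => by
    refine hleft _ ?_
    have : ((j + 1 : ℕ) : ℝ) ≤ m := by exact_mod_cast hj
    push_cast at this
    linarith
  have hfF : ∀ j, j + 1 ≤ m → f j ≤ K₂ * R := fun j hj => by
    refine (hfl j hj).trans (mul_le_of_le_one_right (by positivity) (Real.exp_le_one_iff.2 ?_))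
    refine div_nonpos_of_nonpos_of_nonneg ?_ hR0.le
    have : ((j + 1 : ℕ) : ℝ) ≤ m := by exact_mod_cast hj
    push_cast at this
    linarith
  have hfhead : ∀ j, j + i ≤ m → f j ≤ (R ^ 2)⁻¹ := fun j hj => by
    refine (hfl j (by omega)).trans ?_
    have h1 : Real.exp (((j : ℝ) - β) / R) ≤ Real.exp (-ℓ) * Real.exp (-ℓ) := by
      rw [← Real.exp_add, Real.exp_le_exp, div_le_iff₀ hR0]
      have : ((j + i : ℕ) : ℝ) ≤ m := by exact_mod_cast hj
      push_cast at this
      linarith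
    calc K₂ * R * Real.exp (((j : ℝ) - β) / R) ≤ R * R * (Real.exp (-ℓ) * Real.exp (-ℓ)) := by
          gcongr
      _ = (R ^ 2)⁻¹ := by rw [hexpℓ]; field_simp
  -- Here `|j - β| ≤ 2 i + 1 ≤ 7 R ℓ`. The constant `a = 57 K₄` is `7 + 49 + 1`: the linear and the
  -- quadratic exponent of `exists_le_coeff`, and its prefactor `1 / K₄`.
  have hlower : ∀ j, m ≤ j + (i + i) → j + 1 ≤ m →
      (Integrable fun y => Real.exp ((2 * ((j : ℝ) - β) + 2) * y - n * v y)) ∧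
      Real.exp (-(a * ℓ ^ 2)) ≤ f j := fun j hj1 hj2 => by
    have h1 : ((j + 1 : ℕ) : ℝ) ≤ m := by exact_mod_cast hj2
    have h2 : (m : ℝ) ≤ ((j + (i + i) : ℕ) : ℝ) := by exact_mod_cast hj1
    push_cast at h1 h2
    have h3 : |(j : ℝ) - β| ≤ 7 * (R * ℓ) := by rw [abs_le]; constructor <;> linarith
    obtain ⟨g1, g2⟩ := hlow ((j : ℝ) - β) (by linarith) (by
      calc K₄ * |(j : ℝ) - β| ≤ K₄ * (7 * (R * ℓ)) := by gcongr
        _ = (7 * K₄ * ℓ) * R := by ring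
        _ ≤ R * R := by gcongr
        _ = n := by rw [← hRR]; ring)
    refine ⟨g1, le_trans ?_ g2⟩
    have h4 : K₄ * (|(j : ℝ) - β| / R) ≤ 7 * K₄ * ℓ ^ 2 := by
      calc K₄ * (|(j : ℝ) - β| / R) ≤ K₄ * (7 * (R * ℓ) / R) := by gcongr
        _ = 7 * K₄ * ℓ := by field_simp
        _ ≤ _ := by gcongr; exact le_self_pow₀ hℓ1 (by norm_num)
    have h5 : K₄ * ((j : ℝ) - β) ^ 2 / n ≤ 49 * K₄ * ℓ ^ 2 := by
      calc K₄ * ((j : ℝ) - β) ^ 2 / n = K₄ * |(j : ℝ) - β| ^ 2 / R ^ 2 := by rw [sq_abs, hRR]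
        _ ≤ K₄ * (7 * (R * ℓ)) ^ 2 / R ^ 2 := by gcongr
        _ = _ := by field_simp; norm_num
    have h6 : Real.exp (-(K₄ * ℓ ^ 2)) ≤ 1 / K₄ := by
      rw [Real.exp_neg, ← one_div]
      gcongr
      have : K₄ * 1 ≤ K₄ * ℓ ^ 2 := by gcongr; exact one_le_pow₀ hℓ1
      linarith [Real.add_one_le_exp (K₄ * ℓ ^ 2)]
    calc Real.exp (-(a * ℓ ^ 2)) = Real.exp (-(K₄ * ℓ ^ 2)) * Real.exp (-(56 * K₄ * ℓ ^ 2)) := by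
          rw [← Real.exp_add, ha]; congr 1; ring
      _ ≤ _ := by
        gcongr
        linarith
  have hasyj : ∀ j, m ≤ j + L → j ≤ m + L + 1 →
      |f j - R * (A * gapWeight κ d ((j : ℝ) - β))| ≤ K₁ * (cL + 3) * ℓ := fun j hj1 hj2 => by
    have h1 : (m : ℝ) ≤ ((j + L : ℕ) : ℝ) := by exact_mod_cast hj1
    have h2 : (j : ℝ) ≤ ((m + L + 1 : ℕ) : ℝ) := by exact_mod_cast hj2
    push_cast at h1 h2
    have h3 : 1 + |(j : ℝ) - β| ≤ (cL + 3) * ℓ := by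
      have : |(j : ℝ) - β| ≤ L + 1 := by rw [abs_le]; constructor <;> linarith
      linarith
    have h4 : K₁ * (1 + |(j : ℝ) - β|) ≤ K₁ * (cL + 3) * ℓ := by
      rw [mul_assoc]; gcongr
    exact (hasy _ (h4.trans q4)).trans h4
  -- The index `m - L + 1` is included for the forward difference at `m - L`; it and the `2` in `2τ
  -- + 2` account for `e^{4d}` in `E`.
  have hG1 : ∀ j, j ≤ m - L + 1 → 1 - gapWeight κ d ((j : ℝ) - β) ≤ E * R⁻¹ := fun j hj => by
    refine (one_sub_gapWeight_le hκ _ _).trans ?_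
    have h1 : (j : ℝ) ≤ m - L + 1 := by
      have : ((j + L : ℕ) : ℝ) ≤ ((m + 1 : ℕ) : ℝ) := by exact_mod_cast (by omega)
      push_cast at this
      linarith
    have h2 : (2 * ((j : ℝ) - β) + 2) * d ≤ 4 * d + -(d * L) := by
      have : ((j : ℝ) - β) * d ≤ (1 - L) * d :=
        mul_le_mul_of_nonneg_right (by linarith) hd.le
      have : 0 ≤ d * L := by positivity
      linarith
    calc κ * Real.exp ((2 * ((j : ℝ) - β) + 2) * d) ≤ κ * Real.exp (4 * d + -(d * L)) := by gcongr
      _ = E * Real.exp (-(d * L)) := by rw [Real.exp_add, hE]; ring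
      _ ≤ E * R⁻¹ := by gcongr; exact hexpL.trans hRinv
  have hRAE : R * (A * (E * R⁻¹)) = A * E := by field_simp
  have hAE : A * E ≤ A * E * ℓ := le_mul_of_one_le_right (by positivity) hℓ1
  -- assembling the estimate
  have hmain := norm_sum_range_sub_szegoSeries_le (κ := κ) (d := d) (x := Int.fract β) hκ hd
    (Int.fract_nonneg _) (Int.fract_lt_one _).le hω hω1 (f := f) (n := n) (m := m) (p := m - i)
    (L := L) (by omega) (by omega) hmL (W := R * A) (E₁ := 1) (E₂ := D₂ * ℓ ^ 3)
    (E₃ := K₁ * (cL + 3) * ℓ) (E₄ := A) (E₅ := D₅) (by positivity) ?_ ?_ ?_ ?_ ?_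
  · refine hmain.trans ?_
    have t1 : ((L + L : ℕ) : ℝ) * (K₁ * (cL + 3) * ℓ) ≤ 2 * cL * (K₁ * (cL + 3)) * ℓ ^ 3 := by
      calc ((L + L : ℕ) : ℝ) * (K₁ * (cL + 3) * ℓ) ≤ (2 * (cL * ℓ)) * (K₁ * (cL + 3) * ℓ) := by
            push_cast
            gcongr
            linarith
        _ = 2 * cL * (K₁ * (cL + 3)) * ℓ ^ 2 := by ring
        _ ≤ _ := by gcongr
    have t2 : K₁ * (cL + 3) * ℓ / ‖ω - 1‖ ≤ K₁ * (cL + 3) / ‖ω - 1‖ * ℓ ^ 3 := by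
      rw [div_mul_eq_mul_div]
      gcongr
    have hℓ31 : 1 ≤ ℓ ^ 3 := one_le_pow₀ hℓ1
    have t3 : D₁ * A ≤ D₁ * A * ℓ ^ 3 := le_mul_of_one_le_right (by positivity) hℓ31
    have t4 : D₅ ≤ D₅ * ℓ ^ 3 := le_mul_of_one_le_right hD₅0 hℓ31
    calc _ ≤ 1 * ℓ ^ 3 + D₂ * ℓ ^ 3 + 2 * cL * (K₁ * (cL + 3)) * ℓ ^ 3
          + K₁ * (cL + 3) / ‖ω - 1‖ * ℓ ^ 3 + D₁ * A * ℓ ^ 3 + D₅ * ℓ ^ 3 := by linarith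
      _ = _ := by ring
  · calc ∑ j ∈ Finset.range (m - i), |f j| ≤ ∑ j ∈ Finset.range (m - i), (R ^ 2)⁻¹ := by
          refine Finset.sum_le_sum fun j hj => ?_
          rw [abs_of_nonneg (hf0 j)]
          exact hfhead j (by have := Finset.mem_range.1 hj; omega)
      _ = ((m - i : ℕ) : ℝ) * (R ^ 2)⁻¹ := by simp
      _ ≤ n * (R ^ 2)⁻¹ := by
        gcongr
        omega
      _ = 1 := by rw [hRR, mul_inv_cancel₀ hn0.ne']
  · have hw := norm_sum_window_le hω hω1 (f := f) (p := m - (i + i)) (i := i) (q := m - L)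
      (K := K₂) (a := a) (b := b) (c := A / 2) (R := R) (ℓ := ℓ) hK₂ ha0 hb0 (by positivity) hℓ1 q7
      (by omega) hi1 ?_ ?_ ?_ ?_ ?_ ?_ ?_ ?_
    · rwa [show m - (i + i) + i = m - i by omega] at hw
    · refine le_trans ?_ hi2
      exact_mod_cast (by omega)
    · exact fun j h1 h2 => (Real.exp_pos _).trans_le (hlower j (by omega) (by omega)).2
    · intro j h1 h2
      have g0 := (hlower j (by omega) (by omega)).1
      have g1 := (hlower (j + 1) (by omega) (by omega)).1
      have g2 := (hlower (j + 2) (by omega) (by omega)).1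
      rw [hcast j 1, hcast j 2]
      have e1 : ((j + 1 : ℕ) : ℝ) - β = (j : ℝ) - β + 1 := by push_cast; ring
      have e2 : ((j + 2 : ℕ) : ℝ) - β = (j : ℝ) - β + 2 := by push_cast; ring
      rw [e1] at g1
      rw [e2] at g2
      exact_mod_cast coeff_mul_le g0 g1 g2
    · exact fun j h1 h2 => hfF j (by omega)
    · exact (hfhead _ (by omega)).trans (hRinv.trans hRinv1)
    · exact (hlower _ (by omega) (by omega)).2
    -- The drop at `m - L` is at most two Laplace errors plus `A E`, as the next weight is within `E
    -- / R` of `1`.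
    · have g1 := (abs_le.1 (hasyj (m - L) (by omega) (by omega))).2
      have g2 := (abs_le.1 (hasyj (m - L + 1) (by omega) (by omega))).1
      have g3 := hG1 (m - L + 1) le_rfl
      have g4 := gapWeight_le_one hκ d (((m - L : ℕ) : ℝ) - β)
      have g5 : R * (A * (gapWeight κ d (((m - L : ℕ) : ℝ) - β)
          - gapWeight κ d (((m - L + 1 : ℕ) : ℝ) - β))) ≤ A * E := by
        rw [← hRAE]
        gcongr
        linarith
      have e1 : b * ℓ = A * E * ℓ + 2 * (K₁ * (cL + 3) * ℓ) := by rw [hb]; ring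
      rw [e1]
      linarith
    · have g1 := (abs_le.1 (hasyj (m - L) (by omega) (by omega))).1
      have g3 := hG1 (m - L) (by omega)
      have g5 : R * (A * (1 - gapWeight κ d (((m - L : ℕ) : ℝ) - β))) ≤ A * E := by
        rw [← hRAE]
        gcongr
      have g6 : A * E * ℓ + K₁ * (cL + 3) * ℓ ≤ A / 2 * R := by
        calc A * E * ℓ + K₁ * (cL + 3) * ℓ
            = A / 2 * (2 * (A * E + K₁ * (cL + 3)) / A * ℓ) := by field_simp
          _ ≤ _ := by gcongr
      linarith
  · intro j h1 h2
    rw [hx, add_sub_cancel, mul_assoc]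
    exact hasyj j (by omega) (by omega)
  · have e1 : Real.exp (-(2 * d)) ^ L = Real.exp (-(d * L)) * Real.exp (-(d * L)) := by
      rw [← Real.exp_nat_mul, ← Real.exp_add]; congr 1; ring
    have e2 : Real.exp (-(d * L)) ≤ 1 := hexpL.trans (hRinv.trans hRinv1)
    calc R * A * Real.exp (-(2 * d)) ^ L ≤ R * A * (R⁻¹ * 1) := by
          rw [e1]
          gcongr
          exact hexpL.trans hRinv
      _ = A := by field_simp
  · have hterm : ∀ t : ℕ, f (m + L + t) ≤ K₃ * Real.exp d * Real.exp (-d) ^ t := fun t => by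
      have h1 : (0 : ℝ) ≤ ((m + L + t : ℕ) : ℝ) - β := by
        have : (2 : ℝ) ≤ L := by
          have : 0 < ℓ / d := by positivity
          linarith
        push_cast
        have : (0 : ℝ) ≤ t := Nat.cast_nonneg t
        linarith
      refine (hright _ h1).trans ?_
      have h2 : Real.exp (-(d * (((m + L + t : ℕ) : ℝ) - β))) ≤
          Real.exp d * Real.exp (-d) ^ t * Real.exp (-(d * L)) := by
        rw [← Real.exp_nat_mul, ← Real.exp_add, ← Real.exp_add, Real.exp_le_exp]
        have : d * (L + t - 1) ≤ d * (((m + L + t : ℕ) : ℝ) - β) := by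
          refine mul_le_mul_of_nonneg_left ?_ hd.le
          push_cast
          linarith
        linarith
      calc K₃ * R * Real.exp (-(d * (((m + L + t : ℕ) : ℝ) - β))) ≤
            K₃ * R * (Real.exp d * Real.exp (-d) ^ t * R⁻¹) := by
            gcongr
            refine h2.trans ?_
            gcongr
            exact hexpL.trans hRinv
        _ = _ := by field_simp
    rw [Finset.sum_Ico_eq_sum_range]
    calc ∑ t ∈ Finset.range (n - (m + L)), |f (m + L + t)| ≤
          ∑ t ∈ Finset.range (n - (m + L)), K₃ * Real.exp d * Real.exp (-d) ^ t := by
          refine Finset.sum_le_sum fun t _ => ?_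
          rw [abs_of_nonneg (hf0 _)]
          exact hterm t
      _ = K₃ * Real.exp d * ∑ t ∈ Finset.range (n - (m + L)), Real.exp (-d) ^ t := by
        rw [Finset.mul_sum]
      _ ≤ K₃ * Real.exp d * (1 - Real.exp (-d))⁻¹ := by
        gcongr
        rw [← tsum_geometric_of_lt_one (Real.exp_pos _).le hrd1]
        exact (summable_geometric_of_lt_one (Real.exp_pos _).le hrd1).sum_le_tsum _
          fun _ _ => by positivity
      _ = D₅ := by rw [hD₅, div_eq_mul_inv]

end DoubleWell

/-! ### The weighted Szegő kernel as a Szegő series -/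

lemma norm_szegoSeries_le {κ d x : ℝ} (hκ : 0 < κ) (hd : 0 < d) (hx0 : 0 ≤ x) (hx1 : x ≤ 1)
    {ω : ℂ} (hω : ‖ω‖ = 1) :
    ‖szegoSeries κ d x ω‖ ≤
      1 / ‖ω - 1‖ + κ⁻¹ / (1 - Real.exp (-(2 * d))) + κ / (1 - Real.exp (-(2 * d))) := by
  have hr1 := exp_neg_two_mul_lt_one hd
  have hr0 := Real.exp_pos (-(2 * d))
  have n1 : ∀ l : ℕ, ‖ω ^ l * (gapWeight κ d (l - x) : ℂ)‖ ≤ κ⁻¹ * Real.exp (-(2 * d)) ^ l :=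
    fun l => by
      rw [norm_mul, norm_pow, hω, one_pow, one_mul, Complex.norm_real]
      exact abs_gapWeight_nat_le hκ hd hx1 l
  have n2 : ∀ l : ℕ, ‖(ω⁻¹) ^ (l + 1) * ((1 - gapWeight κ d (-((l : ℝ) + 1) - x) : ℝ) : ℂ)‖ ≤
      κ * Real.exp (-(2 * d)) ^ l := fun l => by
    rw [norm_mul, norm_pow, norm_inv, hω, inv_one, one_pow, one_mul, Complex.norm_real]
    exact abs_one_sub_gapWeight_neg_le hκ hd hx0 l
  have t1 := (norm_tsum_tail_le hr0.le hr1 n1 0).2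
  have t2 := (norm_tsum_tail_le hr0.le hr1 n2 0).2
  rw [Finset.sum_range_zero, sub_zero, pow_zero, mul_one] at t1 t2
  refine (norm_sub_le _ _).trans (add_le_add ((norm_add_le _ _).trans (add_le_add ?_ t1)) t2)
  rw [norm_div, norm_one]

lemma pow_sub_one_le {y : ℝ} (hy : 1 ≤ y) (l : ℕ) : y ^ l - 1 ≤ l * (y - 1) * y ^ l := by
  induction l with
  | zero => simp
  | succ l ih =>
    have h1 : (1 : ℝ) ≤ y ^ l := one_le_pow₀ hy
    have h2 : 1 ≤ y ^ (l + 1) := one_le_pow₀ hy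
    calc y ^ (l + 1) - 1 = y * (y ^ l - 1) + (y - 1) * 1 := by ring
      _ ≤ y * (l * (y - 1) * y ^ l) + (y - 1) * y ^ (l + 1) :=
        add_le_add (mul_le_mul_of_nonneg_left ih (by linarith))
          (mul_le_mul_of_nonneg_left h2 (by linarith))
      _ = _ := by push_cast; ring

lemma one_sub_inv_pow_le {y : ℝ} (hy : 1 ≤ y) (l : ℕ) : |(y⁻¹) ^ l - 1| ≤ l * (y - 1) := by
  have h0 : 0 < y := by linarith
  have h1 : (y⁻¹) ^ l ≤ 1 := pow_le_one₀ (by positivity) (inv_le_one_of_one_le₀ hy)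
  have h2 : (y⁻¹) ^ l * y ^ l = 1 := by rw [← mul_pow, inv_mul_cancel₀ h0.ne', one_pow]
  rw [abs_sub_comm, abs_of_nonneg (by linarith)]
  have h3 := pow_sub_one_le hy l
  have h4 : 0 < (y⁻¹) ^ l := by positivity
  calc 1 - (y⁻¹) ^ l = (y⁻¹) ^ l * (y ^ l - 1) := by linarith
    _ ≤ (y⁻¹) ^ l * (l * (y - 1) * y ^ l) := by gcongr
    _ = l * (y - 1) * ((y⁻¹) ^ l * y ^ l) := by ring
    _ = _ := by rw [h2, mul_one]

/-- Termwise, `y^l - 1 ≤ l (y - 1) y^l`, and `y ≤ e^d` leaves the decay `e^{-dl}` out of `e^{-2dl}`;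
the term `1 / (ζ - 1)` stays away from its pole. A bound linear in `y - 1` is needed to beat the
factor `√n` in front of the series. -/
lemma exists_norm_szegoSeries_sub_le {κ d : ℝ} (hκ : 0 < κ) (hd : 0 < d) {ω : ℂ} (hω : ‖ω‖ = 1)
    (hω1 : ω ≠ 1) :
    ∃ C > 0, ∃ η > 0, ∀ x, 0 ≤ x → x ≤ 1 → ∀ y : ℝ, 1 ≤ y → y ≤ 1 + η →
      ‖szegoSeries κ d x (ω * y) - szegoSeries κ d x ω‖ ≤ C * (y - 1) := by
  have hD : 0 < ‖ω - 1‖ := norm_pos_iff.2 (sub_ne_zero.2 hω1)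
  have hr1 := exp_neg_two_mul_lt_one hd
  have hr0 := Real.exp_pos (-(2 * d))
  set r := Real.exp (-(2 * d)) with hr
  set r' := Real.exp (-d) with hr'
  have hr'0 : 0 < r' := Real.exp_pos _
  have hr'1 : r' < 1 := Real.exp_zero ▸ Real.exp_lt_exp.2 (by linarith)
  have hrr : Real.exp d * r = r' := by rw [hr, hr', ← Real.exp_add]; congr 1; ring
  have s1 : Summable fun l : ℕ => (l : ℝ) * r' ^ l := by
    have := summable_pow_mul_geometric_of_norm_lt_one 1 (r := r')
      (by rw [Real.norm_eq_abs, abs_of_pos hr'0]; exact hr'1)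
    simpa using this
  have s2 : Summable fun l : ℕ => ((l : ℝ) + 1) * r ^ l := by
    have := summable_pow_mul_geometric_of_norm_lt_one 1 (r := r)
      (by rw [Real.norm_eq_abs, abs_of_pos hr0]; exact hr1)
    simp only [add_mul, one_mul]
    exact (by simpa using this : Summable fun l : ℕ => (l : ℝ) * r ^ l).add
      (summable_geometric_of_lt_one hr0.le hr1)
  set T₁ := ∑' l : ℕ, (l : ℝ) * r' ^ l with hT₁
  set T₂ := ∑' l : ℕ, ((l : ℝ) + 1) * r ^ l with hT₂
  have hT₁0 : 0 ≤ T₁ := tsum_nonneg fun l => by positivity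
  have hT₂0 : 0 ≤ T₂ := tsum_nonneg fun l => by positivity
  have hed : 0 < Real.exp d - 1 := by linarith [Real.add_one_le_exp d]
  refine ⟨2 / ‖ω - 1‖ ^ 2 + κ⁻¹ * T₁ + κ * T₂, by positivity, min (Real.exp d - 1) (‖ω - 1‖ / 2),
    by positivity, fun x hx0 hx1 y hy hyη => ?_⟩
  have hy0 : 0 < y := by linarith
  have hyd : y ≤ Real.exp d := by linarith [min_le_left (Real.exp d - 1) (‖ω - 1‖ / 2)]
  have hyD : y - 1 ≤ ‖ω - 1‖ / 2 := by linarith [min_le_right (Real.exp d - 1) (‖ω - 1‖ / 2)]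
  have hy1 : 0 ≤ y - 1 := by linarith
  have a1 : ‖1 / (ω * y - 1) - 1 / (ω - 1)‖ ≤ 2 / ‖ω - 1‖ ^ 2 * (y - 1) := by
    have h1 : ‖ω - 1‖ / 2 ≤ ‖ω * y - 1‖ := by
      have h2 : ω - 1 = (ω * y - 1) - ω * ((y - 1 : ℝ) : ℂ) := by push_cast; ring
      have h3 := norm_sub_le (ω * y - 1) (ω * ((y - 1 : ℝ) : ℂ))
      rw [← h2, norm_mul, hω, one_mul, Complex.norm_real, Real.norm_eq_abs, abs_of_nonneg hy1] at h3
      linarith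
    have h0 : ω * y - 1 ≠ 0 := norm_pos_iff.1 (by linarith)
    have h2 : 1 / (ω * y - 1) - 1 / (ω - 1) =
        -(ω * ((y - 1 : ℝ) : ℂ)) / ((ω * y - 1) * (ω - 1)) := by
      have := sub_ne_zero.2 hω1
      push_cast
      field_simp
      ring
    rw [h2, norm_div, norm_neg, norm_mul, norm_mul, hω, one_mul, Complex.norm_real,
      Real.norm_eq_abs, abs_of_nonneg hy1]
    calc (y - 1) / (‖ω * y - 1‖ * ‖ω - 1‖) ≤ (y - 1) / (‖ω - 1‖ / 2 * ‖ω - 1‖) := by gcongr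
      _ = _ := by field_simp
  have b1 : ∀ l : ℕ, ‖(ω * y) ^ l * (gapWeight κ d (l - x) : ℂ)
      - ω ^ l * (gapWeight κ d (l - x) : ℂ)‖ ≤ κ⁻¹ * (y - 1) * (l * r' ^ l) := fun l => by
    have e1 : (ω * y) ^ l * (gapWeight κ d (l - x) : ℂ) - ω ^ l * (gapWeight κ d (l - x) : ℂ) =
        ω ^ l * (((y ^ l - 1) * gapWeight κ d (l - x) : ℝ) : ℂ) := by push_cast; ring
    rw [e1, norm_mul, norm_pow, hω, one_pow, one_mul, Complex.norm_real, Real.norm_eq_abs, abs_mul,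
      abs_of_nonneg (sub_nonneg.2 (one_le_pow₀ hy))]
    calc (y ^ l - 1) * |gapWeight κ d (l - x)| ≤ (l * (y - 1) * y ^ l) * (κ⁻¹ * r ^ l) :=
          mul_le_mul (pow_sub_one_le hy l) (abs_gapWeight_nat_le hκ hd hx1 l) (abs_nonneg _)
            (by positivity)
      _ = κ⁻¹ * (y - 1) * (l * (y * r) ^ l) := by rw [mul_pow]; ring
      _ ≤ _ := by
        have : y * r ≤ r' := by rw [← hrr]; gcongr
        gcongr
  have b2 : ∀ l : ℕ, ‖((ω * y)⁻¹) ^ (l + 1) * ((1 - gapWeight κ d (-((l : ℝ) + 1) - x) : ℝ) : ℂ)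
      - (ω⁻¹) ^ (l + 1) * ((1 - gapWeight κ d (-((l : ℝ) + 1) - x) : ℝ) : ℂ)‖ ≤
      κ * (y - 1) * (((l : ℝ) + 1) * r ^ l) := fun l => by
    have e1 : ((ω * y)⁻¹) ^ (l + 1) * ((1 - gapWeight κ d (-((l : ℝ) + 1) - x) : ℝ) : ℂ)
        - (ω⁻¹) ^ (l + 1) * ((1 - gapWeight κ d (-((l : ℝ) + 1) - x) : ℝ) : ℂ) =
        (ω⁻¹) ^ (l + 1) * ((((y⁻¹) ^ (l + 1) - 1) *
          (1 - gapWeight κ d (-((l : ℝ) + 1) - x)) : ℝ) : ℂ) := by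
      rw [mul_inv, mul_pow]
      push_cast
      ring
    rw [e1, norm_mul, norm_pow, norm_inv, hω, inv_one, one_pow, one_mul, Complex.norm_real,
      Real.norm_eq_abs, abs_mul]
    have h1 := one_sub_inv_pow_le hy (l + 1)
    push_cast at h1
    calc _ ≤ ((l : ℝ) + 1) * (y - 1) * (κ * r ^ l) :=
          mul_le_mul h1 (abs_one_sub_gapWeight_neg_le hκ hd hx0 l) (abs_nonneg _) (by positivity)
      _ = _ := by ring
  have n1 : ∀ l : ℕ, ‖ω ^ l * (gapWeight κ d (l - x) : ℂ)‖ ≤ κ⁻¹ * r ^ l :=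
    fun l => by
      rw [norm_mul, norm_pow, hω, one_pow, one_mul, Complex.norm_real]
      exact abs_gapWeight_nat_le hκ hd hx1 l
  have n2 : ∀ l : ℕ, ‖(ω⁻¹) ^ (l + 1) * ((1 - gapWeight κ d (-((l : ℝ) + 1) - x) : ℝ) : ℂ)‖ ≤
      κ * r ^ l := fun l => by
    rw [norm_mul, norm_pow, norm_inv, hω, inv_one, one_pow, one_mul, Complex.norm_real]
    exact abs_one_sub_gapWeight_neg_le hκ hd hx0 l
  have u1 := (norm_tsum_tail_le hr0.le hr1 n1 0).1
  have u2 := (norm_tsum_tail_le hr0.le hr1 n2 0).1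
  have c1 := (s1.mul_left (κ⁻¹ * (y - 1))).of_norm_bounded b1
  have c2 := (s2.mul_left (κ * (y - 1))).of_norm_bounded b2
  have d1 := tsum_of_norm_bounded (s1.hasSum.mul_left (κ⁻¹ * (y - 1))) b1
  have d2 := tsum_of_norm_bounded (s2.hasSum.mul_left (κ * (y - 1))) b2
  rw [← hT₁] at d1
  rw [← hT₂] at d2
  have e1 : ∑' l : ℕ, (ω * y) ^ l * (gapWeight κ d (l - x) : ℂ) =
      ∑' l : ℕ, ω ^ l * (gapWeight κ d (l - x) : ℂ) + ∑' l : ℕ,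
        ((ω * y) ^ l * (gapWeight κ d (l - x) : ℂ) - ω ^ l * (gapWeight κ d (l - x) : ℂ)) := by
    rw [← u1.tsum_add c1]
    simp
  have e2 : ∑' l : ℕ, ((ω * y)⁻¹) ^ (l + 1) *
        ((1 - gapWeight κ d (-((l : ℝ) + 1) - x) : ℝ) : ℂ) =
      ∑' l : ℕ, (ω⁻¹) ^ (l + 1) * ((1 - gapWeight κ d (-((l : ℝ) + 1) - x) : ℝ) : ℂ) + ∑' l : ℕ,
        (((ω * y)⁻¹) ^ (l + 1) * ((1 - gapWeight κ d (-((l : ℝ) + 1) - x) : ℝ) : ℂ)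
      - (ω⁻¹) ^ (l + 1) * ((1 - gapWeight κ d (-((l : ℝ) + 1) - x) : ℝ) : ℂ)) := by
    rw [← u2.tsum_add c2]
    simp only [add_sub_cancel]
  rw [szegoSeries, szegoSeries, e1, e2]
  calc _ = ‖(1 / (ω * y - 1) - 1 / (ω - 1)) + ∑' l : ℕ,
        ((ω * y) ^ l * (gapWeight κ d (l - x) : ℂ) - ω ^ l * (gapWeight κ d (l - x) : ℂ))
        - ∑' l : ℕ, (((ω * y)⁻¹) ^ (l + 1) * ((1 - gapWeight κ d (-((l : ℝ) + 1) - x) : ℝ) : ℂ)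
      - (ω⁻¹) ^ (l + 1) * ((1 - gapWeight κ d (-((l : ℝ) + 1) - x) : ℝ) : ℂ))‖ := by
        congr 1; ring
    _ ≤ _ := (norm_sub_le _ _).trans (add_le_add ((norm_add_le _ _).trans (add_le_add a1 d1)) d2)
    _ = _ := by ring

/-- Off the unit circle, the Abel-summed series is the convergent bilateral series. -/
lemma tsum_int_eq_szegoSeries {κ d x : ℝ} (hκ : 0 < κ) (hd : 0 < d) (hx0 : 0 ≤ x) (hx1 : x ≤ 1)
    {ζ : ℂ} (hζ1 : 1 < ‖ζ‖) (hζ2 : ‖ζ‖ < Real.exp (2 * d)) :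
    ∑' l : ℤ, ζ ^ l * (gapWeight κ d (l - x) : ℂ) = szegoSeries κ d x ζ := by
  have hζ0 : ζ ≠ 0 := norm_pos_iff.1 (by linarith)
  have hζi : ‖ζ⁻¹‖ < 1 := by rw [norm_inv]; exact inv_lt_one_of_one_lt₀ hζ1
  have hr1 := exp_neg_two_mul_lt_one hd
  have hr0 := Real.exp_pos (-(2 * d))
  set r := Real.exp (-(2 * d)) with hr
  have hζr : ‖ζ‖ * r < 1 := by
    have : Real.exp (2 * d) * r = 1 := by rw [hr, ← Real.exp_add, add_neg_cancel, Real.exp_zero]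
    rw [← this]
    gcongr
  have u1 : Summable fun l : ℕ => ζ ^ l * (gapWeight κ d (l - x) : ℂ) := by
    refine (norm_tsum_tail_le (C := κ⁻¹) (r := ‖ζ‖ * r) (by positivity) hζr (fun l => ?_) 0).1
    rw [norm_mul, norm_pow, Complex.norm_real, mul_pow]
    calc ‖ζ‖ ^ l * ‖gapWeight κ d (l - x)‖ ≤ ‖ζ‖ ^ l * (κ⁻¹ * r ^ l) := by
          gcongr
          exact abs_gapWeight_nat_le hκ hd hx1 l
      _ = _ := by ring
  have u2 : Summable fun l : ℕ =>
      (ζ⁻¹) ^ (l + 1) * ((1 - gapWeight κ d (-((l : ℝ) + 1) - x) : ℝ) : ℂ) := by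
    refine (norm_tsum_tail_le (C := κ) (r := r) hr0.le hr1 (fun l => ?_) 0).1
    rw [norm_mul, norm_pow, Complex.norm_real]
    calc ‖ζ⁻¹‖ ^ (l + 1) * ‖1 - gapWeight κ d (-((l : ℝ) + 1) - x)‖ ≤ 1 * (κ * r ^ l) :=
          mul_le_mul (pow_le_one₀ (norm_nonneg _) hζi.le) (abs_one_sub_gapWeight_neg_le hκ hd hx0 l)
            (norm_nonneg _) zero_le_one
      _ = _ := one_mul _
  -- For `|ζ| > 1` the Abel term is itself a geometric series over the negative indices, and it
  -- supplies the `1` in `1 - (1 - G)`.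
  have u3 : HasSum (fun l : ℕ => (ζ⁻¹) ^ (l + 1)) (1 / (ζ - 1)) := by
    have h1 := (hasSum_geometric_of_norm_lt_one hζi).mul_right ζ⁻¹
    have h2 : (1 - ζ⁻¹)⁻¹ * ζ⁻¹ = 1 / (ζ - 1) := by
      rw [← mul_inv, sub_mul, one_mul, inv_mul_cancel₀ hζ0, one_div]
    rw [← h2]
    simpa only [pow_succ] using h1
  have u4 := u3.sub u2.hasSum
  have h1 : HasSum (fun l : ℕ => ζ ^ (l : ℤ) * (gapWeight κ d ((l : ℤ) - x) : ℂ))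
      (∑' l : ℕ, ζ ^ l * (gapWeight κ d (l - x) : ℂ)) := by
    simpa using u1.hasSum
  have h2 : (fun l : ℕ => ζ ^ (-((l : ℤ) + 1)) *
      (gapWeight κ d (((-((l : ℤ) + 1) : ℤ) : ℝ) - x) : ℂ)) = fun l : ℕ => (ζ⁻¹) ^ (l + 1)
        - (ζ⁻¹) ^ (l + 1) * ((1 - gapWeight κ d (-((l : ℝ) + 1) - x) : ℝ) : ℂ) := by
    funext l
    rw [zpow_neg, ← inv_zpow]
    push_cast
    rw [show ((l : ℤ) + 1) = ((l + 1 : ℕ) : ℤ) by push_cast; rfl, zpow_natCast]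
    ring
  rw [← h2] at u4
  have h := HasSum.of_nat_of_neg_add_one
    (f := fun l : ℤ => ζ ^ l * (gapWeight κ d (l - x) : ℂ)) h1 u4
  rw [h.tsum_eq, szegoSeries]
  ring

/-- The curvatures in `log r` carry a factor `r²`. The resulting `r₁ / r₂` in the square root lowers
the exponent `2τ + 2`, due to `r dr = e^{2y} dy`, to the `2τ + 1` of the Szegő kernel. -/
lemma gapWeight_wells {r₁ r₂ Δ₁ Δ₂ : ℝ} (h₁ : 0 < r₁) (h₂ : 0 < r₂) (hΔ₁ : 0 < Δ₁) (hΔ₂ : 0 < Δ₂)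
    (τ : ℝ) :
    gapWeight (Real.sqrt (2 * Δ₁ * r₁ ^ 2 / (2 * Δ₂ * r₂ ^ 2))) (Real.log r₂ - Real.log r₁) τ =
      1 / (1 + (Real.sqrt (Δ₂ / Δ₁))⁻¹ * (r₁ / r₂) ^ (-(2 * τ + 1))) := by
  have e1 : Real.sqrt (2 * Δ₁ * r₁ ^ 2 / (2 * Δ₂ * r₂ ^ 2)) =
      (Real.sqrt (Δ₂ / Δ₁))⁻¹ * (r₁ / r₂) := by
    have e0 : 2 * Δ₁ * r₁ ^ 2 / (2 * Δ₂ * r₂ ^ 2) = (Δ₂ / Δ₁)⁻¹ * (r₁ / r₂) ^ 2 := by field_simp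
    rw [e0, Real.sqrt_mul (by positivity), Real.sqrt_inv, Real.sqrt_sq (by positivity)]
  have e2 : Real.exp ((2 * τ + 2) * (Real.log r₂ - Real.log r₁)) = (r₁ / r₂) ^ (-(2 * τ + 2)) := by
    rw [Real.rpow_def_of_pos (by positivity), Real.log_div h₁.ne' h₂.ne']
    congr 1; ring
  have e3 : (r₁ / r₂) ^ (-(2 * τ + 1)) = (r₁ / r₂) * (r₁ / r₂) ^ (-(2 * τ + 2)) := by
    have := Real.rpow_add (show 0 < r₁ / r₂ by positivity) 1 (-(2 * τ + 2))
    rw [Real.rpow_one] at this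
    rw [← this]
    congr 1; ring
  rw [gapWeight, e1, e2, e3, mul_assoc]

/-- The summands at negative index match because `1 / (1 + X) = 1 - 1 / (1 + X⁻¹)`. -/
lemma szegoInner_eq {Q : ℂ → ℝ} {r₁ r₂ : ℝ} (x θ₁ θ₂ : ℝ) (h₁ : 0 < r₁) (h₂ : 0 < r₂)
    (hΔ₁ : 0 < quarterLaplacian Q r₁) (hΔ₂ : 0 < quarterLaplacian Q r₂) :
    szegoInner Q r₁ r₂ x θ₁ θ₂ =
      (1 / (2 * Real.pi) * (Real.sqrt (quarterLaplacian Q r₁) / r₁) * r₁ ^ (2 * x) : ℝ) *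
      szegoSeries (Real.sqrt (2 * quarterLaplacian Q r₁ * r₁ ^ 2 / (2 * quarterLaplacian Q r₂ * r₂ ^ 2)))
        (Real.log r₂ - Real.log r₁) x (Complex.exp (Complex.I * ((θ₁ - θ₂ : ℝ) : ℂ))) := by
  have hα : 0 < Real.sqrt (quarterLaplacian Q r₂ / quarterLaplacian Q r₁) :=
    Real.sqrt_pos.2 (by positivity)
  set Δ₁ := quarterLaplacian Q r₁
  set Δ₂ := quarterLaplacian Q r₂
  set α := Real.sqrt (Δ₂ / Δ₁) with hα_def
  have hρ : 0 < r₁ / r₂ := by positivity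
  have t1 : ∀ l : ℕ, Complex.exp (Complex.I * ((θ₁ - θ₂ : ℝ) : ℂ) * ((l : ℤ) : ℂ)) /
      ((1 + α⁻¹ * (r₁ / r₂) ^ (-(2 * (l : ℝ) - 2 * x + 1)) : ℝ) : ℂ) =
      Complex.exp (Complex.I * ((θ₁ - θ₂ : ℝ) : ℂ)) ^ l *
        (gapWeight (Real.sqrt (2 * Δ₁ * r₁ ^ 2 / (2 * Δ₂ * r₂ ^ 2)))
          (Real.log r₂ - Real.log r₁) (l - x) : ℂ) := fun l => by
    rw [gapWeight_wells h₁ h₂ hΔ₁ hΔ₂, ← Complex.exp_nat_mul, one_div, Complex.ofReal_inv,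
      div_eq_mul_inv]
    congr 2
    · push_cast; ring
    · congr 4; ring
  have t2 : ∀ l : ℕ, Complex.exp (Complex.I * ((θ₁ - θ₂ : ℝ) : ℂ) * ((-((l : ℤ) + 1) : ℤ) : ℂ)) /
      ((1 + α * (r₁ / r₂) ^ (2 * (-((l : ℝ) + 1)) - 2 * x + 1) : ℝ) : ℂ) =
      (Complex.exp (Complex.I * ((θ₁ - θ₂ : ℝ) : ℂ)))⁻¹ ^ (l + 1) *
        ((1 - gapWeight (Real.sqrt (2 * Δ₁ * r₁ ^ 2 / (2 * Δ₂ * r₂ ^ 2)))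
          (Real.log r₂ - Real.log r₁) (-((l : ℝ) + 1) - x) : ℝ) : ℂ) := fun l => by
    have e1 : (1 + α * (r₁ / r₂) ^ (2 * (-((l : ℝ) + 1)) - 2 * x + 1))⁻¹ =
        1 - 1 / (1 + α⁻¹ * (r₁ / r₂) ^ (-(2 * (-((l : ℝ) + 1) - x) + 1))) := by
      have e2 : 2 * (-((l : ℝ) + 1) - x) + 1 = 2 * (-((l : ℝ) + 1)) - 2 * x + 1 := by ring
      rw [e2, Real.rpow_neg hρ.le]
      have := Real.rpow_pos_of_pos hρ (2 * (-((l : ℝ) + 1)) - 2 * x + 1)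
      field_simp
      ring
    rw [gapWeight_wells h₁ h₂ hΔ₁ hΔ₂, ← hα_def, ← e1, Complex.ofReal_inv, div_eq_mul_inv,
      ← Complex.exp_neg, ← Complex.exp_nat_mul]
    congr 2
    push_cast; ring
  simp only [szegoInner, szegoSeries]
  rw [tsum_congr t1, tsum_congr t2]

lemma szegoGap_eq {Q : ℂ → ℝ} {r₁ r₂ x : ℝ} (h₁ : 0 < r₁) (h₂ : 0 < r₂) (hx0 : 0 ≤ x)
    (hx1 : x ≤ 1) (hlt : r₁ < r₂)
    (hΔ₁ : 0 < quarterLaplacian Q r₁) (hΔ₂ : 0 < quarterLaplacian Q r₂) {z w ζ : ℂ}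
    (hzw : z * (starRingEnd ℂ) w = (r₁ : ℂ) ^ 2 * ζ) (hζ1 : 1 < ‖ζ‖)
    (hζ2 : ‖ζ‖ < Real.exp (2 * (Real.log r₂ - Real.log r₁))) :
    szegoGap Q r₁ r₂ x z w =
      (1 / (2 * Real.pi) * (Real.sqrt (quarterLaplacian Q r₁) / r₁) * r₁ ^ (2 * x) : ℝ) *
      szegoSeries (Real.sqrt (2 * quarterLaplacian Q r₁ * r₁ ^ 2 / (2 * quarterLaplacian Q r₂ * r₂ ^ 2)))
        (Real.log r₂ - Real.log r₁) x ζ := by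
  have hd : 0 < Real.log r₂ - Real.log r₁ := sub_pos.2 (Real.log_lt_log h₁ hlt)
  rw [← tsum_int_eq_szegoSeries (Real.sqrt_pos.2 (by positivity)) hd hx0 hx1 hζ1 hζ2, szegoGap, hzw]
  set Δ₁ := quarterLaplacian Q r₁
  set Δ₂ := quarterLaplacian Q r₂
  have hs₁ : 0 < Real.sqrt Δ₁ := Real.sqrt_pos.2 hΔ₁
  have hs₂ : 0 < Real.sqrt Δ₂ := Real.sqrt_pos.2 hΔ₂
  have hr₁ : (r₁ : ℂ) ≠ 0 := by exact_mod_cast h₁.ne'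
  have hterm : ∀ l : ℤ, ((r₁ : ℂ) ^ 2 * ζ) ^ l /
      ((r₁ ^ (2 * (l : ℝ) + 1 - 2 * x) / Real.sqrt Δ₁ + r₂ ^ (2 * (l : ℝ) + 1 - 2 * x) / Real.sqrt Δ₂ : ℝ) : ℂ)
      = (Real.sqrt Δ₁ / r₁ * r₁ ^ (2 * x) : ℝ) * (ζ ^ l * (gapWeight
        (Real.sqrt (2 * Δ₁ * r₁ ^ 2 / (2 * Δ₂ * r₂ ^ 2))) (Real.log r₂ - Real.log r₁) (l - x) : ℂ)) := by
    intro l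
    rw [gapWeight_wells h₁ h₂ hΔ₁ hΔ₂, mul_zpow]
    set s := 2 * (l : ℝ) + 1 - 2 * x with hs
    have e0 : 2 * ((l : ℝ) - x) + 1 = s := by rw [hs]; ring
    have e1 : ((r₁ : ℂ) ^ 2) ^ l = ((r₁ ^ (2 * (l : ℝ)) : ℝ) : ℂ) := by
      rw [Real.rpow_mul h₁.le, Real.rpow_intCast, Real.rpow_two]
      push_cast; rfl
    have e2 : r₁ ^ (2 * (l : ℝ)) = r₁ ^ s * (r₁ ^ (2 * x) / r₁) := by
      rw [← Real.rpow_sub_one h₁.ne', ← Real.rpow_add h₁]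
      congr 1; rw [hs]; ring
    have e3 : (r₁ / r₂) ^ (-s) = r₂ ^ s / r₁ ^ s := by
      rw [Real.rpow_neg (by positivity), Real.div_rpow h₁.le h₂.le, inv_div]
    have p1 : 0 < r₁ ^ s := Real.rpow_pos_of_pos h₁ _
    have p2 : 0 < r₂ ^ s := Real.rpow_pos_of_pos h₂ _
    have e4 : r₁ ^ (2 * (l : ℝ)) / (r₁ ^ s / Real.sqrt Δ₁ + r₂ ^ s / Real.sqrt Δ₂) =
        (Real.sqrt Δ₁ / r₁ * r₁ ^ (2 * x)) *
          (1 / (1 + (Real.sqrt (Δ₂ / Δ₁))⁻¹ * (r₁ / r₂) ^ (-s))) := by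
      rw [e2, e3, Real.sqrt_div hΔ₂.le]
      field_simp
    rw [e0, e1, mul_comm _ (ζ ^ l), mul_div_assoc, ← Complex.ofReal_div, e4]
    push_cast
    ring
  simp only [hterm]
  rw [tsum_mul_left, ← mul_assoc, ← Complex.ofReal_mul]
  congr 2
  ring

/-! ### The kernel in logarithmic coordinates -/

lemma integral_Ioi_zero_eq_integral_exp (g : ℝ → ℝ) :
    ∫ r in Set.Ioi 0, g r = ∫ y, Real.exp y * g (Real.exp y) := by
  have h := integral_image_eq_integral_abs_deriv_smul (s := Set.univ) MeasurableSet.univ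
    (fun x _ => (Real.hasDerivAt_exp x).hasDerivWithinAt) Real.exp_injective.injOn g
  rw [Set.image_univ, Real.range_exp, Measure.restrict_univ] at h
  rw [h]
  simp only [Real.abs_exp, smul_eq_mul]

/-- Polar coordinates and `r = e^y`. Subtracting the linear part of `q` shifts the exponent `2 j +
2` by `-B n` and pulls out a factor independent of `j`. If the integral diverges, both sides are
`0`. -/
lemma monomialNormSq_eq (q : ℝ → ℝ) (r₁ B : ℝ) (n j : ℕ) :
    monomialNormSq (radialPotential q) n j =
      2 * Real.exp (-(n * (q r₁ - B * Real.log r₁))) *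
        expMoment (gapProfile q r₁ B) n (2 * (j - B * n / 2) + 2) := by
  have h1 : ∀ z : ℂ, ‖weightedMonomial (radialPotential q) n j z‖ ^ 2 =
      (fun r : ℝ => (r ^ j * Real.exp (-((n : ℝ) / 2) * q r)) ^ 2) ‖z‖ := fun z => by
    rw [weightedMonomial, norm_mul, norm_pow, Complex.norm_real, Real.norm_eq_abs, Real.abs_exp,
      radialPotential]
  have hvol : (volume : Measure ℂ).real (Metric.ball 0 1) = Real.pi := by
    rw [measureReal_def, Complex.volume_ball]
    simp
  rw [monomialNormSq, area, integral_smul_measure, ENNReal.toReal_ofReal (by positivity)]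
  simp only [h1]
  rw [integral_fun_norm_addHaar volume
    (fun r : ℝ => (r ^ j * Real.exp (-((n : ℝ) / 2) * q r)) ^ 2), hvol, Complex.finrank_real_complex,
    integral_Ioi_zero_eq_integral_exp, expMoment, mul_assoc, ← integral_const_mul]
  have h2 : ∀ y, Real.exp y * (Real.exp y ^ (2 - 1) •
        (Real.exp y ^ j * Real.exp (-((n : ℝ) / 2) * q (Real.exp y))) ^ 2) =
      Real.exp (-(n * (q r₁ - B * Real.log r₁))) *
        Real.exp ((2 * ((j : ℝ) - B * n / 2) + 2) * y - n * gapProfile q r₁ B y) := fun y => by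
    rw [smul_eq_mul, mul_pow, ← Real.exp_nat_mul, ← Real.exp_nat_mul, ← Real.exp_nat_mul,
      ← Real.exp_nat_mul, ← Real.exp_add, ← Real.exp_add, ← Real.exp_add, ← Real.exp_add,
      gapProfile]
    congr 1
    push_cast
    ring
  simp only [h2]
  have := Real.pi_pos
  simp only [smul_eq_mul, nsmul_eq_mul]
  field_simp
  norm_num

/-- The factor pulled out of the norms is the one produced by the numerator, so it cancels and only
the profile enters. The two radii enter the coefficients through `u₁ + u₂` alone. -/
lemma correlationKernel_eq (q : ℝ → ℝ) (r₁ B : ℝ) (n : ℕ) (u₁ u₂ θ₁ θ₂ : ℝ) :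
    correlationKernel (radialPotential q) n
        ((Real.exp u₁ : ℂ) * Complex.exp (Complex.I * (θ₁ : ℂ)))
        ((Real.exp u₂ : ℂ) * Complex.exp (Complex.I * (θ₂ : ℂ))) =
      (1 / 2 * Real.exp (-((n * gapProfile q r₁ B u₁ + n * gapProfile q r₁ B u₂) / 2)) : ℝ) *
        ∑ j ∈ Finset.range n, Complex.exp (Complex.I * ((θ₁ - θ₂ : ℝ) : ℂ)) ^ j *
          (coeff (gapProfile q r₁ B) n (u₁ + u₂) ((j : ℝ) - B * n / 2) : ℂ) := by
  rw [correlationKernel, Finset.mul_sum]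
  refine Finset.sum_congr rfl fun j _ => ?_
  have hnorm : ∀ u θ : ℝ, ‖(Real.exp u : ℂ) * Complex.exp (Complex.I * (θ : ℂ))‖ = Real.exp u :=
    fun u θ => by
      rw [norm_mul, Complex.norm_real, Real.norm_eq_abs, Real.abs_exp,
        mul_comm Complex.I, Complex.norm_exp_ofReal_mul_I, mul_one]
  have hmon : ∀ u θ : ℝ, weightedMonomial (radialPotential q) n j
      ((Real.exp u : ℂ) * Complex.exp (Complex.I * (θ : ℂ))) =
      ((Real.exp u ^ j * Real.exp (-((n : ℝ) / 2) * q (Real.exp u)) : ℝ) : ℂ) *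
        Complex.exp (Complex.I * (θ : ℂ)) ^ j := fun u θ => by
    rw [weightedMonomial, radialPotential, hnorm, mul_pow]
    push_cast
    ring
  have hconj : (starRingEnd ℂ) (Complex.exp (Complex.I * (θ₂ : ℂ))) =
      Complex.exp (-(Complex.I * (θ₂ : ℂ))) := by
    rw [← Complex.exp_conj, map_mul, Complex.conj_I, Complex.conj_ofReal, neg_mul]
  have hω : Complex.exp (Complex.I * ((θ₁ - θ₂ : ℝ) : ℂ)) =
      Complex.exp (Complex.I * (θ₁ : ℂ)) * Complex.exp (-(Complex.I * (θ₂ : ℂ))) := by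
    rw [← Complex.exp_add]
    congr 1; push_cast; ring
  have hreal : (Real.exp u₁ ^ j * Real.exp (-((n : ℝ) / 2) * q (Real.exp u₁))) *
      (Real.exp u₂ ^ j * Real.exp (-((n : ℝ) / 2) * q (Real.exp u₂))) =
      2 * Real.exp (-(n * (q r₁ - B * Real.log r₁))) *
        (1 / 2 * Real.exp (-((n * gapProfile q r₁ B u₁ + n * gapProfile q r₁ B u₂) / 2)) *
        Real.exp (((j : ℝ) - B * n / 2) * (u₁ + u₂))) := by
    have e1 : ∀ a b c : ℝ, 2 * Real.exp a * (1 / 2 * Real.exp b * Real.exp c) =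
        Real.exp (a + b + c) := fun a b c => by rw [Real.exp_add, Real.exp_add]; ring
    rw [e1, ← Real.exp_nat_mul, ← Real.exp_nat_mul, ← Real.exp_add, ← Real.exp_add, ← Real.exp_add]
    congr 1
    simp only [gapProfile]
    ring
  rw [hmon, hmon, map_mul, map_pow, Complex.conj_ofReal, hconj, monomialNormSq_eq q r₁ B, hω,
    mul_mul_mul_comm, ← Complex.ofReal_mul, hreal, ← mul_pow, coeff]
  have hE : ((2 * Real.exp (-(n * (q r₁ - B * Real.log r₁))) : ℝ) : ℂ) ≠ 0 := by
    exact_mod_cast (by positivity : 2 * Real.exp (-(n * (q r₁ - B * Real.log r₁))) ≠ 0)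
  rw [Complex.ofReal_mul (2 * Real.exp (-(n * (q r₁ - B * Real.log r₁)))),
    Complex.ofReal_mul (2 * Real.exp (-(n * (q r₁ - B * Real.log r₁)))), mul_assoc,
    mul_div_mul_left _ _ hE, Complex.ofReal_mul, Complex.ofReal_div]
  ring

namespace IsGapPotential

variable {q : ℝ → ℝ} {σ : Measure ℂ} {N : ℕ} {a b : ℕ → ℝ} {k : ℕ}

/-- The gap profile is a double well with minima at the two edges of the gap. -/
lemma exists_doubleWell (h : IsGapPotential q σ N a b k) :
    ∃ C c δ : ℝ, DoubleWell (gapProfile q (b k) (gapSlope q σ (b k) (a (k + 1))))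
      (Real.log (b k)) (Real.log (a (k + 1)))
      (2 * quarterLaplacian (radialPotential q) (b k : ℂ) * b k ^ 2)
      (2 * quarterLaplacian (radialPotential q) (a (k + 1) : ℂ) * a (k + 1) ^ 2) C c δ := by
  have h1 := h.inner_pos
  have h12 := h.gap_lt
  have h2 := h1.trans h12
  have hΔ₁ := h.quarterLaplacian_pos (Or.inl rfl)
  have hΔ₂ := h.quarterLaplacian_pos (Or.inr rfl)
  obtain ⟨C₁, hC₁, δ₁, hδ₁, e₁⟩ := h.exists_gapProfile_expansion (Or.inl rfl)
  obtain ⟨C₂, hC₂, δ₂, hδ₂, e₂⟩ := h.exists_gapProfile_expansion (Or.inr rfl)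
  set v := gapProfile q (b k) (gapSlope q σ (b k) (a (k + 1))) with hv
  set α₁ := 2 * quarterLaplacian (radialPotential q) (b k : ℂ) * b k ^ 2 with hα₁
  set α₂ := 2 * quarterLaplacian (radialPotential q) (a (k + 1) : ℂ) * a (k + 1) ^ 2 with hα₂
  have hα₁0 : 0 < α₁ := by positivity
  have hα₂0 : 0 < α₂ := by positivity
  set y₁ := Real.log (b k)
  set y₂ := Real.log (a (k + 1))
  have hy : y₁ < y₂ := Real.log_lt_log h1 h12
  set C := C₁ + C₂ with hC
  have hC0 : 0 < C := by positivity
  set δ := min (min (δ₁ / 2) (δ₂ / 2)) (min ((y₂ - y₁) / 3) (min (α₁ / 2 / C) (α₂ / 2 / C))) with hδ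
  have hd : 0 < y₂ - y₁ := sub_pos.2 hy
  have hδ0 : 0 < δ := by positivity
  have m1 : δ ≤ δ₁ / 2 := (min_le_left _ _).trans (min_le_left _ _)
  have m2 : δ ≤ δ₂ / 2 := (min_le_left _ _).trans (min_le_right _ _)
  have m3 : δ ≤ (y₂ - y₁) / 3 := (min_le_right _ _).trans (min_le_left _ _)
  have m4 : δ ≤ α₁ / 2 / C := ((min_le_right _ _).trans (min_le_right _ _)).trans (min_le_left _ _)
  have m5 : δ ≤ α₂ / 2 / C := ((min_le_right _ _).trans (min_le_right _ _)).trans (min_le_right _ _)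
  obtain ⟨c, hc, hfar⟩ := h.exists_gapProfile_ge hδ0
  refine ⟨C, c, δ, ?_⟩
  exact {
    measurable := (h.lowerSemicontinuous_gapProfile _).measurable
    lt := hy
    α₁_pos := hα₁0
    α₂_pos := hα₂0
    C_pos := hC0
    c_pos := hc
    δ_pos := hδ0
    two_mul_lt := by linarith
    small₁ := by rw [mul_comm]; exact (le_div_iff₀ hC0).1 m4
    small₂ := by rw [mul_comm]; exact (le_div_iff₀ hC0).1 m5
    near₁ := fun y hy => (e₁ y (by linarith)).trans (by gcongr; linarith)
    near₂ := fun y hy => (e₂ y (by linarith)).trans (by gcongr; linarith)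
    far := hfar }

end IsGapPotential

/-! ### Microscopic coordinates at the inner edge -/

lemma abs_log_one_add_sub_le {p : ℝ} (hp : |p| ≤ 1 / 2) : |Real.log (1 + p) - p| ≤ 2 * p ^ 2 := by
  obtain ⟨h1, h2⟩ := abs_le.1 hp
  have h0 : 0 < 1 + p := by linarith
  have h3 := Real.log_le_sub_one_of_pos h0
  have h4 := Real.one_sub_inv_le_log_of_pos h0
  have h5 : p - 2 * p ^ 2 ≤ 1 - (1 + p)⁻¹ := by
    rw [← one_div, one_sub_div h0.ne', le_div_iff₀ h0]
    nlinarith [sq_nonneg p]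
  rw [abs_le]
  constructor <;> nlinarith [sq_nonneg p]

/-- Near a nondegenerate zero minimum at `y₁`, the profile at `y₁ + log (1 + p)` is quadratic in
`p` up to a cubic error. -/
lemma exists_abs_well_log_sub_le {v : ℝ → ℝ} {y₁ α C δ : ℝ} (hα : 0 < α) (hC : 0 < C) (hδ : 0 < δ)
    (hv : ∀ y, |y - y₁| ≤ δ → |v y - α * (y - y₁) ^ 2| ≤ C * |y - y₁| ^ 3) :
    ∃ C' > 0, ∃ η > 0, η ≤ 1 / 2 ∧ ∀ p, |p| ≤ η →
      |Real.log (1 + p)| ≤ 2 * |p| ∧ |v (y₁ + Real.log (1 + p)) - α * p ^ 2| ≤ C' * |p| ^ 3 := by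
  refine ⟨8 * C + 6 * α, by positivity, min (1 / 2) (δ / 2), by positivity, min_le_left _ _,
    fun p hp => ?_⟩
  have h1 := abs_log_one_add_sub_le (hp.trans (min_le_left _ _))
  have hp2 := hp.trans (min_le_left _ _)
  have hpδ := hp.trans (min_le_right _ _)
  have hp0 := abs_nonneg p
  set l := Real.log (1 + p)
  have h2 : |l| ≤ 2 * |p| := by
    have h3 : |l| ≤ |l - p| + |p| := by simpa using abs_add_le (l - p) p
    have h4 : p ^ 2 = |p| * |p| := by rw [← sq, sq_abs]
    rw [h4] at h1
    nlinarith
  refine ⟨h2, ?_⟩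
  have h3 := hv (y₁ + l) (by rw [add_sub_cancel_left]; linarith)
  rw [add_sub_cancel_left] at h3
  have h4 : |α * l ^ 2 - α * p ^ 2| ≤ 6 * α * |p| ^ 3 := by
    have e1 : α * l ^ 2 - α * p ^ 2 = α * ((l - p) * (l + p)) := by ring
    rw [e1, abs_mul, abs_mul, abs_of_pos hα]
    have h5 : |l + p| ≤ 3 * |p| := (abs_add_le _ _).trans (by linarith)
    calc α * (|l - p| * |l + p|) ≤ α * (2 * p ^ 2 * (3 * |p|)) := by gcongr
      _ = 6 * α * (p ^ 2 * |p|) := by ring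
      _ = 6 * α * |p| ^ 3 := by rw [← sq_abs p]; ring
  calc |v (y₁ + l) - α * p ^ 2| ≤ |v (y₁ + l) - α * l ^ 2| + |α * l ^ 2 - α * p ^ 2| :=
        abs_sub_le _ _ _
    _ ≤ C * (2 * |p|) ^ 3 + 6 * α * |p| ^ 3 := by
      refine add_le_add (h3.trans ?_) h4
      gcongr
    _ = _ := by ring

/-- The relative displacement `t / √(2 n Δ) / r`, its logarithm, and the profile there. -/
lemma exists_edge_estimates {v : ℝ → ℝ} {r Δ C δ : ℝ} (hr : 0 < r) (hΔ : 0 < Δ) (hC : 0 < C)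
    (hδ : 0 < δ) (hv : ∀ y, |y - Real.log r| ≤ δ →
      |v y - 2 * Δ * r ^ 2 * (y - Real.log r) ^ 2| ≤ C * |y - Real.log r| ^ 3)
    {T₀ : ℝ} (hT₀ : 0 ≤ T₀) :
    ∃ M ≥ 0, ∀ᶠ n : ℕ in atTop, ∀ t, |t| ≤ T₀ → ∃ p u : ℝ,
      r + t / Real.sqrt (2 * n * Δ) = Real.exp u ∧ Real.exp u = r * (1 + p) ∧
      |p| ≤ M / Real.sqrt n ∧ (0 < t → 0 < p) ∧ |u - Real.log r| ≤ M / Real.sqrt n ∧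
      |n * v u - t ^ 2| ≤ M / Real.sqrt n := by
  obtain ⟨C', hC', η, hη, hη2, hest⟩ :=
    exists_abs_well_log_sub_le (v := v) (y₁ := Real.log r) (α := 2 * Δ * r ^ 2) (by positivity)
      hC hδ hv
  -- With `p = t / (s √n)` the quadratic part of `n v` is exactly `t²`, and only the cubic error
  -- contributes.
  set s := Real.sqrt (2 * Δ) * r with hs
  have hs0 : 0 < s := mul_pos (Real.sqrt_pos.2 (by positivity)) hr
  have hss : s ^ 2 = 2 * Δ * r ^ 2 := by rw [hs, mul_pow, Real.sq_sqrt (by positivity)]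
  set P := T₀ / s with hP
  have hP0 : 0 ≤ P := by positivity
  refine ⟨2 * P + C' * P ^ 3, by positivity, ?_⟩
  have hev := eventually_log_pow_le_sqrt (P / η) 0
  filter_upwards [hev, eventually_ge_atTop 1] with n hn hn1 t ht
  rw [pow_zero, mul_one] at hn
  have hn0 : (0 : ℝ) < n := by exact_mod_cast hn1
  set R := Real.sqrt n with hR
  have hR0 : 0 < R := Real.sqrt_pos.2 hn0
  have hRR : R ^ 2 = n := Real.sq_sqrt hn0.le
  set p := t / (s * R) with hp
  have hpP : |p| ≤ P / R := by
    rw [hp, abs_div, abs_of_pos (show 0 < s * R by positivity), hP, div_div]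
    gcongr
  have hpη : |p| ≤ η := by
    refine hpP.trans ?_
    rw [div_le_iff₀ hR0]
    rw [div_le_iff₀ hη] at hn
    linarith
  obtain ⟨e1, e2⟩ := hest p hpη
  have hp1 : 0 < 1 + p := by linarith [(abs_le.1 (hpη.trans hη2)).1]
  have hsq : Real.sqrt (2 * n * Δ) = Real.sqrt (2 * Δ) * R := by
    rw [hR, ← Real.sqrt_mul (by positivity)]
    congr 1; ring
  have hexp : Real.exp (Real.log r + Real.log (1 + p)) = r * (1 + p) := by
    rw [Real.exp_add, Real.exp_log hr, Real.exp_log hp1]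
  have hsΔ : 0 < Real.sqrt (2 * Δ) := Real.sqrt_pos.2 (by positivity)
  have hPR : 0 ≤ P / R := by positivity
  have hCR : 0 ≤ C' * P ^ 3 / R := by positivity
  have hM : (2 * P + C' * P ^ 3) / R = 2 * (P / R) + C' * P ^ 3 / R := by ring
  refine ⟨p, Real.log r + Real.log (1 + p), ?_, hexp, ?_, ?_, ?_, ?_⟩
  · rw [hexp, hsq, hp, hs]
    field_simp
  · rw [hM]; linarith
  · intro h; rw [hp]; positivity
  · rw [add_sub_cancel_left, hM]; linarith
  · have e3 : (n : ℝ) * (2 * Δ * r ^ 2 * p ^ 2) = t ^ 2 := by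
      rw [← hss, hp, ← hRR]
      field_simp
    have e4 : n * v (Real.log r + Real.log (1 + p)) - t ^ 2 =
        n * (v (Real.log r + Real.log (1 + p)) - 2 * Δ * r ^ 2 * p ^ 2) := by
      rw [← e3]; ring
    rw [e4, abs_mul, abs_of_pos hn0, hM]
    calc (n : ℝ) * |v (Real.log r + Real.log (1 + p)) - 2 * Δ * r ^ 2 * p ^ 2|
        ≤ R ^ 2 * (C' * (P / R) ^ 3) := by
          rw [hRR]
          gcongr
          exact e2.trans (by gcongr)
      _ = C' * P ^ 3 / R := by field_simp
      _ ≤ _ := by linarith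

lemma exp_I_mul_ne_one {θ₁ θ₂ : ℝ} (hθ₁ : 0 ≤ θ₁ ∧ θ₁ < 2 * Real.pi)
    (hθ₂ : 0 ≤ θ₂ ∧ θ₂ < 2 * Real.pi) (hθ : θ₁ ≠ θ₂) :
    Complex.exp (Complex.I * ((θ₁ - θ₂ : ℝ) : ℂ)) ≠ 1 := by
  intro h
  obtain ⟨n, hn⟩ := Complex.exp_eq_one_iff.1 h
  have h1 : θ₁ - θ₂ = n * (2 * Real.pi) := by
    have h2 : Complex.I * ((θ₁ - θ₂ : ℝ) : ℂ) = Complex.I * ((n * (2 * Real.pi) : ℝ) : ℂ) := by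
      rw [hn]; push_cast; ring
    exact_mod_cast mul_left_cancel₀ Complex.I_ne_zero h2
  have hπ := Real.pi_pos
  have h3 : n = 0 := by
    have a1 : (n : ℝ) < 1 := by
      by_contra! hc
      nlinarith
    have a2 : (-1 : ℝ) < n := by
      by_contra! hc
      nlinarith
    have b1 : n < 1 := by exact_mod_cast a1
    have b2 : -1 < n := by exact_mod_cast a2
    omega
  rw [h3] at h1
  apply hθ
  simp only [Int.cast_zero, zero_mul] at h1
  linarith

lemma norm_exp_I_mul (φ : ℝ) : ‖Complex.exp (Complex.I * (φ : ℂ))‖ = 1 := by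
  rw [mul_comm, Complex.norm_exp_ofReal_mul_I]

/-- Matching of constants: the powers `r₁^{±2x}` cancel, and `√(2π) √Δ / (2π r₁) = r₁⁻² √(2Δ r₁² /
π) / 2`. -/
lemma edgePrefactor_mul {n : ℕ} {r₁ Δ y s t θ₁ θ₂ : ℝ} (h₁ : 0 < r₁) (hΔ : 0 < Δ) (hy : 0 ≤ y)
    (X : ℂ) :
    edgePrefactor n r₁ y s t θ₁ θ₂ *
        ((1 / (2 * Real.pi) * (Real.sqrt Δ / r₁) * r₁ ^ (2 * Int.fract y) : ℝ) * X) =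
      (1 / 2 * Real.exp (-((t ^ 2 + s ^ 2) / 2)) : ℝ) *
        (Complex.exp (Complex.I * ((θ₁ - θ₂ : ℝ) : ℂ)) ^ ⌊y⌋₊ *
        ((Real.sqrt n * (Real.exp (-(2 * Real.log r₁)) *
          Real.sqrt (2 * Δ * r₁ ^ 2 / Real.pi)) : ℝ) * X)) := by
  have hπ := Real.pi_pos
  have e1 : Complex.exp (Complex.I * ((θ₁ - θ₂ : ℝ) : ℂ) * ((⌊y⌋ : ℤ) : ℂ)) =
      Complex.exp (Complex.I * ((θ₁ - θ₂ : ℝ) : ℂ)) ^ ⌊y⌋₊ := by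
    rw [← Complex.exp_nat_mul, ← Int.natCast_floor_eq_floor hy, Int.cast_natCast, mul_comm]
  have e2 : Real.sqrt (2 * Real.pi * n) * Real.exp (-(t ^ 2 + s ^ 2) / 2) *
      r₁ ^ (-(2 * Int.fract y)) * (1 / (2 * Real.pi) * (Real.sqrt Δ / r₁) * r₁ ^ (2 * Int.fract y)) =
      1 / 2 * Real.exp (-((t ^ 2 + s ^ 2) / 2)) * (Real.sqrt n * (Real.exp (-(2 * Real.log r₁)) *
          Real.sqrt (2 * Δ * r₁ ^ 2 / Real.pi))) := by
    have a1 : Real.exp (-(2 * Real.log r₁)) = (r₁ ^ 2)⁻¹ := by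
      rw [Real.exp_neg, two_mul, Real.exp_add, Real.exp_log h₁, sq]
    have a2 : Real.sqrt (2 * Δ * r₁ ^ 2 / Real.pi) = Real.sqrt (2 * Real.pi) * Real.sqrt Δ * r₁ / Real.pi := by
      rw [← Real.sqrt_mul (by positivity), eq_div_iff hπ.ne',
        ← Real.sqrt_sq h₁.le, ← Real.sqrt_mul (by positivity)]
      conv_lhs => rw [← Real.sqrt_sq hπ.le, ← Real.sqrt_mul (by positivity)]
      congr 1
      rw [Real.sqrt_sq h₁.le, Real.sqrt_sq hπ.le]
      field_simp
    have a3 : r₁ ^ (-(2 * Int.fract y)) * r₁ ^ (2 * Int.fract y) = 1 := by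
      rw [← Real.rpow_add h₁, neg_add_cancel, Real.rpow_zero]
    have a4 : -(t ^ 2 + s ^ 2) / 2 = -((t ^ 2 + s ^ 2) / 2) := by ring
    rw [a1, a2, a4, Real.sqrt_mul (by positivity)]
    calc _ = Real.sqrt (2 * Real.pi) * Real.sqrt n * Real.exp (-((t ^ 2 + s ^ 2) / 2)) *
          (1 / (2 * Real.pi) * (Real.sqrt Δ / r₁)) *
          (r₁ ^ (-(2 * Int.fract y)) * r₁ ^ (2 * Int.fract y)) := by ring
      _ = _ := by rw [a3]; field_simp
  rw [edgePrefactor, e1]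
  calc _ = ((Real.sqrt (2 * Real.pi * n) * Real.exp (-(t ^ 2 + s ^ 2) / 2) *
      r₁ ^ (-(2 * Int.fract y)) *
        (1 / (2 * Real.pi) * (Real.sqrt Δ / r₁) * r₁ ^ (2 * Int.fract y)) : ℝ) : ℂ) *
      (Complex.exp (Complex.I * ((θ₁ - θ₂ : ℝ) : ℂ)) ^ ⌊y⌋₊ * X) := by push_cast; ring
    _ = _ := by rw [e2]; push_cast; ring

/-- Applied with `Wb` of order `√n` and `δ₁` of order `1 / √n`, so replacing the exact prefactor by
its Gaussian limit costs `O(1)`. -/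
lemma norm_mul_sub_le {E E₀ δ₁ δ₂ Wb : ℝ} {S P : ℂ} (hE : |E| ≤ 1) (hE₀ : |E - E₀| ≤ δ₁)
    (hS : ‖S - P‖ ≤ δ₂) (hP : ‖P‖ ≤ Wb) (hδ₁ : 0 ≤ δ₁) :
    ‖(E : ℂ) * S - E₀ * P‖ ≤ δ₂ + δ₁ * Wb := by
  have e : (E : ℂ) * S - E₀ * P = E * (S - P) + ((E - E₀ : ℝ) : ℂ) * P := by push_cast; ring
  rw [e]
  refine (norm_add_le _ _).trans ?_
  rw [norm_mul, norm_mul, Complex.norm_real, Complex.norm_real, Real.norm_eq_abs, Real.norm_eq_abs]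
  have h0 : 0 ≤ ‖S - P‖ := norm_nonneg _
  have h1 : |E| * ‖S - P‖ ≤ δ₂ := (mul_le_of_le_one_left h0 hE).trans hS
  have h2 : |E - E₀| * ‖P‖ ≤ δ₁ * Wb := mul_le_mul hE₀ hP (norm_nonneg _) hδ₁
  linarith

lemma half_exp_estimates {x y x' y' ε : ℝ} (hx : 0 ≤ x) (hy : 0 ≤ y) (hx' : 0 ≤ x') (hy' : 0 ≤ y')
    (h₁ : |x - x'| ≤ ε) (h₂ : |y - y'| ≤ ε) :
    |1 / 2 * Real.exp (-((x + y) / 2))| ≤ 1 ∧ |1 / 2 * Real.exp (-((x' + y') / 2))| ≤ 1 ∧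
      |1 / 2 * Real.exp (-((x + y) / 2)) - 1 / 2 * Real.exp (-((x' + y') / 2))| ≤ ε := by
  have e0 : ∀ z : ℝ, 0 ≤ z → |1 / 2 * Real.exp (-(z / 2))| ≤ 1 := fun z hz => by
    have : Real.exp (-(z / 2)) ≤ 1 := Real.exp_le_one_iff.2 (by linarith)
    rw [abs_of_pos (by positivity)]
    linarith
  refine ⟨e0 _ (by positivity), e0 _ (by positivity), ?_⟩
  have e1 : |Real.exp (-((x + y) / 2)) - Real.exp (-((x' + y') / 2))| ≤
      |-((x + y) / 2) - -((x' + y') / 2)| * Real.exp 0 :=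
    abs_exp_sub_exp_le (by linarith) (by linarith)
  have e2 : |-((x + y) / 2) - -((x' + y') / 2)| ≤ ε := by
    rw [abs_le] at h₁ h₂ ⊢
    constructor <;> linarith
  rw [Real.exp_zero, mul_one] at e1
  rw [← mul_sub, abs_mul, abs_of_pos (by norm_num : (0 : ℝ) < 1 / 2)]
  linarith [abs_nonneg (Real.exp (-((x + y) / 2)) - Real.exp (-((x' + y') / 2)))]

lemma one_add_mul_estimates {p₁ p₂ M R : ℝ} (hR : 1 ≤ R) (h₁ : 0 < p₁) (h₂ : 0 < p₂)
    (h₁' : p₁ ≤ M / R) (h₂' : p₂ ≤ M / R) :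
    1 < (1 + p₁) * (1 + p₂) ∧ (1 + p₁) * (1 + p₂) - 1 ≤ (2 * M + M ^ 2) / R := by
  have hR0 : 0 < R := by linarith
  have h₁₂ := mul_pos h₁ h₂
  have e1 : p₁ * p₂ ≤ M / R * (M / R) := mul_le_mul h₁' h₂' h₂.le (h₁.le.trans h₁')
  have e2 : M / R * (M / R) ≤ M ^ 2 / R := by
    rw [div_mul_div_comm, ← sq]
    gcongr
    exact le_mul_of_one_le_left hR0.le hR
  have e3 : (2 * M + M ^ 2) / R = M / R + M / R + M ^ 2 / R := by ring
  have e4 : (1 + p₁) * (1 + p₂) = 1 + p₁ + p₂ + p₁ * p₂ := by ring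
  rw [e3, e4]
  constructor <;> linarith

/-! ### The kernel at the inner edge of the gap -/

set_option maxHeartbeats 1000000 in
/-- The correlation kernel at two points near the inner edge of a gap, with an error
`O(log³ n)`. -/
theorem IsGapPotential.exists_correlationKernel_asymp {q : ℝ → ℝ} {σ : Measure ℂ} {N : ℕ}
    {a b : ℕ → ℝ} {k : ℕ} (h : IsGapPotential q σ N a b k) {θ₁ θ₂ : ℝ}
    (hθ₁ : 0 ≤ θ₁ ∧ θ₁ < 2 * Real.pi) (hθ₂ : 0 ≤ θ₂ ∧ θ₂ < 2 * Real.pi) (hθ : θ₁ ≠ θ₂) {T₀ : ℝ}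
    (hT₀ : 0 ≤ T₀) :
    ∃ C : ℝ, ∀ᶠ n : ℕ in atTop, ∀ s, |s| ≤ T₀ → ∀ t, |t| ≤ T₀ →
      ‖correlationKernel (radialPotential q) n (edgePoint (radialPotential q) n (b k) t θ₁)
          (edgePoint (radialPotential q) n (b k) s θ₂)
        - edgePrefactor n (b k) (gapSlope q σ (b k) (a (k + 1)) * n / 2) s t θ₁ θ₂ *
          szegoInner (radialPotential q) (b k) (a (k + 1))
            (Int.fract (gapSlope q σ (b k) (a (k + 1)) * n / 2)) θ₁ θ₂‖ ≤ C * Real.log n ^ 3 ∧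
      (0 < s → 0 < t →
        ‖correlationKernel (radialPotential q) n (edgePoint (radialPotential q) n (b k) t θ₁)
            (edgePoint (radialPotential q) n (b k) s θ₂)
          - edgePrefactor n (b k) (gapSlope q σ (b k) (a (k + 1)) * n / 2) s t θ₁ θ₂ *
            szegoGap (radialPotential q) (b k) (a (k + 1))
              (Int.fract (gapSlope q σ (b k) (a (k + 1)) * n / 2))
              (edgePoint (radialPotential q) n (b k) t θ₁)
              (edgePoint (radialPotential q) n (b k) s θ₂)‖ ≤ C * Real.log n ^ 3) := by
  obtain ⟨C, c, δ, hW⟩ := h.exists_doubleWell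
  have hB0 : 0 < gapSlope q σ (b k) (a (k + 1)) := by
    rw [h.gapSlope_eq]; linarith [h.innerMass_pos]
  have hB2 : gapSlope q σ (b k) (a (k + 1)) < 2 := by
    rw [h.gapSlope_eq]; linarith [h.innerMass_lt_one]
  have hv0 := h.gapProfile_nonneg
  have h1 := h.inner_pos
  have h12 := h.gap_lt
  have h2 := h1.trans h12
  have hΔ₁ := h.quarterLaplacian_pos (Or.inl rfl)
  have hΔ₂ := h.quarterLaplacian_pos (Or.inr rfl)
  set B := gapSlope q σ (b k) (a (k + 1)) with hB
  set r₁ := b k with hr₁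
  set r₂ := a (k + 1) with hr₂
  set Q := radialPotential q with hQ
  set v := gapProfile q r₁ B with hv
  set ω := Complex.exp (Complex.I * ((θ₁ - θ₂ : ℝ) : ℂ)) with hωdef
  have hω : ‖ω‖ = 1 := norm_exp_I_mul _
  have hω1 : ω ≠ 1 := exp_I_mul_ne_one hθ₁ hθ₂ hθ
  obtain ⟨M, hM, hedge⟩ := exists_edge_estimates h1 hΔ₁ hW.C_pos hW.δ_pos hW.near₁ hT₀
  obtain ⟨C₁, hC₁⟩ := hW.exists_sum_coeff_asymp hB0 hB2 (M := 2 * M) (by positivity) hω hω1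
  set d := Real.log r₂ - Real.log r₁ with hd_def
  have hd : 0 < d := sub_pos.2 hW.lt
  set κ := Real.sqrt (2 * quarterLaplacian Q r₁ * r₁ ^ 2 / (2 * quarterLaplacian Q r₂ * r₂ ^ 2))
    with hκ_def
  have hκ : 0 < κ := Real.sqrt_pos.2 (by positivity)
  set A := Real.exp (-(2 * Real.log r₁)) *
    Real.sqrt (2 * quarterLaplacian Q r₁ * r₁ ^ 2 / Real.pi) with hA
  have hA0 : 0 ≤ A := by positivity
  obtain ⟨C₂, hC₂, η, hη, hlip⟩ := exists_norm_szegoSeries_sub_le hκ hd hω hω1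
  set Sb := 1 / ‖ω - 1‖ + κ⁻¹ / (1 - Real.exp (-(2 * d))) + κ / (1 - Real.exp (-(2 * d))) with hSb
  have hed : 0 < Real.exp (2 * d) - 1 := by linarith [Real.add_one_le_exp (2 * d)]
  set η' := min η ((Real.exp (2 * d) - 1) / 2) with hη'
  have hη'0 : 0 < η' := by positivity
  set M₂ := 2 * M + M ^ 2 with hM₂
  have hM₂0 : 0 ≤ M₂ := by positivity
  refine ⟨|C₁| + M * (A * Sb) + A * (C₂ * M₂), ?_⟩
  filter_upwards [hedge, hC₁, eventually_ge_atTop 3, eventually_log_pow_le_sqrt (M₂ / η') 0]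
    with n hn1 hn2 hn3 hn4 s hs t ht
  obtain ⟨p₁, u₁, a1, a2, a3, a4, a5, a6⟩ := hn1 t ht
  obtain ⟨p₂, u₂, b1, b2, b3, b4, b5, b6⟩ := hn1 s hs
  rw [pow_zero, mul_one] at hn4
  have hn3' : (3 : ℝ) ≤ n := by exact_mod_cast hn3
  have hn0 : (0 : ℝ) < n := by linarith
  set x := Int.fract (B * n / 2) with hx
  have hx0 : 0 ≤ x := Int.fract_nonneg _
  have hx1 : x ≤ 1 := (Int.fract_lt_one _).le
  set R := Real.sqrt n with hR
  have hR1 : 1 ≤ R := by rw [hR, Real.one_le_sqrt]; linarith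
  have hR0 : 0 < R := by linarith
  have hℓ1 : 1 ≤ Real.log n := by
    rw [Real.le_log_iff_exp_le hn0]
    linarith [Real.exp_one_lt_three]
  have hℓ3 : 1 ≤ Real.log n ^ 3 := one_le_pow₀ hℓ1
  have hz : edgePoint Q n r₁ t θ₁ = (Real.exp u₁ : ℂ) * Complex.exp (Complex.I * (θ₁ : ℂ)) := by
    rw [edgePoint, a1]
  have hw : edgePoint Q n r₁ s θ₂ = (Real.exp u₂ : ℂ) * Complex.exp (Complex.I * (θ₂ : ℂ)) := by
    rw [edgePoint, b1]
  have hK := correlationKernel_eq q r₁ B n u₁ u₂ θ₁ θ₂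
  rw [← hz, ← hw] at hK
  rw [← hQ, ← hv, ← hωdef] at hK
  have hY : |u₁ + u₂ - 2 * Real.log r₁| ≤ 2 * M / R := by
    have e : u₁ + u₂ - 2 * Real.log r₁ = (u₁ - Real.log r₁) + (u₂ - Real.log r₁) := by ring
    rw [e]
    refine (abs_add_le _ _).trans ((add_le_add a5 b5).trans (le_of_eq ?_))
    ring
  have hsum := hn2 (u₁ + u₂) hY
  obtain ⟨hE1, hE₀1, hEE⟩ := half_exp_estimates (mul_nonneg hn0.le (hv0 u₁))
    (mul_nonneg hn0.le (hv0 u₂)) (sq_nonneg t) (sq_nonneg s) a6 b6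
  set E := 1 / 2 * Real.exp (-((n * v u₁ + n * v u₂) / 2)) with hE
  set E₀ := 1 / 2 * Real.exp (-((t ^ 2 + s ^ 2) / 2)) with hE₀
  have hβ : 0 ≤ B * n / 2 := by positivity
  set w₀ := 1 / (2 * Real.pi) * (Real.sqrt (quarterLaplacian Q r₁) / r₁) * r₁ ^ (2 * x) with hw₀
  have hpre : ∀ X : ℂ, edgePrefactor n r₁ (B * n / 2) s t θ₁ θ₂ * ((w₀ : ℂ) * X) =
      (E₀ : ℂ) * (ω ^ ⌊B * n / 2⌋₊ * ((R * A : ℝ) * X)) := edgePrefactor_mul h1 hΔ₁ hβ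
  have hsz := norm_szegoSeries_le hκ hd hx0 hx1 hω
  have hP : ‖ω ^ ⌊B * n / 2⌋₊ * ((R * A : ℝ) * szegoSeries κ d x ω)‖ ≤ R * A * Sb := by
    rw [norm_mul, norm_pow, hω, one_pow, one_mul, norm_mul, Complex.norm_real, Real.norm_eq_abs,
      abs_of_nonneg (by positivity)]
    gcongr
  have hinner : szegoInner Q r₁ r₂ x θ₁ θ₂ = (w₀ : ℂ) * szegoSeries κ d x ω :=
    szegoInner_eq x θ₁ θ₂ h1 h2 hΔ₁ hΔ₂
  have hSb0 : 0 ≤ Sb := (norm_nonneg _).trans hsz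
  have hgapf : ∀ {z w ζ : ℂ}, z * (starRingEnd ℂ) w = (r₁ : ℂ) ^ 2 * ζ → 1 < ‖ζ‖ →
      ‖ζ‖ < Real.exp (2 * d) → szegoGap Q r₁ r₂ x z w =
        (w₀ : ℂ) * szegoSeries κ d x ζ := szegoGap_eq h1 h2 hx0 hx1 h12 hΔ₁ hΔ₂
  clear hn2 hC₁ hn1 hedge
  clear_value w₀ E E₀ A Sb M₂ R x κ d η' v Q
  have hfirst : ‖correlationKernel Q n (edgePoint Q n r₁ t θ₁) (edgePoint Q n r₁ s θ₂)
      - edgePrefactor n r₁ (B * n / 2) s t θ₁ θ₂ * szegoInner Q r₁ r₂ x θ₁ θ₂‖ ≤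
      (|C₁| + M * (A * Sb)) * Real.log n ^ 3 := by
    rw [hinner, hpre, hK]
    refine (norm_mul_sub_le hE1 hEE hsum hP (by positivity)).trans ?_
    have e1 : M / R * (R * A * Sb) = M * (A * Sb) := by field_simp
    rw [e1, add_mul]
    refine add_le_add ?_ (le_mul_of_one_le_right (by positivity) hℓ3)
    gcongr
    exact le_abs_self _
  constructor
  · refine hfirst.trans (mul_le_mul_of_nonneg_right ?_ (by positivity))
    exact le_add_of_nonneg_right (by positivity)
  · intro hs0 ht0
    have hp₁ := a4 ht0
    have hp₂ := b4 hs0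
    rw [abs_of_pos hp₁] at a3
    rw [abs_of_pos hp₂] at b3
    set y := (1 + p₁) * (1 + p₂) with hy
    obtain ⟨hy1, hyM⟩ := one_add_mul_estimates hR1 hp₁ hp₂ a3 b3
    rw [← hM₂, ← hy] at hyM
    rw [← hy] at hy1
    have hyη : y - 1 ≤ η' := by
      refine hyM.trans ?_
      rw [div_le_iff₀ hR0]
      rw [div_le_iff₀ hη'0] at hn4
      linarith
    have hyη1 : y ≤ 1 + η := by linarith [min_le_left η ((Real.exp (2 * d) - 1) / 2)]
    have hyd : y < Real.exp (2 * d) := by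
      linarith [min_le_right η ((Real.exp (2 * d) - 1) / 2)]
    have hyn : ‖ω * (y : ℂ)‖ = y := by
      rw [norm_mul, hω, one_mul, Complex.norm_real, Real.norm_eq_abs, abs_of_pos (by linarith)]
    have hzw : edgePoint Q n r₁ t θ₁ * (starRingEnd ℂ) (edgePoint Q n r₁ s θ₂) =
        (r₁ : ℂ) ^ 2 * (ω * (y : ℂ)) := by
      rw [hz, hw, a2, b2, map_mul, Complex.conj_ofReal, ← Complex.exp_conj, map_mul, Complex.conj_I,
        Complex.conj_ofReal, mul_mul_mul_comm, ← Complex.exp_add, hωdef, hy]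
      have : Complex.I * (θ₁ : ℂ) + -Complex.I * (θ₂ : ℂ) = Complex.I * ((θ₁ - θ₂ : ℝ) : ℂ) := by
        push_cast; ring
      rw [this]
      push_cast
      ring
    have hgap := hgapf hzw (by rw [hyn]; exact hy1)
      (by rw [hyn]; exact hyd)
    have hL := hlip x hx0 hx1 y hy1.le hyη1
    -- The two Szegő kernels are the same series at `ω` and at `ω y` with `y - 1 ≤ M₂ / √n`; the
    -- Lipschitz bound offsets the factor `√n` in the prefactor.
    have hdiff : ‖edgePrefactor n r₁ (B * n / 2) s t θ₁ θ₂ * szegoInner Q r₁ r₂ x θ₁ θ₂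
        - edgePrefactor n r₁ (B * n / 2) s t θ₁ θ₂ *
          szegoGap Q r₁ r₂ x (edgePoint Q n r₁ t θ₁) (edgePoint Q n r₁ s θ₂)‖ ≤
        A * (C₂ * M₂) * Real.log n ^ 3 := by
      rw [hinner, hgap, hpre, hpre, ← mul_sub, ← mul_sub, ← mul_sub,
        norm_mul, norm_mul, norm_mul, norm_pow, hω, one_pow, one_mul, Complex.norm_real,
        Complex.norm_real, Real.norm_eq_abs, Real.norm_eq_abs, norm_sub_rev]
      have e1 : |R * A| * ‖szegoSeries κ d x (ω * y) - szegoSeries κ d x ω‖ ≤ A * (C₂ * M₂) := by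
        rw [abs_of_nonneg (by positivity)]
        calc R * A * ‖szegoSeries κ d x (ω * y) - szegoSeries κ d x ω‖ ≤
              R * A * (C₂ * (M₂ / R)) := by
              gcongr
              exact hL.trans (by gcongr)
          _ = A * (C₂ * M₂) := by field_simp
      refine ((mul_le_of_le_one_left (by positivity) hE₀1).trans e1).trans ?_
      exact le_mul_of_one_le_right (by positivity) hℓ3
    rw [add_mul]
    exact (norm_sub_le_norm_sub_add_norm_sub _ _ _).trans (add_le_add hfirst hdiff)

end CoulombGap

theorem theorem1p17 (q : ℝ → ℝ) (σ : MeasureTheory.Measure ℂ) (N : ℕ) (a b : ℕ → ℝ) (k : ℕ)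
    (hq : CoulombGap.IsGapPotential q σ N a b k)
    (r₁ r₂ B : ℝ) (hr₁ : r₁ = b k) (hr₂ : r₂ = a (k + 1))
    (hB : B = CoulombGap.gapSlope q σ r₁ r₂)
    (θ₁ θ₂ : ℝ) (hθ₁ : 0 ≤ θ₁ ∧ θ₁ < 2 * Real.pi) (hθ₂ : 0 ≤ θ₂ ∧ θ₂ < 2 * Real.pi)
    (hθ : θ₁ ≠ θ₂) (T : Set ℝ) (hT : IsCompact T) :
    ∃ (C : ℝ) (n₀ : ℕ), ∀ n : ℕ, n₀ ≤ n → ∀ s ∈ T, ∀ t ∈ T,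
      ‖CoulombGap.correlationKernel (CoulombGap.radialPotential q) n
          (CoulombGap.edgePoint (CoulombGap.radialPotential q) n r₁ t θ₁)
          (CoulombGap.edgePoint (CoulombGap.radialPotential q) n r₁ s θ₂)
        - CoulombGap.edgePrefactor n r₁ (B * n / 2) s t θ₁ θ₂ *
          CoulombGap.szegoInner (CoulombGap.radialPotential q) r₁ r₂ (Int.fract (B * n / 2)) θ₁ θ₂‖
        ≤ C * Real.log n ^ 5 ∧
      (0 < s → 0 < t →
        ‖CoulombGap.correlationKernel (CoulombGap.radialPotential q) n
            (CoulombGap.edgePoint (CoulombGap.radialPotential q) n r₁ t θ₁)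
            (CoulombGap.edgePoint (CoulombGap.radialPotential q) n r₁ s θ₂)
          - CoulombGap.edgePrefactor n r₁ (B * n / 2) s t θ₁ θ₂ *
            CoulombGap.szegoGap (CoulombGap.radialPotential q) r₁ r₂ (Int.fract (B * n / 2))
              (CoulombGap.edgePoint (CoulombGap.radialPotential q) n r₁ t θ₁)
              (CoulombGap.edgePoint (CoulombGap.radialPotential q) n r₁ s θ₂)‖
          ≤ C * Real.log n ^ 5) := by
  subst hr₁ hr₂ hB
  obtain ⟨T₀, hT₀⟩ := hT.isBounded.exists_norm_le
  obtain ⟨C, hC⟩ := hq.exists_correlationKernel_asymp hθ₁ hθ₂ hθ (le_max_right T₀ 0)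
  obtain ⟨n₀, hn₀⟩ := eventually_atTop.1 (hC.and (eventually_ge_atTop 3))
  refine ⟨|C|, n₀, fun n hn s hs t ht => ?_⟩
  obtain ⟨h1, hn3⟩ := hn₀ n hn
  obtain ⟨h2, h3⟩ := h1 s ((hT₀ s hs).trans (le_max_left _ _)) t ((hT₀ t ht).trans (le_max_left _ _))
  have hn3' : (3 : ℝ) ≤ n := by exact_mod_cast hn3
  have hℓ : 1 ≤ Real.log n := by
    rw [Real.le_log_iff_exp_le (by linarith)]
    linarith [Real.exp_one_lt_three]
  -- The threshold `n ≥ 3` gives `log n ≥ 1`, so the cubic error is absorbed; `|C|` is used because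
  -- `C` carries no sign.
  have hle : C * Real.log n ^ 3 ≤ |C| * Real.log n ^ 5 :=
    mul_le_mul (le_abs_self C) (pow_le_pow_right₀ hℓ (by norm_num)) (by positivity) (abs_nonneg C)
  exact ⟨h2.trans hle, fun h4 h5 => (h3 h4 h5).trans hle⟩
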